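/- Let $n\ge 2$ and let $\Sigma\subset\mathbb R^n$ be the image $g(\Omega)$ of a compact convex set $\Omega\subset\mathbb R^n$ (for instance a closed ball) under a map $g$ that is bilipschitz on $\Omega$ (i.e. $\frac1{L_\Omega}|x-y|\le|g(x)-g(y)|\le L_\Sigma|x-y|$ for all $x,y\in\Omega$, with some constants $L_\Omega,L_\Sigma>0$) and measure-preserving ($\mathrm{vol}(g(A))=\mathrm{vol}(A)$ for all measurable $A\subseteq\Omega$). Assume that $\partial\Sigma$ is smooth (of class $C^2$: near each of its points $\Sigma$ is a sublevel set $\{f\le 0\}$ of a $C^2$ function $f$ with non-vanishing derivative there), and that $$\kappa=\sup_{H}\kappa_H\,\mathcal R_H<\infty ,$$ where $H$ ranges over all two-dimensional affine planes in $\mathbb R^n$, $\kappa_H$ is the maximal curvature of $\partial\Sigma\cap H$ (the supremum of $|\gamma''|$ over all $C^2$ arcs $\gamma$ in $\partial\Sigma\cap H$ parametrised by arc length) and $\mathcal R_H$ is its length (one-dimensional Hausdorff measure). Let $D_\Sigma$ be the diameter of $\Sigma$, and for $\epsilon>0$ let $\Sigma^\epsilon=\{x\in\Sigma: d(x,\partial\Sigma)\ge\epsilon\}$.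 Points $u,v\in\Sigma$ see each other if $[u,v]\subseteq\Sigma$; in that case $d_\Sigma(u,v)=\frac{|a-b|\,|u-v|}{|a-u|\,|v-b|}$, where $a$ and $b$ are the endpoints, on the side of $u$ and of $v$ respectively, of the longest segment through $u$ and $v$ contained in $\Sigma$ (and $d_\Sigma(u,u)=0$). For $u$ in the interior of $\Sigma$, $P_u$ is the distribution of the point $w$ obtained by one step of Hit-and-Run from $u$: a direction is chosen uniformly from the unit sphere, and then $w$ is chosen uniformly from the largest connected chord through $u$ in this direction contained in $\Sigma$. Let $F(u)$ be defined by $\mathbb P(|w-u|\le F(u))=1/8$, i.e. $F(u)$ is the smallest $r$ with $P_u(\{x:|x-u|\le r\})\ge 1/8$. Let $\epsilon>0$, let $u,v\in\Sigma^\epsilon$ see each other, and let $\epsilon'=\frac{\epsilon}{6}\min\left(\frac{\pi}{4},\frac{\sin(\pi/8)}{\kappa}\right)$. Suppose that $$d_\Sigma(u,v)<\frac{\epsilon}{24D_\Sigma}\qquad\text{and}\qquad |u-v|<\min\left(\frac{2F(u)}{\sqrt n},\epsilon'\right).$$ Then the total variation distance of $P_u$ and $P_v$ satisfies $$|P_u-P_v|=\sup_{A\text{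 measurable}}|P_u(A)-P_v(A)|<1-\frac{\epsilon}{8e^4D_\Sigma}.$$ -/

import Mathlib

open scoped ENNReal MeasureTheory Topology

noncomputable section

namespace HitAndRun

variable {E : Type*} [NormedAddCommGroup E] [InnerProductSpace ℝ E]

/-! ### Chords, visibility, cross-ratio distance -/

/-- The parameters `t` of the largest connected piece of `{u + t • w} ∩ S` that contains `u`. -/
def chordParams (S : Set E) (u w : E) : Set ℝ :=
  connectedComponentIn {t : ℝ | u + t • w ∈ S} 0

/-- Two points see each other in `S` if the segment between them lies in `S`. -/
def Sees (S : Set E) (u v : E) : Prop := segment ℝ u v ⊆ S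

/-- The endpoint, on the side of `u`, of the longest chord of `S` through `u` and `v`. -/
def chordStart (S : Set E) (u v : E) : E := u + sInf (chordParams S u (v - u)) • (v - u)

/-- The endpoint, on the side of `v`, of the longest chord of `S` through `u` and `v`. -/
def chordEnd (S : Set E) (u v : E) : E := u + sSup (chordParams S u (v - u)) • (v - u)

/-- The cross-ratio distance `|a - b| |u - v| / (|a - u| |v - b|)` of two points that see each
other, where `a, u, v, b` lie in this order on the chord through `u` and `v`, with endpoints `a`
and `b`. It is `0` if `u = v`. -/
def crossRatioDist (S : Set E) (u v : E) : ℝ :=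
  dist (chordStart S u v) (chordEnd S u v) * dist u v /
    (dist (chordStart S u v) u * dist v (chordEnd S u v))

/-- The points of `S` at distance at least `ε` from the boundary of `S`. -/
def innerPart (S : Set E) (ε : ℝ) : Set E := {x ∈ S | ε ≤ Metric.infDist x (frontier S)}

/-! ### The assumptions on the space -/

/-- `S` is the image of a compact convex set under a bilipschitz, measure-preserving map. -/
def HasBilipschitzEmbedding [FiniteDimensional ℝ E] [MeasurableSpace E] [BorelSpace E]
    (S : Set E) : Prop :=
  ∃ (Ω : Set E) (g : E → E) (LΩ LS : ℝ),
    IsCompact Ω ∧ Convex ℝ Ω ∧ 0 < LΩ ∧ 0 < LS ∧ g '' Ω = S ∧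
    (∀ x ∈ Ω, ∀ y ∈ Ω, dist x y / LΩ ≤ dist (g x) (g y) ∧ dist (g x) (g y) ≤ LS * dist x y) ∧
    ∀ A ⊆ Ω, MeasurableSet A → MeasureTheory.volume (g '' A) = MeasureTheory.volume A

/-- `S` has a boundary of class `C²`: near each boundary point it is a sublevel set `{f ≤ 0}` of a
`C²` function with non-vanishing derivative. -/
def HasC2Boundary (S : Set E) : Prop :=
  ∀ p ∈ frontier S, ∃ f : E → ℝ,
    ContDiffAt ℝ 2 f p ∧ fderiv ℝ f p ≠ 0 ∧ ∀ᶠ x in 𝓝 p, (x ∈ S ↔ f x ≤ 0)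

/-- The (maximal) curvature of a set `C`, meant to be a curve: the supremum of `|γ''(t)|` over all
`C²` arcs `γ` in `C` that are parametrised by arc length. -/
def maxCurvature (C : Set E) : ℝ≥0∞ :=
  sSup {k | ∃ (γ : ℝ → E) (a b : ℝ), ContDiffOn ℝ 2 γ (Set.Ioo a b) ∧
    (∀ t ∈ Set.Ioo a b, γ t ∈ C ∧ ‖deriv γ t‖ = 1) ∧
    ∃ t ∈ Set.Ioo a b, k = ‖deriv (deriv γ) t‖ₑ}

/-- The curvature constant `κ` of `S`: the supremum, over all two-dimensional planes `H`, of the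
curvature of `∂S ∩ H` times the length of `∂S ∩ H`. -/
def curvatureConst [MeasurableSpace E] [BorelSpace E] (S : Set E) : ℝ≥0∞ :=
  ⨆ H : {H : AffineSubspace ℝ E // Module.finrank ℝ H.direction = 2},
    maxCurvature (frontier S ∩ (H.1 : Set E)) * μH[1] (frontier S ∩ (H.1 : Set E))

/-! ### One step of Hit-and-Run -/

variable [MeasurableSpace E] [BorelSpace E] [FiniteDimensional ℝ E]

/-- `stepProb S u A` is the probability that one step of Hit-and-Run in `S` from `u` ends in `A`:
a direction `θ` is chosen uniformly from the unit sphere, and then the next point is chosen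
uniformly from the largest chord in `S` through `u` in the direction `θ`. -/
def stepProb (S : Set E) (u : E) (A : Set E) : ℝ≥0∞ :=
  let σ : MeasureTheory.Measure (Metric.sphere (0 : E) 1) :=
    (MeasureTheory.volume : MeasureTheory.Measure E).toSphere
  (∫⁻ θ, MeasureTheory.volume (chordParams S u θ ∩ {t : ℝ | u + t • (θ : E) ∈ A}) /
    MeasureTheory.volume (chordParams S u θ) ∂σ) / σ Set.univ

/-- The radius `F(u)` of the ball about `u` that one step from `u` hits with probability `1/8`. -/
def stepRadius (S : Set E) (u : E) : ℝ :=
  sInf {r : ℝ | 1 / 8 ≤ stepProb S u (Metric.closedBall u r)}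

/-- The total variation distance between the one-step distributions from `u` and from `v`. -/
def stepTV (S : Set E) (u v : E) : ℝ :=
  ⨆ A : {A : Set E // MeasurableSet A},
    |(stepProb S u A.1).toReal - (stepProb S v A.1).toReal|

end HitAndRun

end

/-!
A step of Hit-and-Run from `u` has a density: at a point `x` that is seen from `u` it is
`2 / (σ * ℓ * ‖x - u‖ ^ (n - 1))`, where `σ` is the area of the unit sphere and `ℓ` is the length of
the chord through `u` and `x` (`stepProb_eq_lintegral`). The length of a chord through a point of
`S^ε` lies between `2ε` and the diameter `D`. So if `x` is seen from both `u` and `v`, and if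
`‖x - v‖` is not much larger than `‖x - u‖`, then the density at `x` of the step from `v` is at
least `c` times that of the step from `u`, with a `c` of the order of `ε / D`
(`mul_stepDensity_le`). If this holds outside of a set `B`, then the total variation distance is at
most `1 - c * (1 - P_u(B))` (`stepTV_le_of_mul_stepDensity_le`). The set `B` contains the ball of
radius `F(u)` about `u`, whose probability is at most `1 / 8`. Outside of it,
`|u - v| < 2 F(u) / √n` is small compared with `‖x - u‖`. It remains to control the points that are
seen from `u` but not from `v`.

In dimension at least three there are none. Suppose that the boundary bends away from a tangent
vector `t`. Then `S` contains a segment in the direction of `t`, so the sections of the boundary by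
the planes through this segment have a length that is bounded below. Among these planes there are
some arbitrarily close to the tangent hyperplane, and the curvature of their sections tends to
infinity, which contradicts the finiteness of the curvature constant. Hence the second fundamental
form has a sign (`IsGraphChart.hessian_nonneg`), `S` is locally convex (`exists_convex_inter_ball`),
and sweeping a segment over `S` shows that `v` sees everything that `u` sees
(`Sees.trans_of_locally_convex`). In addition, `B` contains the points whose direction from `u` is
not nearly orthogonal to `v - u`. Their probability is at most `1 / 4` by Chebyshev's inequality,
and outside of `B` the ratio of the distances has a `(n - 1)`-th power that is at most `e ^ 6`.

In the plane, `S` need not be convex, but the curvature `K` of its boundary and its length `R`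
satisfy `15 * |u - v| * K * R ≤ ε`. The tool is `one_le_curvature_mul_of_cap`: a component of the
complement of `S` that sticks out of a disc reaches at least as far as `1 / K` from its centre. If
`u` but not `v` sees the point `x` at the distance `τ` from `u`, then an obstacle lies at a small
angle next to the segment from `u` to `x`, and the angle is at most of the order of
`|u - v| * K * τ / ε` (`exists_obstacle`). Either its component inside of the disc of radius `τ`
about `u` reaches the circle and casts a shadow there next to `x`, or it is an island; then, again
by the cap lemma, the ray through `x` passes next to shadows for a set of radii of length at least
`1 / (2 * K)` (`exists_nearShadow_of_island`). On each circle, the places next to a shadow are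
separated by boundary points (`volume_nearShadow_le`), and by the coarea inequality the number of
these points integrates to at most `R`. So the lost points have probability at most `0.62`
(`stepProb_not_sees_le`).
-/

open scoped ENNReal MeasureTheory Topology

noncomputable section

namespace HitAndRun

open Set Filter Metric MeasureTheory

variable {E : Type*} [NormedAddCommGroup E] [InnerProductSpace ℝ E]

/-! ### Boundary arcs parametrised by arc length -/

/-- The implicit function theorem for a scalar equation that is solved for a real unknown. -/
theorem exists_scalar_implicit {X : Type*} [NormedAddCommGroup X] [NormedSpace ℝ X]
    [CompleteSpace X] {k : ℕ∞} (hk : k ≠ 0) {f : X × ℝ → ℝ} {u : X × ℝ}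
    (hf : ContDiffAt ℝ k f u) (hd : fderiv ℝ f u (0, 1) ≠ 0) :
    ∃ ψ : X → ℝ, ContDiffAt ℝ k ψ u.1 ∧ ψ u.1 = u.2 ∧ (∀ᶠ x in 𝓝 u.1, f (x, ψ x) = f u) ∧
      ∀ᶠ w in 𝓝 u, (f w = f u ↔ ψ w.1 = w.2) := by
  have hk' : (k : WithTop ℕ∞) ≠ 0 := by exact_mod_cast hk
  set L : ℝ →L[ℝ] ℝ := fderiv ℝ f u ∘L .inr ℝ X ℝ with hL
  have hL1 : L 1 ≠ 0 := by simpa [hL] using hd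
  have hinv : L.IsInvertible := by
    refine ⟨ContinuousLinearEquiv.unitsEquivAut ℝ (Units.mk0 (L 1) hL1), ?_⟩
    ext
    simp
  exact ⟨hf.implicitFunction hk' hinv, hf.contDiffAt_implicitFunction hk' hinv,
    hf.implicitFunction_apply_self hk' hinv, hf.eventually_apply_implicitFunction hk' hinv,
    hf.eventually_apply_eq_iff_implicitFunction hk' hinv⟩

/-- The arc-length function of the graph of `h`, near a point where `h` is of class `C²`, has a
local inverse of class `C²`. -/
theorem exists_arclength_inverse {h : ℝ → ℝ} (hh : ContDiffAt ℝ 2 h 0) :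
    ∃ (B : ℝ → ℝ) (a : ℝ), 0 < a ∧ B 0 = 0 ∧ ContDiffOn ℝ 2 B (Ioo (-a) a) ∧
      ∀ s ∈ Ioo (-a) a, HasDerivAt B (1 / √(1 + deriv h (B s) ^ 2)) s := by
  obtain ⟨b, hb, hbC⟩ : ∃ b > 0, ContDiffOn ℝ 2 h (ball 0 b) := by
    obtain ⟨U, hU, hC⟩ := hh.contDiffOn (m := 2) le_rfl (by simp)
    obtain ⟨b, hb, hbU⟩ := Metric.mem_nhds_iff.1 (by simpa using hU)
    exact ⟨b, hb, hC.mono hbU⟩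
  have hd : ContDiffOn ℝ 1 (deriv h) (ball 0 b) :=
    hbC.deriv_of_isOpen isOpen_ball (by norm_num)
  set σ : ℝ → ℝ := fun τ => √(1 + deriv h τ ^ 2) with hσ
  have hσpos : ∀ τ, 0 < σ τ := fun τ => Real.sqrt_pos.2 (by positivity)
  have hσC : ContDiffOn ℝ 1 σ (ball 0 b) :=
    (contDiffOn_const.add (hd.pow 2)).sqrt (fun x _ => by positivity)
  set A : ℝ → ℝ := fun τ => ∫ s in (0 : ℝ)..τ, σ s with hA
  have hAd : ∀ τ ∈ ball (0 : ℝ) b, HasDerivAt A (σ τ) τ := by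
    intro τ hτ
    have hsub : uIcc 0 τ ⊆ ball (0 : ℝ) b :=
      (convex_ball (0 : ℝ) b).ordConnected.uIcc_subset (mem_ball_self hb) hτ
    exact intervalIntegral.integral_hasDerivAt_right
      ((hσC.continuousOn.mono hsub).intervalIntegrable)
      (hσC.continuousOn.stronglyMeasurableAtFilter isOpen_ball τ hτ)
      (hσC.continuousOn.continuousAt (isOpen_ball.mem_nhds hτ))
  have hAC : ContDiffOn ℝ 2 A (ball 0 b) := by
    refine (contDiffOn_succ_iff_deriv_of_isOpen (n := 1) isOpen_ball).2 ⟨?_, by simp, ?_⟩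
    · exact fun τ hτ => (hAd τ hτ).differentiableAt.differentiableWithinAt
    · exact hσC.congr fun τ hτ => (hAd τ hτ).deriv
  have hA0 : A 0 = 0 := by simp [hA]
  have h0 : (0 : ℝ) ∈ ball (0 : ℝ) b := mem_ball_self hb
  have hAat : ContDiffAt ℝ 2 A 0 := hAC.contDiffAt (isOpen_ball.mem_nhds h0)
  have hne : (σ 0) ≠ 0 := (hσpos 0).ne'
  set e : ℝ ≃L[ℝ] ℝ := ContinuousLinearEquiv.unitsEquivAut ℝ (Units.mk0 (σ 0) hne) with he
  have hAf : HasFDerivAt A (e : ℝ →L[ℝ] ℝ) 0 := by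
    have := (hAd 0 h0).hasFDerivAt
    convert! this using 1
  set P := hAat.toOpenPartialHomeomorph A hAf two_ne_zero with hP
  have hBC : ContDiffAt ℝ 2 P.symm 0 := by
    have := hAat.to_localInverse hAf two_ne_zero
    rw [hA0] at this
    exact this
  have hB0 : P.symm 0 = 0 := by
    have := hAat.localInverse_apply_image hAf two_ne_zero
    rw [hA0] at this
    exact this
  have hmem0 : (0 : ℝ) ∈ P.target := by
    have := ContDiffAt.image_mem_toOpenPartialHomeomorph_target hAat hAf two_ne_zero
    rwa [hA0] at this
  have hev : ∀ᶠ s in 𝓝 (0 : ℝ), s ∈ P.target ∧ P.symm s ∈ ball (0 : ℝ) b := by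
    refine Filter.Eventually.and (P.open_target.mem_nhds hmem0)
      (hBC.continuousAt.eventually_mem (by rw [hB0]; exact isOpen_ball.mem_nhds h0))
  obtain ⟨U, hU, hC⟩ := hBC.contDiffOn (m := 2) le_rfl (by simp)
  obtain ⟨a, ha, haU⟩ := Metric.mem_nhds_iff.1 ((show U ∈ 𝓝 (0 : ℝ) by simpa using hU) |> fun h =>
    Filter.inter_mem h hev)
  refine ⟨P.symm, a, ha, hB0, hC.mono fun s hs => (haU ?_).1, fun s hs => ?_⟩
  · simpa [Real.ball_eq_Ioo] using hs
  · have hs' := (haU (show s ∈ ball (0 : ℝ) a by simpa [Real.ball_eq_Ioo] using hs)).2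
    have := P.hasDerivAt_symm hs'.1 (hσpos _).ne' (hAd _ hs'.2)
    simpa [hσ, one_div] using this

/-- Through a point `q` of the level set `Z = 0`, in the plane spanned by orthonormal vectors `t`
and `m`, of which `t` is tangent to the level set and `m` is not, there is an arc of the level set
parametrised by arc length, whose second derivative at `q` is given by the Hessian of `Z`. -/
theorem exists_unit_speed_arc {Z : E → ℝ} {U : Set E} (hU : IsOpen U) (hZ : ContDiffOn ℝ 2 Z U)
    {q t m : E} (hq : q ∈ U) (hq0 : Z q = 0) (ht : ‖t‖ = 1) (hm : ‖m‖ = 1)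
    (htm : inner ℝ t m = 0) (hZt : fderiv ℝ Z q t = 0) (hZm : fderiv ℝ Z q m ≠ 0) :
    ∃ (γ : ℝ → E) (a : ℝ), 0 < a ∧ ContDiffOn ℝ 2 γ (Ioo (-a) a) ∧ γ 0 = q ∧
      (∀ s ∈ Ioo (-a) a, γ s ∈ U ∧ Z (γ s) = 0 ∧ ‖deriv γ s‖ = 1 ∧
        ∃ x y : ℝ, γ s = q + x • t + y • m) ∧
      |fderiv ℝ (fderiv ℝ Z) q t t| = ‖deriv (deriv γ) 0‖ * |fderiv ℝ Z q m| := by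
  have hZq : ContDiffAt ℝ 2 Z q := hZ.contDiffAt (hU.mem_nhds hq)
  -- the curve as a graph over its tangent line
  set f : ℝ × ℝ → ℝ := fun w => Z (q + w.1 • t + w.2 • m) with hf
  have hZq0 : ContDiffAt ℝ 2 Z (q + ((0, 0) : ℝ × ℝ).1 • t + ((0, 0) : ℝ × ℝ).2 • m) := by
    simpa using hZq
  have hfC : ContDiffAt ℝ ((2 : ℕ∞) : WithTop ℕ∞) f (0, 0) := by
    refine ContDiffAt.comp (0, 0) (g := Z) hZq0 ?_
    fun_prop
  have hfd : ∀ w : ℝ × ℝ, fderiv ℝ f (0, 0) w = w.1 * fderiv ℝ Z q t + w.2 * fderiv ℝ Z q m := by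
    intro w
    have h1 : HasFDerivAt (fun w : ℝ × ℝ => q + w.1 • t + w.2 • m)
        ((ContinuousLinearMap.fst ℝ ℝ ℝ).smulRight t + (ContinuousLinearMap.snd ℝ ℝ ℝ).smulRight m)
        (0, 0) := by
      have a1 : HasFDerivAt (fun w : ℝ × ℝ => w.1 • t)
        ((ContinuousLinearMap.fst ℝ ℝ ℝ).smulRight t) (0, 0) :=
        ((ContinuousLinearMap.fst ℝ ℝ ℝ).smulRight t).hasFDerivAt
      have a2 : HasFDerivAt (fun w : ℝ × ℝ => w.2 • m)
        ((ContinuousLinearMap.snd ℝ ℝ ℝ).smulRight m) (0, 0) :=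
        ((ContinuousLinearMap.snd ℝ ℝ ℝ).smulRight m).hasFDerivAt
      simpa using (a1.const_add q).fun_add a2
    have h2 : HasFDerivAt Z (fderiv ℝ Z q)
        (q + ((0, 0) : ℝ × ℝ).1 • t + ((0, 0) : ℝ × ℝ).2 • m) := by
      simpa using (hZq.differentiableAt two_ne_zero).hasFDerivAt
    have := h2.comp (0, 0) h1
    rw [show f = Z ∘ fun w : ℝ × ℝ => q + w.1 • t + w.2 • m from rfl, this.fderiv]
    simp
  obtain ⟨h, hhC, hh0, hhf, -⟩ := exists_scalar_implicit (u := ((0 : ℝ), (0 : ℝ))) (by norm_num)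
    hfC (by rw [hfd]; simpa using hZm)
  simp only at hhC hh0 hhf
  obtain ⟨B, a, ha, hB0, hBC, hBd⟩ := exists_arclength_inverse hhC
  -- the arc on a small interval
  set c : ℝ → E := fun τ => q + τ • t + h τ • m with hc
  have hBa : ContDiffAt ℝ 2 B 0 := hBC.contDiffAt (Ioo_mem_nhds (by linarith) ha)
  have hcC : ContDiffAt ℝ 2 c 0 := by
    exact (contDiffAt_const.add (contDiffAt_id.smul contDiffAt_const)).add
      (hhC.smul contDiffAt_const)
  have hγC : ContDiffAt ℝ 2 (c ∘ B) 0 := ContDiffAt.comp 0 (by rwa [hB0]) hBa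
  obtain ⟨V, hV, hVC⟩ := hγC.contDiffOn (m := 2) le_rfl (by simp)
  have hV : V ∈ 𝓝 (0 : ℝ) := by simpa using hV
  have hc0 : c 0 = q := by simp [hc, hh0]
  obtain ⟨W, hW, hWC⟩ := hhC.contDiffOn (m := 2) le_rfl (by simp)
  have hW : W ∈ 𝓝 (0 : ℝ) := by simpa using hW
  have hev : ∀ᶠ s in 𝓝 (0 : ℝ), s ∈ V ∧ (c ∘ B) s ∈ U ∧ f (B s, h (B s)) = 0 ∧
      B s ∈ interior W := by
    refine Filter.Eventually.and hV (Filter.Eventually.and (hγC.continuousAt.eventually_mem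
      (hU.mem_nhds (by simpa [hB0, hc0] using hq))) ?_)
    have hBt : Tendsto B (𝓝 0) (𝓝 0) := by simpa [ContinuousAt, hB0] using hBa.continuousAt
    refine Filter.Eventually.and ?_ (hBt.eventually (isOpen_interior.mem_nhds
      (mem_interior_iff_mem_nhds.2 hW)))
    have h1 : f (0, 0) = 0 := by simp [hf, hq0]
    rw [h1] at hhf
    exact hBt.eventually hhf
  obtain ⟨a', ha', haU⟩ := Metric.mem_nhds_iff.1 hev
  set r := min a a' with hr
  have hr0 : 0 < r := lt_min ha ha'
  have hIoo : ∀ s ∈ Ioo (-r) r, s ∈ Ioo (-a) a ∧ s ∈ ball (0 : ℝ) a' := fun s hs =>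
    ⟨⟨by linarith [hs.1, min_le_left a a'], by linarith [hs.2, min_le_left a a']⟩, by
      rw [Real.ball_eq_Ioo]
      exact ⟨by linarith [hs.1, min_le_right a a'], by linarith [hs.2, min_le_right a a']⟩⟩
  have hγon : ContDiffOn ℝ 2 (c ∘ B) (Ioo (-r) r) :=
    hVC.mono fun s hs => (haU (hIoo s hs).2).1
  have hdγ : ∀ s ∈ Ioo (-r) r, HasDerivAt (c ∘ B)
      ((1 / √(1 + deriv h (B s) ^ 2)) • (t + deriv h (B s) • m)) s := by
    intro s hs
    have hWs := (haU (hIoo s hs).2).2.2.2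
    have hhd : HasDerivAt h (deriv h (B s)) (B s) :=
      ((hWC.contDiffAt (mem_interior_iff_mem_nhds.1 hWs)).differentiableAt
        two_ne_zero).hasDerivAt
    have hcd : HasDerivAt c (t + deriv h (B s) • m) (B s) := by
      have := (((hasDerivAt_id (B s)).smul_const t).const_add q).fun_add (hhd.smul_const m)
      simpa using this
    exact HasDerivAt.scomp s hcd (hBd s (hIoo s hs).1)
  have hnorm : ∀ s ∈ Ioo (-r) r, ‖deriv (c ∘ B) s‖ = 1 := by
    intro s hs
    rw [(hdγ s hs).deriv, norm_smul]
    have h1 : ‖t + deriv h (B s) • m‖ = √(1 + deriv h (B s) ^ 2) := by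
      rw [← Real.sqrt_sq (norm_nonneg (t + _)), norm_add_sq_real, norm_smul, inner_smul_right, htm,
        ht, hm]
      simp
    have h2 : 0 < √(1 + deriv h (B s) ^ 2) := Real.sqrt_pos.2 (by positivity)
    rw [h1, Real.norm_of_nonneg (by positivity)]
    field_simp
  have h0r : (0 : ℝ) ∈ Ioo (-r) r := ⟨by linarith, hr0⟩
  refine ⟨c ∘ B, r, hr0, hγon, by simp [hB0, hc0], fun s hs => ⟨(haU (hIoo s hs).2).2.1, ?_,
    hnorm s hs, B s, h (B s), rfl⟩, ?_⟩
  · exact (haU (hIoo s hs).2).2.2.1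
  -- the second derivative at the base point
  have hnr : Ioo (-r) r ∈ 𝓝 (0 : ℝ) := Ioo_mem_nhds (by linarith) hr0
  have hγ1 : HasDerivAt (c ∘ B) (deriv (c ∘ B) 0) 0 := (hdγ 0 h0r).differentiableAt.hasDerivAt
  have hγ2 : HasDerivAt (deriv (c ∘ B)) (deriv (deriv (c ∘ B)) 0) 0 := by
    have := hγon.deriv_of_isOpen (m := 1) isOpen_Ioo (by norm_num)
    exact ((this.contDiffAt hnr).differentiableAt one_ne_zero).hasDerivAt
  have hDZ : HasFDerivAt (fderiv ℝ Z) (fderiv ℝ (fderiv ℝ Z) q) q :=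
    ((hZq.fderiv_right (m := 1) (by norm_num)).differentiableAt one_ne_zero).hasFDerivAt
  have hγ0 : (c ∘ B) 0 = q := by simp [hB0, hc0]
  have hh1 : deriv h 0 = 0 := by
    have hcd : HasDerivAt c (t + deriv h 0 • m) 0 := by
      have := (((hasDerivAt_id (0 : ℝ)).smul_const t).const_add q).fun_add
        ((hhC.differentiableAt two_ne_zero).hasDerivAt.smul_const m)
      simpa using this
    have h3 : HasDerivAt (Z ∘ c) (fderiv ℝ Z q (t + deriv h 0 • m)) 0 := by
      refine HasFDerivAt.comp_hasDerivAt 0 ?_ hcd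
      rw [hc0]
      exact (hZq.differentiableAt two_ne_zero).hasFDerivAt
    have h4 : Z ∘ c =ᶠ[𝓝 0] fun _ => f (0, 0) := hhf
    have h5 := h3.unique ((hasDerivAt_const (0 : ℝ) (f (0, 0))).congr_of_eventuallyEq h4)
    rw [map_add, map_smul, hZt, zero_add, smul_eq_mul] at h5
    exact (mul_eq_zero.1 h5).resolve_right hZm
  have hd0 : deriv (c ∘ B) 0 = t := by
    rw [(hdγ 0 h0r).deriv, hB0, hh1]
    simp
  -- the second derivative is orthogonal to the velocity and lies in the plane
  have hperp : inner ℝ t (deriv (deriv (c ∘ B)) 0) = 0 := by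
    have h1 := hγ2.inner ℝ hγ2
    have h2 : (fun s => inner ℝ (deriv (c ∘ B) s) (deriv (c ∘ B) s)) =ᶠ[𝓝 0] fun _ => (1 : ℝ) := by
      filter_upwards [hnr] with s hs
      rw [real_inner_self_eq_norm_sq, hnorm s hs]
      norm_num
    have h3 := h1.unique ((hasDerivAt_const (0 : ℝ) (1 : ℝ)).congr_of_eventuallyEq h2)
    rw [hd0] at h3
    have h4 := real_inner_comm t (deriv (deriv (c ∘ B)) 0)
    linarith
  have hplane : ∃ x y : ℝ, deriv (deriv (c ∘ B)) 0 = x • t + y • m := by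
    set P : Submodule ℝ E := Submodule.span ℝ {t, m} with hP
    have hcl : IsClosed (P : Set E) := by
      have := FiniteDimensional.span_of_finite ℝ (Set.toFinite ({t, m} : Set E))
      exact P.closed_of_finiteDimensional
    have hmem : ∀ᶠ s in 𝓝 (0 : ℝ), deriv (c ∘ B) s ∈ P := by
      filter_upwards [hnr] with s hs
      rw [(hdγ s hs).deriv]
      exact P.smul_mem _ (P.add_mem (Submodule.subset_span (by simp))
        (P.smul_mem _ (Submodule.subset_span (by simp))))
    have h1 := hasDerivAt_iff_tendsto_slope.1 hγ2
    have h2 : deriv (deriv (c ∘ B)) 0 ∈ (P : Set E) := by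
      refine hcl.mem_of_tendsto h1 ?_
      filter_upwards [nhdsWithin_le_nhds hmem] with s hs
      rw [slope_def_module]
      exact P.smul_mem _ (P.sub_mem hs hmem.self_of_nhds)
    obtain ⟨x, y, hxy⟩ := Submodule.mem_span_pair.1 h2
    exact ⟨x, y, hxy.symm⟩
  obtain ⟨x, y, hxy⟩ := hplane
  have hx : x = 0 := by
    rw [hxy, inner_add_right, inner_smul_right, inner_smul_right, htm, real_inner_self_eq_norm_sq,
      ht] at hperp
    simpa using hperp
  have hsecond : fderiv ℝ (fderiv ℝ Z) q t t + fderiv ℝ Z q (deriv (deriv (c ∘ B)) 0) = 0 := by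
    have h1 : HasDerivAt (fun s => fderiv ℝ Z ((c ∘ B) s)) (fderiv ℝ (fderiv ℝ Z) q t) 0 := by
      have := HasFDerivAt.comp_hasDerivAt (f := c ∘ B) (0 : ℝ) (by rw [hγ0]; exact hDZ) hγ1
      rwa [hd0] at this
    have h2 := h1.clm_apply hγ2
    have h3 : (fun s => fderiv ℝ Z ((c ∘ B) s) (deriv (c ∘ B) s)) =ᶠ[𝓝 0] fun _ => (0 : ℝ) := by
      filter_upwards [hnr] with s hs
      have h4 : HasDerivAt (Z ∘ (c ∘ B)) (fderiv ℝ Z ((c ∘ B) s) (deriv (c ∘ B) s)) s := by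
        refine HasFDerivAt.comp_hasDerivAt s ?_ (hdγ s hs).differentiableAt.hasDerivAt
        exact ((hZ.contDiffAt (hU.mem_nhds (haU (hIoo s hs).2).2.1)).differentiableAt
          two_ne_zero).hasFDerivAt
      have h5 : Z ∘ (c ∘ B) =ᶠ[𝓝 s] fun _ => (0 : ℝ) := by
        filter_upwards [isOpen_Ioo.mem_nhds hs] with s' hs'
        exact (haU (hIoo s' hs').2).2.2.1
      exact h4.unique ((hasDerivAt_const s (0 : ℝ)).congr_of_eventuallyEq h5)
    have h6 := h2.unique ((hasDerivAt_const (0 : ℝ) (0 : ℝ)).congr_of_eventuallyEq h3)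
    rw [hd0, hγ0] at h6
    exact h6
  rw [hxy, hx, zero_smul, zero_add, map_smul, smul_eq_mul] at hsecond
  rw [hxy, hx, zero_smul, zero_add, norm_smul, hm, mul_one, Real.norm_eq_abs, ← abs_mul,
    show fderiv ℝ (fderiv ℝ Z) q t t = -(y * fderiv ℝ Z q m) by linarith, abs_neg]

/-! ### Charts of the boundary -/

/-- `Z` presents `S` near the point `p` as the region below a `C²` graph in the direction of the
unit vector `ν`, which is the outward normal at `p`: `Z x` is the height, measured along `ν`, of `x`
above the boundary of `S`. -/
structure IsGraphChart (S : Set E) (p ν : E) (Z : E → ℝ) (r : ℝ) : Prop where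
  pos : 0 < r
  norm_normal : ‖ν‖ = 1
  contDiffOn : ContDiffOn ℝ 2 Z (ball p r)
  apply_center : Z p = 0
  fderiv_center : ∀ w, fderiv ℝ Z p w = inner ℝ ν w
  mem_iff : ∀ x ∈ ball p r, (x ∈ S ↔ Z x ≤ 0)
  apply_add : ∀ x ∈ ball p r, ∀ s : ℝ, x + s • ν ∈ ball p r → Z (x + s • ν) = Z x + s

/-- The normal `ν` is the direction of the gradient of a defining function `f` of `S`, and `Z x` is
defined implicitly as the number for which `f (x - Z x • ν) = 0`. -/
theorem exists_graphChart [FiniteDimensional ℝ E] {S : Set E} (hS : IsClosed S)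
    (hC : HasC2Boundary S) {p : E} (hp : p ∈ frontier S) :
    ∃ (ν : E) (Z : E → ℝ) (r : ℝ), IsGraphChart S p ν Z r := by
  obtain ⟨f, hf, hdf, hmem⟩ := hC p hp
  have hfd : HasFDerivAt f (fderiv ℝ f p) p := (hf.differentiableAt two_ne_zero).hasFDerivAt
  -- the defining function vanishes at the boundary point
  have hfp : f p = 0 := by
    have h1 : f p ≤ 0 := hmem.self_of_nhds.1 (hS.frontier_subset hp)
    by_contra hne
    have h2 : ∀ᶠ x in 𝓝 p, x ∈ S := by
      filter_upwards [hmem, hf.continuousAt.eventually_lt continuousAt_const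
        (lt_of_le_of_ne h1 hne)] with x hx hx'
      exact hx.2 hx'.le
    exact hp.2 (mem_interior_iff_mem_nhds.2 h2)
  set g : E := (InnerProductSpace.toDual ℝ E).symm (fderiv ℝ f p) with hg
  have hgi : ∀ w, fderiv ℝ f p w = inner ℝ g w := fun w => by
    rw [hg, InnerProductSpace.toDual_symm_apply]
  have hg0 : g ≠ 0 := by
    intro h0
    apply hdf
    ext w
    simp [hgi, h0]
  have hgn : 0 < ‖g‖ := norm_pos_iff.2 hg0
  set ν : E := ‖g‖⁻¹ • g with hν
  have hν1 : ‖ν‖ = 1 := by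
    rw [hν, norm_smul, norm_inv, norm_norm, inv_mul_cancel₀ hgn.ne']
  have hgν : fderiv ℝ f p ν = ‖g‖ := by
    rw [hgi, hν, inner_smul_right, real_inner_self_eq_norm_sq]
    field_simp
  -- the height function is an implicit function
  set F : E × ℝ → ℝ := fun w => f (w.1 - w.2 • ν) with hF
  have hf0 : ContDiffAt ℝ 2 f (((p, 0) : E × ℝ).1 - ((p, 0) : E × ℝ).2 • ν) := by simpa using hf
  have hFC : ContDiffAt ℝ ((2 : ℕ∞) : WithTop ℕ∞) F (p, 0) :=
    ContDiffAt.comp (p, (0 : ℝ)) (g := f) hf0 (by fun_prop)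
  have hFd : ∀ w : E × ℝ, fderiv ℝ F (p, 0) w = fderiv ℝ f p w.1 - w.2 * ‖g‖ := by
    intro w
    have h1 : HasFDerivAt (fun w : E × ℝ => w.1 - w.2 • ν)
        ((ContinuousLinearMap.fst ℝ E ℝ) - (ContinuousLinearMap.snd ℝ E ℝ).smulRight ν)
        (p, 0) :=
      ((ContinuousLinearMap.fst ℝ E ℝ) - (ContinuousLinearMap.snd ℝ E ℝ).smulRight ν).hasFDerivAt
    have h2 : HasFDerivAt f (fderiv ℝ f p) (((p, 0) : E × ℝ).1 - ((p, 0) : E × ℝ).2 • ν) := by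
      simpa using hfd
    have := h2.comp (p, (0 : ℝ)) h1
    rw [show F = f ∘ fun w : E × ℝ => w.1 - w.2 • ν from rfl, this.fderiv]
    simp [hgν]
  obtain ⟨Z, hZC, hZ0, hZf, hZu⟩ := exists_scalar_implicit (u := ((p, 0) : E × ℝ)) (by norm_num)
    hFC (by rw [hFd]; simpa using hg0)
  simp only at hZC hZ0 hZf
  have hFp : F (p, 0) = 0 := by simp [hF, hfp]
  rw [hFp] at hZf hZu
  -- a ball on which `f` increases in the direction of `ν`
  obtain ⟨r₁, hr₁, hinc⟩ : ∃ r₁ > 0, ∀ x ∈ ball p r₁, ContDiffAt ℝ 2 f x ∧ 0 < fderiv ℝ f x ν ∧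
      (x ∈ S ↔ f x ≤ 0) := by
    have h1 : ∀ᶠ x in 𝓝 p, ContDiffAt ℝ 2 f x := hf.eventually (by simp)
    have h2 : ∀ᶠ x in 𝓝 p, 0 < fderiv ℝ f x ν := by
      have : ContinuousAt (fun x => fderiv ℝ f x ν) p :=
        ((hf.fderiv_right (m := 1) (by norm_num)).continuousAt).clm_apply continuousAt_const
      exact continuousAt_const.eventually_lt this (by rwa [hgν])
    obtain ⟨r, hr, h⟩ := Metric.mem_nhds_iff.1 (h1.and (h2.and hmem))
    exact ⟨r, hr, fun x hx => h hx⟩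
  have hmono : ∀ x ∈ ball p r₁, ∀ s : ℝ, 0 < s → x + s • ν ∈ ball p r₁ → f x < f (x + s • ν) := by
    intro x hx s hs hxs
    have hconv : ∀ τ ∈ Icc 0 s, x + τ • ν ∈ ball p r₁ := by
      intro τ hτ
      have := (convex_ball p r₁).segment_subset hx hxs
      apply this
      rw [segment_eq_image']
      refine ⟨τ / s, ⟨by have := hτ.1; positivity, (div_le_one hs).2 hτ.2⟩, ?_⟩
      simp only [add_sub_cancel_left, smul_smul]
      rw [div_mul_cancel₀ _ hs.ne']
    have hder : ∀ τ ∈ Icc 0 s, HasDerivAt (fun τ : ℝ => f (x + τ • ν))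
        (fderiv ℝ f (x + τ • ν) ν) τ := by
      intro τ hτ
      have h1 : HasDerivAt (fun τ : ℝ => x + τ • ν) ν τ := by
        simpa using ((hasDerivAt_id τ).smul_const ν).const_add x
      exact HasFDerivAt.comp_hasDerivAt τ
        (((hinc _ (hconv τ hτ)).1.differentiableAt two_ne_zero).hasFDerivAt) h1
    have := strictMonoOn_of_deriv_pos (convex_Icc 0 s)
      (fun τ hτ => (hder τ hτ).continuousAt.continuousWithinAt)
      (fun τ hτ => by
        rw [interior_Icc] at hτ
        rw [(hder τ ⟨hτ.1.le, hτ.2.le⟩).deriv]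
        exact (hinc _ (hconv τ ⟨hτ.1.le, hτ.2.le⟩)).2.1)
    simpa using this ⟨le_rfl, hs.le⟩ ⟨hs.le, le_rfl⟩ hs
  have hZcont : ContinuousAt Z p := hZC.continuousAt
  have hev1 : ∀ᶠ x in 𝓝 p, ContDiffAt ℝ 2 Z x := hZC.eventually (by simp)
  have hev2 : ∀ᶠ x in 𝓝 p, x - Z x • ν ∈ ball p r₁ := by
    have : ContinuousAt (fun x => x - Z x • ν) p := continuousAt_id.sub (hZcont.smul_const ν)
    exact this.eventually_mem (by simpa [hZ0] using ball_mem_nhds p hr₁)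
  obtain ⟨d, hd, hdu⟩ := Metric.mem_nhds_iff.1 hZu
  have hev3 : ∀ᶠ x in 𝓝 p, |Z x| < d / 2 := by
    have : ContinuousAt (fun x => |Z x|) p := hZcont.abs
    exact this.eventually_lt continuousAt_const (by simpa [hZ0] using by linarith)
  obtain ⟨r₂, hr₂, hball⟩ := Metric.mem_nhds_iff.1 (hev1.and (hev2.and (hev3.and hZf)))
  set r := min r₁ (min r₂ (d / 4)) with hr
  have hrr : 0 < r := lt_min hr₁ (lt_min hr₂ (by linarith))
  have hb1 : ball p r ⊆ ball p r₁ := ball_subset_ball (min_le_left _ _)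
  have hb2 : ball p r ⊆ ball p r₂ := ball_subset_ball ((min_le_right _ _).trans (min_le_left _ _))
  have hb3 : ball p r ⊆ ball p (d / 4) :=
    ball_subset_ball ((min_le_right _ _).trans (min_le_right _ _))
  refine ⟨ν, Z, r, hrr, hν1, fun x hx => (hball (hb2 hx)).1.contDiffWithinAt, hZ0, ?_, ?_, ?_⟩
  · intro w
    have hZd : HasFDerivAt Z (fderiv ℝ Z p) p := (hZC.differentiableAt (by norm_num)).hasFDerivAt
    have h1 : HasFDerivAt (fun x => x - Z x • ν) (ContinuousLinearMap.id ℝ E -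
        (fderiv ℝ Z p).smulRight ν) p := (hasFDerivAt_id p).sub (hZd.smul_const ν)
    have h2 : HasFDerivAt f (fderiv ℝ f p) (p - Z p • ν) := by simpa [hZ0] using hfd
    have h3 := h2.comp p h1
    have h4 : (f ∘ fun x => x - Z x • ν) =ᶠ[𝓝 p] fun _ => (0 : ℝ) := hZf
    have h5 := h3.unique ((hasFDerivAt_const (0 : ℝ) p).congr_of_eventuallyEq h4)
    have h6 := congrArg (fun L : E →L[ℝ] ℝ => L w) h5
    simp only [ContinuousLinearMap.comp_apply, sub_apply,
      ContinuousLinearMap.id_apply, ContinuousLinearMap.smulRight_apply, map_sub, map_smul,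
      smul_eq_mul, hgν, zero_apply] at h6
    rw [hgi] at h6
    rw [hν, inner_smul_left]
    simp only [conj_trivial]
    field_simp
    linarith
  · intro x hx
    have hx2 := hball (hb2 hx)
    have hfx : f (x - Z x • ν) = 0 := hx2.2.2.2
    rw [(hinc x (hb1 hx)).2.2]
    rcases lt_trichotomy (Z x) 0 with h | h | h
    · have h1 := hmono x (hb1 hx) (-Z x) (by linarith)
        (by simpa [sub_eq_add_neg] using hx2.2.1)
      rw [neg_smul, ← sub_eq_add_neg, hfx] at h1
      exact iff_of_true h1.le h.le
    · rw [h, zero_smul, sub_zero] at hfx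
      exact iff_of_true hfx.le h.le
    · have h1 := hmono (x - Z x • ν) hx2.2.1 (Z x) h (by simpa using hb1 hx)
      rw [hfx, sub_add_cancel] at h1
      exact iff_of_false (not_le.2 h1) (not_le.2 h)
  · intro x hx s hxs
    have hx2 := hball (hb2 hx)
    have hs : |s| < d / 2 := by
      have h1 : ‖s • ν‖ < d / 4 + d / 4 := by
        calc ‖s • ν‖ = ‖(x + s • ν - p) - (x - p)‖ := by congr 1; abel
          _ ≤ ‖x + s • ν - p‖ + ‖x - p‖ := norm_sub_le _ _
          _ < d / 4 + d / 4 := add_lt_add (by simpa [dist_eq_norm] using hb3 hxs)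
            (by simpa [dist_eq_norm] using hb3 hx)
      rw [norm_smul, hν1, mul_one, Real.norm_eq_abs] at h1
      linarith
    have hmem' : (x + s • ν, Z x + s) ∈ ball ((p, 0) : E × ℝ) d := by
      rw [mem_ball, Prod.dist_eq]
      refine max_lt ((hb3 hxs).trans (by linarith)) ?_
      rw [Real.dist_eq, sub_zero]
      calc |Z x + s| ≤ |Z x| + |s| := abs_add_le _ _
        _ < d := by linarith [hx2.2.2.1]
    refine (hdu hmem').1 ?_
    have : x + s • ν - (Z x + s) • ν = x - Z x • ν := by rw [add_smul]; abel
    simp only [hF, this]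
    exact hx2.2.2.2

namespace IsGraphChart

variable {S : Set E} {p ν : E} {Z : E → ℝ} {r : ℝ}

theorem contDiffAt (h : IsGraphChart S p ν Z r) {q : E} (hq : q ∈ ball p r) : ContDiffAt ℝ 2 Z q :=
  h.contDiffOn.contDiffAt (isOpen_ball.mem_nhds hq)

theorem hasFDerivAt (h : IsGraphChart S p ν Z r) {q : E} (hq : q ∈ ball p r) :
    HasFDerivAt Z (fderiv ℝ Z q) q := ((h.contDiffAt hq).differentiableAt two_ne_zero).hasFDerivAt

theorem hasFDerivAt_fderiv (h : IsGraphChart S p ν Z r) {q : E} (hq : q ∈ ball p r) :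
    HasFDerivAt (fderiv ℝ Z) (fderiv ℝ (fderiv ℝ Z) q) q :=
  (((h.contDiffAt hq).fderiv_right (m := 1) (by norm_num)).differentiableAt one_ne_zero).hasFDerivAt

theorem hessian_comm (h : IsGraphChart S p ν Z r) {q : E} (hq : q ∈ ball p r) (v w : E) :
    fderiv ℝ (fderiv ℝ Z) q v w = fderiv ℝ (fderiv ℝ Z) q w v :=
  ((h.contDiffAt hq).isSymmSndFDerivAt (by simp)).eq v w

theorem eventually_mem (_h : IsGraphChart S p ν Z r) {q : E} (hq : q ∈ ball p r) (w : E) :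
    ∀ᶠ s in 𝓝 (0 : ℝ), q + s • w ∈ ball p r := by
  have : ContinuousAt (fun s : ℝ => q + s • w) 0 := by fun_prop
  exact this.eventually_mem (isOpen_ball.mem_nhds (by simpa using hq))

theorem fderiv_normal (h : IsGraphChart S p ν Z r) {q : E} (hq : q ∈ ball p r) :
    fderiv ℝ Z q ν = 1 := by
  have h1 : HasDerivAt (fun s : ℝ => q + s • ν) ν 0 := by
    simpa using ((hasDerivAt_id (0 : ℝ)).smul_const ν).const_add q
  have h2 : HasDerivAt (Z ∘ fun s : ℝ => q + s • ν) (fderiv ℝ Z q ν) 0 :=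
    HasFDerivAt.comp_hasDerivAt 0 (by simpa using h.hasFDerivAt hq) h1
  have h3 : (Z ∘ fun s : ℝ => q + s • ν) =ᶠ[𝓝 0] fun s => Z q + s := by
    filter_upwards [h.eventually_mem hq ν] with s hs
    exact h.apply_add q hq s hs
  exact h2.unique (((hasDerivAt_id (0 : ℝ)).const_add (Z q)).congr_of_eventuallyEq h3)

theorem hessian_normal (h : IsGraphChart S p ν Z r) {q : E} (hq : q ∈ ball p r) (w : E) :
    fderiv ℝ (fderiv ℝ Z) q w ν = 0 := by
  have h1 : HasFDerivAt (fun x => fderiv ℝ Z x ν)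
      ((fderiv ℝ (fderiv ℝ Z) q).flip ν) q := by
    have := (h.hasFDerivAt_fderiv hq).clm_apply (hasFDerivAt_const ν q)
    convert! this using 1
    ext; simp
  have h2 : (fun x => fderiv ℝ Z x ν) =ᶠ[𝓝 q] fun _ => (1 : ℝ) := by
    filter_upwards [isOpen_ball.mem_nhds hq] with x hx using h.fderiv_normal hx
  have h3 := h1.unique ((hasFDerivAt_const (1 : ℝ) q).congr_of_eventuallyEq h2)
  have := congrArg (fun L : E →L[ℝ] ℝ => L w) h3
  simpa using this

theorem mem_frontier_iff (h : IsGraphChart S p ν Z r) (hS : IsClosed S) {q : E}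
    (hq : q ∈ ball p r) : q ∈ frontier S ↔ Z q = 0 := by
  rw [hS.frontier_eq]
  constructor
  · rintro ⟨h1, h2⟩
    by_contra hne
    have h3 : Z q < 0 := lt_of_le_of_ne ((h.mem_iff q hq).1 h1) hne
    refine h2 (mem_interior_iff_mem_nhds.2 ?_)
    filter_upwards [isOpen_ball.mem_nhds hq,
      (h.contDiffAt hq).continuousAt.eventually_lt continuousAt_const h3] with x hx hx'
    exact (h.mem_iff x hx).2 hx'.le
  · intro h0
    refine ⟨(h.mem_iff q hq).2 h0.le, fun hint => ?_⟩
    have h1 : ContinuousAt (fun s : ℝ => q + s • ν) 0 := by fun_prop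
    have h2 : ∀ᶠ s in 𝓝 (0 : ℝ), q + s • ν ∈ S := by
      have := h1.eventually_mem (s := interior S)
        (isOpen_interior.mem_nhds (by simpa using hint))
      filter_upwards [this] with s hs using interior_subset hs
    have h3 : ∀ᶠ s in 𝓝[>] (0 : ℝ), q + s • ν ∈ S ∧ q + s • ν ∈ ball p r :=
      nhdsWithin_le_nhds (h2.and (h.eventually_mem hq ν))
    obtain ⟨s, ⟨hs1, hs2⟩, hs0⟩ := (h3.and self_mem_nhdsWithin).exists
    have h4 := (h.mem_iff _ hs2).1 hs1
    rw [h.apply_add q hq s hs2, h0] at h4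
    have : 0 < s := hs0
    linarith

end IsGraphChart

/-! ### Curvature and length of plane sections -/

section

theorem enorm_le_maxCurvature {C : Set E} {γ : ℝ → E} {a : ℝ} (ha : 0 < a)
    (hγ : ContDiffOn ℝ 2 γ (Ioo (-a) a)) (hC : ∀ s ∈ Ioo (-a) a, γ s ∈ C ∧ ‖deriv γ s‖ = 1) :
    ‖deriv (deriv γ) 0‖ₑ ≤ maxCurvature C :=
  le_sSup ⟨γ, -a, a, hγ, hC, 0, ⟨by linarith, ha⟩, rfl⟩

/-- The second fundamental form of the boundary is controlled, in the direction of a vector `t`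
tangent to a plane section, by the curvature of this section and the slope of the plane. -/
theorem IsGraphChart.abs_hessian_le {S : Set E} {p ν : E} {Z : E → ℝ} {r : ℝ}
    (h : IsGraphChart S p ν Z r) (hS : IsClosed S) {q t m : E} (hq : q ∈ ball p r) (hq0 : Z q = 0)
    (ht : ‖t‖ = 1) (hm : ‖m‖ = 1) (htm : inner ℝ t m = 0) (hZt : fderiv ℝ Z q t = 0)
    (hZm : fderiv ℝ Z q m ≠ 0) {H : Set E} (hH : ∀ x y : ℝ, q + x • t + y • m ∈ H) {K : ℝ}
    (hK : 0 ≤ K) (hcurv : maxCurvature (frontier S ∩ H) ≤ ENNReal.ofReal K) :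
    |fderiv ℝ (fderiv ℝ Z) q t t| ≤ K * |fderiv ℝ Z q m| := by
  obtain ⟨γ, a, ha, hγ, -, hγs, hsec⟩ :=
    exists_unit_speed_arc isOpen_ball h.contDiffOn hq hq0 ht hm htm hZt hZm
  have h1 : ‖deriv (deriv γ) 0‖ₑ ≤ maxCurvature (frontier S ∩ H) := by
    refine enorm_le_maxCurvature ha hγ fun s hs => ?_
    obtain ⟨hU, hZ, hn, x, y, hxy⟩ := hγs s hs
    exact ⟨⟨(h.mem_frontier_iff hS hU).2 hZ, hxy ▸ hH x y⟩, hn⟩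
  have h2 : ‖deriv (deriv γ) 0‖ ≤ K := by
    have := h1.trans hcurv
    rw [← ofReal_norm] at this
    exact (ENNReal.ofReal_le_ofReal_iff hK).1 this
  rw [hsec]
  exact mul_le_mul_of_nonneg_right h2 (abs_nonneg _)

theorem inter_frontier_nonempty_of_isPreconnected {X : Type*} [TopologicalSpace X] {s T : Set X}
    (hs : IsPreconnected s) (h1 : (s ∩ T).Nonempty) (h2 : (s ∩ Tᶜ).Nonempty) :
    (s ∩ frontier T).Nonempty := by
  by_contra hno
  have hno' : ∀ x ∈ s, x ∈ closure T → x ∈ interior T := fun x hx hc => by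
    by_contra hi
    exact hno ⟨x, hx, hc, hi⟩
  obtain ⟨x, hx, hxT⟩ := h1
  obtain ⟨y, hy, hyT⟩ := h2
  refine hyT (interior_subset (hs.subset_left_of_subset_union isOpen_interior
    isClosed_closure.isOpen_compl
    (disjoint_left.2 fun z hz hz' => hz' (subset_closure (interior_subset hz)))
    (fun z hz => ?_) ⟨x, hx, hno' x hx (subset_closure hxT)⟩ hy))
  by_cases hc : z ∈ closure T
  · exact Or.inl (hno' z hz hc)
  · exact Or.inr hc

theorem exists_mem_frontier_on_line {S : Set E} (hS : Bornology.IsBounded S) {q m : E}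
    (hm : ‖m‖ = 1) (hq : q ∈ S) : ∃ y : ℝ, q + y • m ∈ frontier S := by
  obtain ⟨R, hR⟩ := hS.subset_ball q
  have hout : q + |R| • m ∉ S := fun h => by
    have h1 := hR h
    rw [mem_ball, dist_eq_norm, add_sub_cancel_left, norm_smul, hm, mul_one, Real.norm_eq_abs,
      abs_abs] at h1
    exact absurd h1 (not_lt.2 (le_abs_self R))
  obtain ⟨_, ⟨y, rfl⟩, hy⟩ := inter_frontier_nonempty_of_isPreconnected
    (isPreconnected_range (f := fun y : ℝ => q + y • m) (by fun_prop)) ⟨q, ⟨0, by simp⟩, hq⟩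
    ⟨_, ⟨|R|, rfl⟩, hout⟩
  exact ⟨y, hy⟩

/-- The affine plane through `q` spanned by `t` and `m`. -/
def planeThrough (q t m : E) : AffineSubspace ℝ E :=
  AffineSubspace.mk' q (Submodule.span ℝ {t, m})

theorem mem_planeThrough (q t m : E) (x y : ℝ) : q + x • t + y • m ∈ planeThrough q t m := by
  rw [planeThrough, AffineSubspace.mem_mk', vsub_eq_sub, show q + x • t + y • m - q = x • t + y • m
    by abel]
  exact Submodule.mem_span_pair.2 ⟨x, y, rfl⟩

theorem finrank_direction_planeThrough {q t m : E} (ht : ‖t‖ = 1) (hm : ‖m‖ = 1)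
    (htm : inner ℝ t m = 0) : Module.finrank ℝ (planeThrough q t m).direction = 2 := by
  rw [planeThrough, AffineSubspace.direction_mk']
  have hli : LinearIndependent ℝ ![t, m] := by
    apply Orthonormal.linearIndependent
    refine ⟨fun i => by fin_cases i <;> simp [ht, hm], ?_⟩
    intro i j hij
    fin_cases i <;> fin_cases j <;> simp_all [real_inner_comm]
  have := finrank_span_eq_card hli
  rwa [Matrix.range_cons, Matrix.range_cons, Matrix.range_empty, union_empty, singleton_union,
    Fintype.card_fin] at this

variable [MeasurableSpace E] [BorelSpace E]

/-- A plane section of the boundary is at least as long as any segment in that section of the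
set. -/
theorem ofReal_le_hausdorffMeasure_frontier {S : Set E} (hS : Bornology.IsBounded S) {q t m : E}
    (ht : ‖t‖ = 1) (hm : ‖m‖ = 1) (htm : inner ℝ t m = 0) {H : Set E}
    (hH : ∀ x y : ℝ, q + x • t + y • m ∈ H) {a b : ℝ} (hab : ∀ x ∈ Icc a b, q + x • t ∈ S) :
    ENNReal.ofReal (b - a) ≤ μH[1] (frontier S ∩ H) := by
  set π : E → ℝ := fun y => inner ℝ t (y - q) with hπ
  have hL : LipschitzWith 1 π := by
    refine LipschitzWith.of_dist_le_mul fun x y => ?_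
    rw [Real.dist_eq, hπ, dist_eq_norm]
    simp only [← inner_sub_right, sub_sub_sub_cancel_right, NNReal.coe_one, one_mul]
    calc |inner ℝ t (x - y)| ≤ ‖t‖ * ‖x - y‖ := abs_real_inner_le_norm _ _
      _ = ‖x - y‖ := by rw [ht, one_mul]
  have himg : Icc a b ⊆ π '' (frontier S ∩ H) := by
    intro x hx
    obtain ⟨y, hy⟩ := exists_mem_frontier_on_line hS hm (hab x hx)
    refine ⟨_, ⟨hy, hH x y⟩, ?_⟩
    simp only [hπ]
    rw [show q + x • t + y • m - q = x • t + y • m by abel, inner_add_right, inner_smul_right,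
      inner_smul_right, htm, real_inner_self_eq_norm_sq, ht]
    simp
  calc ENNReal.ofReal (b - a) = volume (Icc a b) := Real.volume_Icc.symm
    _ ≤ volume (π '' (frontier S ∩ H)) := measure_mono himg
    _ = μH[1] (π '' (frontier S ∩ H)) := by rw [MeasureTheory.hausdorffMeasure_real]
    _ ≤ μH[1] (frontier S ∩ H) := by
      have := hL.hausdorffMeasure_image_le (d := 1) zero_le_one (frontier S ∩ H)
      simpa using this

theorem maxCurvature_mul_le_curvatureConst {S : Set E} {q t m : E} (ht : ‖t‖ = 1) (hm : ‖m‖ = 1)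
    (htm : inner ℝ t m = 0) :
    maxCurvature (frontier S ∩ planeThrough q t m) * μH[1] (frontier S ∩ planeThrough q t m) ≤
      curvatureConst S := by
  unfold curvatureConst
  exact le_iSup (fun H : {H : AffineSubspace ℝ E // Module.finrank ℝ H.direction = 2} =>
    maxCurvature (frontier S ∩ (H.1 : Set E)) * μH[1] (frontier S ∩ (H.1 : Set E)))
    ⟨planeThrough q t m, finrank_direction_planeThrough ht hm htm⟩

/-- If a plane section of `S` contains a segment of length `l`, then the curvature of the boundary
of this section is at most `κ / l`. -/
theorem maxCurvature_le_of_segment {S : Set E} (hS : Bornology.IsBounded S)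
    (hκ : curvatureConst S ≠ ⊤) {q t m : E}
    (ht : ‖t‖ = 1) (hm : ‖m‖ = 1) (htm : inner ℝ t m = 0) {a b : ℝ} (hab : a < b)
    (hseg : ∀ x ∈ Icc a b, q + x • t ∈ S) :
    maxCurvature (frontier S ∩ planeThrough q t m) ≤
      ENNReal.ofReal ((curvatureConst S).toReal / (b - a)) := by
  have h1 := ofReal_le_hausdorffMeasure_frontier hS ht hm htm (mem_planeThrough q t m) hseg
  have h2 := maxCurvature_mul_le_curvatureConst (S := S) (q := q) ht hm htm
  have hl : 0 < b - a := by linarith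
  rw [ENNReal.ofReal_div_of_pos hl, ENNReal.ofReal_toReal hκ,
    ENNReal.le_div_iff_mul_le (Or.inl (by simpa using hl)) (Or.inl ENNReal.ofReal_ne_top)]
  exact (mul_le_mul_right h1 _).trans h2

end

/-! ### Caps outside of a planar region -/

theorem second_deriv_nonpos_of_isLocalMax {f : ℝ → ℝ} {x l : ℝ} (hmax : IsLocalMax f x)
    (hc : ContinuousAt f x) (hf : HasDerivAt (deriv f) l x) : l ≤ 0 := by
  by_contra! hl
  have hmin : IsLocalMin f x :=
    isLocalMin_of_deriv_deriv_pos (by rwa [hf.deriv]) hmax.deriv_eq_zero hc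
  have hconst : f =ᶠ[𝓝 x] fun _ => f x := by
    filter_upwards [hmax, hmin] with y h1 h2 using le_antisymm h1 h2
  have h1 := hconst.deriv
  simp only [deriv_const'] at h1
  have := hf.unique ((hasDerivAt_const x (0 : ℝ)).congr_of_eventuallyEq h1)
  linarith

/-- A bounded open set `W` of the complement of a planar region `S` whose frontier is contained in
`S` except inside the disc of radius `r₀` about `c`, but which itself lies outside this disc, comes
as far from `c` as the radius of curvature of `∂S` allows: at a point of `W` farthest from `c`, the
boundary of `S` is curved at least as much as the circle about `c`. -/
theorem one_le_curvature_mul_of_cap [FiniteDimensional ℝ E] (hdim : Module.finrank ℝ E = 2)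
    {S : Set E} (hS : IsClosed S)
    (hC : HasC2Boundary S) {K : ℝ} (hK : 0 ≤ K)
    (hcurv : maxCurvature (frontier S) ≤ ENNReal.ofReal K) {W : Set E} {c : E} {r₀ s : ℝ}
    (hr₀ : 0 ≤ r₀) (hWo : IsOpen W) (hWne : W.Nonempty) (hWS : ∀ w ∈ W, w ∉ S)
    (hWcl : ∀ x ∈ closure W, x ∈ W ∨ x ∈ S ∨ dist x c ≤ r₀)
    (hWr : ∀ w ∈ W, r₀ < dist w c ∧ dist w c ≤ s) : 1 ≤ K * s := by
  have : ProperSpace E := FiniteDimensional.proper ℝ E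
  -- the point of the closure of `W` farthest from `c`
  have hcomp : IsCompact (closure W) := by
    refine (isCompact_closedBall c s).of_isClosed_subset isClosed_closure ?_
    exact closure_minimal (fun w hw => mem_closedBall.2 (hWr w hw).2) isClosed_closedBall
  obtain ⟨m, hm, hmax⟩ := hcomp.exists_isMaxOn hWne.closure
    (f := fun x => dist x c) (by fun_prop)
  have hmax : ∀ x ∈ closure W, dist x c ≤ dist m c := fun x hx => hmax hx
  obtain ⟨w₀, hw₀⟩ := hWne
  have hmr : r₀ < dist m c := (hWr w₀ hw₀).1.trans_le (hmax w₀ (subset_closure hw₀))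
  have hms : dist m c ≤ s := by
    have : closure W ⊆ closedBall c s :=
      closure_minimal (fun w hw => mem_closedBall.2 (hWr w hw).2) isClosed_closedBall
    exact mem_closedBall.1 (this hm)
  have hmW : m ∉ W := by
    intro hmW
    have h1 : ContinuousAt (fun η : ℝ => m + η • (m - c)) 0 := by fun_prop
    have h2 : ∀ᶠ η in 𝓝[>] (0 : ℝ), m + η • (m - c) ∈ W :=
      nhdsWithin_le_nhds (h1.eventually_mem (hWo.mem_nhds (by simpa using hmW)))
    obtain ⟨η, hη, hη0⟩ := (h2.and self_mem_nhdsWithin).exists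
    have hη0 : 0 < η := hη0
    have h3 := hmax _ (subset_closure hη)
    rw [dist_eq_norm, show m + η • (m - c) - c = (1 + η) • (m - c) by module, norm_smul,
      ← dist_eq_norm, Real.norm_of_nonneg (by linarith)] at h3
    nlinarith
  have hmS : m ∈ S := by
    rcases hWcl m hm with h | h | h
    · exact absurd h hmW
    · exact h
    · linarith
  have hmF : m ∈ frontier S := by
    rw [hS.frontier_eq]
    refine ⟨hmS, fun hi => ?_⟩
    obtain ⟨x, hx1, hx2⟩ := mem_closure_iff_nhds.1 hm _ (isOpen_interior.mem_nhds hi)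
    exact hWS x hx2 (interior_subset hx1)
  obtain ⟨ν, Z, r, hZ⟩ := exists_graphChart hS hC hmF
  -- a smaller ball, outside of the disc
  obtain ⟨r', hr', hr'r, hout⟩ : ∃ r' > 0, r' ≤ r ∧ ∀ x ∈ ball m r', r₀ < dist x c := by
    refine ⟨min r (dist m c - r₀), lt_min hZ.pos (by linarith), min_le_left _ _, fun x hx => ?_⟩
    have h1 : dist x m < dist m c - r₀ := (mem_ball.1 hx).trans_le (min_le_right _ _)
    have h2 := dist_triangle_left m c x
    linarith
  have hB : ball m r' ⊆ ball m r := ball_subset_ball hr'r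
  -- a connected set of the ball that avoids `S` and meets `W` lies in `W`
  have hconn : ∀ T : Set E, IsPreconnected T → T ⊆ ball m r' → (∀ x ∈ T, 0 < Z x) →
      (T ∩ W).Nonempty → T ⊆ W := by
    intro T hT hTB hTZ hTW
    refine hT.subset_left_of_subset_union hWo isClosed_closure.isOpen_compl
      (disjoint_left.2 fun x hx hx' => hx' (subset_closure hx)) (fun x hx => ?_) hTW
    by_cases hxc : x ∈ closure W
    · left
      rcases hWcl x hxc with h | h | h
      · exact h
      · exact absurd ((hZ.mem_iff x (hB (hTB hx))).1 h) (not_le.2 (hTZ x hx))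
      · exact absurd h (not_le.2 (hout x (hTB hx)))
    · right; exact hxc
  have hline : ∀ (x : E) (z : ℝ), x ∈ ball m r' → x + z • ν ∈ ball m r' → ∀ τ ∈ Icc 0 z,
      x + τ • ν ∈ ball m r' := by
    intro x z hx hxz τ hτ
    rcases hτ.1.eq_or_lt with h0 | h0
    · simpa [← h0] using hx
    have hz : 0 < z := h0.trans_le hτ.2
    apply (convex_ball m r').segment_subset hx hxz
    rw [segment_eq_image']
    refine ⟨τ / z, ⟨by positivity, (div_le_one hz).2 hτ.2⟩, ?_⟩
    simp only [add_sub_cancel_left, smul_smul]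
    rw [div_mul_cancel₀ _ hz.ne']
  set z₁ := r' / 2 with hz₁
  have hz₁0 : 0 < z₁ := by positivity
  have hmz : m + z₁ • ν ∈ ball m r' := by
    rw [mem_ball, dist_eq_norm, add_sub_cancel_left, norm_smul, hZ.norm_normal, mul_one,
      Real.norm_of_nonneg hz₁0.le]
    linarith
  have hmB : m ∈ ball m r' := mem_ball_self hr'
  have hcontν : ∀ x₀ : E, Tendsto (fun x : E => x + z₁ • ν) (𝓝 x₀) (𝓝 (x₀ + z₁ • ν)) := fun x₀ =>
    (continuous_add_const (z₁ • ν)).tendsto x₀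
  -- a neighbourhood of the point above `m` lies in `W`
  obtain ⟨d, hd, hdW⟩ : ∃ d > 0, ball (m + z₁ • ν) d ⊆ W := by
    have h1 : ∀ᶠ x in 𝓝 (m + z₁ • ν), x ∈ ball m r' ∧ 0 < Z x := by
      refine Filter.Eventually.and (isOpen_ball.mem_nhds hmz) ?_
      refine continuousAt_const.eventually_lt (hZ.contDiffAt (hB hmz)).continuousAt ?_
      rw [hZ.apply_add m (hB hmB) _ (hB hmz), hZ.apply_center]
      linarith
    obtain ⟨d, hd, hball⟩ := Metric.mem_nhds_iff.1 h1
    refine ⟨d, hd, hconn _ (convex_ball _ _).isPreconnected (fun x hx => (hball hx).1)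
      (fun x hx => (hball hx).2) ?_⟩
    have h2 : ∀ᶠ x in 𝓝 m, x ∈ ball m r' ∧ x + z₁ • ν ∈ ball (m + z₁ • ν) d :=
      Filter.Eventually.and (isOpen_ball.mem_nhds hmB) ((hcontν m) (ball_mem_nhds _ hd))
    obtain ⟨w, ⟨hw1, hw2⟩, hwW⟩ := mem_closure_iff_nhds.1 hm _ h2
    refine ⟨_, hw2, ?_⟩
    have h3 : (fun τ : ℝ => w + τ • ν) '' Icc 0 z₁ ⊆ W := by
      refine hconn _ (isPreconnected_Icc.image _ (by fun_prop)) ?_ ?_ ?_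
      · rintro _ ⟨τ, hτ, rfl⟩
        exact hline w z₁ hw1 (hball hw2).1 τ hτ
      · rintro _ ⟨τ, hτ, rfl⟩
        simp only
        rw [hZ.apply_add w (hB hw1) _ (hB (hline w z₁ hw1 (hball hw2).1 τ hτ))]
        have h4 : 0 < Z w := by
          by_contra! h
          exact hWS w hwW ((hZ.mem_iff w (hB hw1)).2 h)
        linarith [hτ.1]
      · exact ⟨w, ⟨0, ⟨le_rfl, hz₁0.le⟩, by simp⟩, hwW⟩
    exact h3 ⟨z₁, ⟨hz₁0.le, le_rfl⟩, rfl⟩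
  -- hence the boundary near `m` lies in the closure of `W`
  have hcl : ∀ᶠ q in 𝓝 m, Z q = 0 → q ∈ closure W := by
    have h2 : ∀ᶠ x in 𝓝 m, x ∈ ball m r' ∧ x + z₁ • ν ∈ ball (m + z₁ • ν) d ∧
        x + z₁ • ν ∈ ball m r' :=
      Filter.Eventually.and (isOpen_ball.mem_nhds hmB) (Filter.Eventually.and
        ((hcontν m) (ball_mem_nhds _ hd)) ((hcontν m) (isOpen_ball.mem_nhds hmz)))
    filter_upwards [h2] with q hq hq0
    have h3 : (fun τ : ℝ => q + τ • ν) '' Ioc 0 z₁ ⊆ W := by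
      refine hconn _ (isPreconnected_Ioc.image _ (by fun_prop)) ?_ ?_ ?_
      · rintro _ ⟨τ, hτ, rfl⟩
        exact hline q z₁ hq.1 hq.2.2 τ ⟨hτ.1.le, hτ.2⟩
      · rintro _ ⟨τ, hτ, rfl⟩
        simp only
        rw [hZ.apply_add q (hB hq.1) _ (hB (hline q z₁ hq.1 hq.2.2 τ ⟨hτ.1.le, hτ.2⟩)), hq0]
        linarith [hτ.1]
      · exact ⟨q + z₁ • ν, ⟨z₁, ⟨hz₁0, le_rfl⟩, rfl⟩, hdW hq.2.1⟩
    have h4 : Tendsto (fun τ : ℝ => q + τ • ν) (𝓝[>] 0) (𝓝 q) := by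
      have : ContinuousAt (fun τ : ℝ => q + τ • ν) 0 := by fun_prop
      have h5 := this.tendsto
      simp only [zero_smul, add_zero] at h5
      exact h5.mono_left nhdsWithin_le_nhds
    refine mem_closure_of_tendsto h4 ?_
    filter_upwards [Ioc_mem_nhdsGT hz₁0] with τ hτ using h3 ⟨τ, hτ, rfl⟩
  -- an arc of the boundary through `m`
  obtain ⟨t, ht, hνt⟩ : ∃ t : E, ‖t‖ = 1 ∧ inner ℝ ν t = 0 := by
    have hν0 : ν ≠ 0 := by
      intro h
      have := hZ.norm_normal
      simp [h] at this
    have h1 : Module.finrank ℝ (Submodule.span ℝ {ν})ᗮ = 1 := by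
      have h2 := Submodule.finrank_add_finrank_orthogonal (Submodule.span ℝ {ν})
      rw [finrank_span_singleton hν0, hdim] at h2
      omega
    have h3 : Nontrivial (Submodule.span ℝ {ν})ᗮ := Module.nontrivial_of_finrank_pos (R := ℝ)
      (by omega)
    obtain ⟨x, hx⟩ := exists_ne (0 : (Submodule.span ℝ {ν})ᗮ)
    have hx0 : (x : E) ≠ 0 := by simpa using hx
    refine ⟨‖(x : E)‖⁻¹ • (x : E), norm_smul_inv_norm hx0, ?_⟩
    rw [inner_smul_right, (Submodule.mem_orthogonal_singleton_iff_inner_right).1 x.2, mul_zero]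
  obtain ⟨γ, a, ha, hγ, hγ0, hγs, -⟩ :=
    exists_unit_speed_arc (t := t) (m := ν) isOpen_ball hZ.contDiffOn (mem_ball_self hZ.pos)
      hZ.apply_center ht hZ.norm_normal (by rw [real_inner_comm, hνt])
      (by rw [hZ.fderiv_center, hνt])
      (by rw [hZ.fderiv_normal (mem_ball_self hZ.pos)]; exact one_ne_zero)
  have hacc : ‖deriv (deriv γ) 0‖ ≤ K := by
    have h1 : ‖deriv (deriv γ) 0‖ₑ ≤ maxCurvature (frontier S) :=
      enorm_le_maxCurvature ha hγ fun s hs =>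
        ⟨(hZ.mem_frontier_iff hS (hγs s hs).1).2 (hγs s hs).2.1, (hγs s hs).2.2.1⟩
    have := h1.trans hcurv
    rw [← ofReal_norm] at this
    exact (ENNReal.ofReal_le_ofReal_iff hK).1 this
  have hna : Ioo (-a) a ∈ 𝓝 (0 : ℝ) := Ioo_mem_nhds (by linarith) ha
  have hγd : ∀ s ∈ Ioo (-a) a, HasDerivAt γ (deriv γ s) s := fun s hs =>
    ((hγ.contDiffAt (isOpen_Ioo.mem_nhds hs)).differentiableAt two_ne_zero).hasDerivAt
  have hγ2 : HasDerivAt (deriv γ) (deriv (deriv γ) 0) 0 := by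
    have := hγ.deriv_of_isOpen (m := 1) isOpen_Ioo (by norm_num)
    exact ((this.contDiffAt hna).differentiableAt one_ne_zero).hasDerivAt
  have h0a : (0 : ℝ) ∈ Ioo (-a) a := ⟨by linarith, ha⟩
  set g : ℝ → ℝ := fun s => inner ℝ (γ s - c) (γ s - c) with hg
  have hgd : ∀ s ∈ Ioo (-a) a, HasDerivAt g (2 * inner ℝ (γ s - c) (deriv γ s)) s := by
    intro s hs
    have h1 := ((hγd s hs).sub_const c).inner ℝ ((hγd s hs).sub_const c)
    rw [real_inner_comm, ← two_mul] at h1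
    convert! h1 using 1
    rw [real_inner_comm]
  have hgmax : IsLocalMax g 0 := by
    have h1 : ∀ᶠ s in 𝓝 (0 : ℝ), Z (γ s) = 0 → γ s ∈ closure W := by
      have : Tendsto γ (𝓝 0) (𝓝 m) := by
        have := (hγd 0 h0a).continuousAt.tendsto
        rwa [hγ0] at this
      exact this.eventually hcl
    filter_upwards [h1, hna] with s hs hsa
    have h2 := hmax _ (hs (hγs s hsa).2.1)
    simp only [hg, real_inner_self_eq_norm_sq, hγ0, ← dist_eq_norm]
    gcongr
  have hg2 : HasDerivAt (deriv g) (2 * (1 + inner ℝ (m - c) (deriv (deriv γ) 0))) 0 := by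
    have h1 : deriv g =ᶠ[𝓝 0] fun s => 2 * inner ℝ (γ s - c) (deriv γ s) := by
      filter_upwards [hna] with s hs using (hgd s hs).deriv
    have h2 := (((hγd 0 h0a).sub_const c).inner ℝ hγ2).const_mul 2
    rw [hγ0, real_inner_self_eq_norm_sq, (hγs 0 h0a).2.2.1] at h2
    refine HasDerivAt.congr_of_eventuallyEq ?_ h1
    convert! h2 using 1
    ring
  have h1 := second_deriv_nonpos_of_isLocalMax hgmax (hgd 0 h0a).continuousAt hg2
  have h2 := abs_real_inner_le_norm (m - c) (deriv (deriv γ) 0)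
  have h3 := neg_abs_le (inner ℝ (m - c) (deriv (deriv γ) 0))
  rw [← dist_eq_norm] at h2
  have h4 : dist m c * ‖deriv (deriv γ) 0‖ ≤ s * K :=
    mul_le_mul hms hacc (norm_nonneg _) (dist_nonneg.trans hms)
  linarith

/-! ### Local convexity in dimension at least three -/

/-- The second derivative of a chart along a line. -/
theorem IsGraphChart.hasDerivAt_line {S : Set E} {p ν : E} {Z : E → ℝ} {r : ℝ}
    (h : IsGraphChart S p ν Z r) {q w : E} {s : ℝ} (hs : q + s • w ∈ ball p r) :
    HasDerivAt (fun x : ℝ => Z (q + x • w)) (fderiv ℝ Z (q + s • w) w) s ∧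
      HasDerivAt (deriv fun x : ℝ => Z (q + x • w))
        (fderiv ℝ (fderiv ℝ Z) (q + s • w) w w) s := by
  have hl : ∀ x : ℝ, HasDerivAt (fun x : ℝ => q + x • w) w x := fun x => by
    simpa using ((hasDerivAt_id x).smul_const w).const_add q
  have h1 : ∀ x : ℝ, q + x • w ∈ ball p r →
      HasDerivAt (fun x : ℝ => Z (q + x • w)) (fderiv ℝ Z (q + x • w) w) x := fun x hx =>
    HasFDerivAt.comp_hasDerivAt x (h.hasFDerivAt hx) (hl x)
  refine ⟨h1 s hs, ?_⟩
  have hev : ∀ᶠ x in 𝓝 s, q + x • w ∈ ball p r := by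
    have : ContinuousAt (fun x : ℝ => q + x • w) s := (hl s).continuousAt
    exact this.eventually_mem (isOpen_ball.mem_nhds hs)
  have h2 : (deriv fun x : ℝ => Z (q + x • w)) =ᶠ[𝓝 s] fun x => fderiv ℝ Z (q + x • w) w := by
    filter_upwards [hev] with x hx using (h1 x hx).deriv
  refine HasDerivAt.congr_of_eventuallyEq ?_ h2
  have h3 := (HasFDerivAt.comp_hasDerivAt s (h.hasFDerivAt_fderiv hs) (hl s)).clm_apply
    (hasDerivAt_const s w)
  simpa using h3

/-- In dimension at least three, a finite curvature constant excludes saddle points of the boundary: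
if the boundary bends away from a tangent vector `t`, then `S` contains a segment in the direction
of `t`, and among the planes through this segment there are some which are arbitrarily close to
being tangent and whose sections are therefore curved arbitrarily much. -/
theorem IsGraphChart.hessian_nonneg [FiniteDimensional ℝ E] [MeasurableSpace E] [BorelSpace E]
    (hdim : 3 ≤ Module.finrank ℝ E) {S : Set E}
    {p ν : E} {Z : E → ℝ} {r : ℝ}
    (h : IsGraphChart S p ν Z r) (hS : IsClosed S) (hSb : Bornology.IsBounded S)
    (hκ : curvatureConst S ≠ ⊤) {q t : E} (hq : q ∈ ball p r) (hq0 : Z q = 0)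
    (ht : fderiv ℝ Z q t = 0) : 0 ≤ fderiv ℝ (fderiv ℝ Z) q t t := by
  wlog ht1 : ‖t‖ = 1 generalizing t
  · rcases eq_or_ne t 0 with rfl | ht0
    · simp
    have h1 := this (t := ‖t‖⁻¹ • t) (by simp [ht]) (norm_smul_inv_norm ht0)
    simp only [map_smul, smul_apply, smul_eq_mul] at h1
    have h2 : 0 < ‖t‖⁻¹ := inv_pos.2 (norm_pos_iff.2 ht0)
    exact nonneg_of_mul_nonneg_right (nonneg_of_mul_nonneg_right h1 h2) h2
  by_contra! hneg
  set g : E := (InnerProductSpace.toDual ℝ E).symm (fderiv ℝ Z q) with hg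
  have hgi : ∀ w, fderiv ℝ Z q w = inner ℝ g w := fun w => by
    rw [hg, InnerProductSpace.toDual_symm_apply]
  have hg0 : g ≠ 0 := by
    intro h0
    have := h.fderiv_normal hq
    simp [hgi, h0] at this
  have hgn : 0 < ‖g‖ := norm_pos_iff.2 hg0
  set g' : E := ‖g‖⁻¹ • g with hg'
  have hg1 : ‖g'‖ = 1 := norm_smul_inv_norm hg0
  have hgt : inner ℝ g' t = (0 : ℝ) := by rw [hg', inner_smul_left, ← hgi, ht, mul_zero]
  have hgg : fderiv ℝ Z q g' = ‖g‖ := by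
    rw [hgi, hg', inner_smul_right, real_inner_self_eq_norm_sq]
    field_simp
  -- a second tangent direction
  obtain ⟨w, hw1, hwt, hwg⟩ :
      ∃ w : E, ‖w‖ = 1 ∧ inner ℝ w t = (0 : ℝ) ∧ inner ℝ w g' = (0 : ℝ) := by
    have h1 : Module.finrank ℝ (Submodule.span ℝ {t, g'}) ≤ 2 := by
      classical
      have h2 := finrank_span_finset_le_card (R := ℝ) ({t, g'} : Finset E)
      rw [Finset.coe_pair] at h2
      exact h2.trans Finset.card_le_two
    have h2 := Submodule.finrank_add_finrank_orthogonal (Submodule.span ℝ {t, g'})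
    have h3 : Nontrivial (Submodule.span ℝ {t, g'})ᗮ :=
      Module.nontrivial_of_finrank_pos (R := ℝ) (by omega)
    obtain ⟨x, hx⟩ := exists_ne (0 : (Submodule.span ℝ {t, g'})ᗮ)
    have hx0 : (x : E) ≠ 0 := by simpa using hx
    have h4 := (Submodule.mem_orthogonal' _ _).1 x.2
    refine ⟨‖(x : E)‖⁻¹ • (x : E), norm_smul_inv_norm hx0, ?_, ?_⟩
    · rw [inner_smul_left, h4 t (Submodule.subset_span (by simp)), mul_zero]
    · rw [inner_smul_left, h4 g' (Submodule.subset_span (by simp)), mul_zero]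
  -- the segment
  obtain ⟨d, hd, hseg⟩ : ∃ d : ℝ, 0 < d ∧ ∀ x ∈ Icc (-d) d, q + x • t ∈ S := by
    have h0 : q + (0 : ℝ) • t ∈ ball p r := by simpa using hq
    obtain ⟨h1, h2⟩ := h.hasDerivAt_line (w := t) h0
    have hmax : IsLocalMax (fun x : ℝ => Z (q + x • t)) 0 := by
      refine isLocalMax_of_deriv_deriv_neg ?_ ?_ h1.continuousAt
      · rw [h2.deriv]; simpa using hneg
      · rw [h1.deriv]; simpa using ht
    have h3 : ∀ᶠ x in 𝓝 (0 : ℝ), q + x • t ∈ S := by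
      filter_upwards [hmax, h.eventually_mem hq t] with x hx hxb
      exact (h.mem_iff _ hxb).2 (by simpa [hq0] using hx)
    obtain ⟨d, hd, hball⟩ := Metric.mem_nhds_iff.1 h3
    refine ⟨d / 2, half_pos hd, fun x hx => hball ?_⟩
    rw [mem_ball, Real.dist_eq, sub_zero, abs_lt]
    constructor <;> linarith [hx.1, hx.2]
  -- the planes through the segment
  set C := (curvatureConst S).toReal / (d - -d) with hCdef
  have hC : 0 ≤ C := div_nonneg ENNReal.toReal_nonneg (by linarith)
  have hkey : ∀ α : ℝ, Real.sin α ≠ 0 →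
      |fderiv ℝ (fderiv ℝ Z) q t t| ≤ C * |Real.sin α * ‖g‖| := by
    intro α hα
    set m : E := Real.cos α • w + Real.sin α • g' with hm
    have hwZ : fderiv ℝ Z q w = 0 := by
      rw [hgi, real_inner_comm]
      have : inner ℝ w (‖g‖ • g') = (0 : ℝ) := by rw [inner_smul_right, hwg, mul_zero]
      rwa [hg', smul_smul, mul_inv_cancel₀ hgn.ne', one_smul] at this
    have hZm : fderiv ℝ Z q m = Real.sin α * ‖g‖ := by
      rw [hm, map_add, map_smul, map_smul, hwZ, hgg]; simp
    have htm : inner ℝ t m = (0 : ℝ) := by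
      rw [hm, inner_add_right, inner_smul_right, inner_smul_right, real_inner_comm, hwt,
        real_inner_comm, hgt]
      simp
    have hm1 : ‖m‖ = 1 := by
      have h1 : ‖m‖ ^ 2 = 1 := by
        rw [← real_inner_self_eq_norm_sq, hm, inner_add_left, inner_add_right, inner_add_right]
        simp only [inner_smul_left, inner_smul_right, hwg, real_inner_self_eq_norm_sq, hw1, hg1,
          real_inner_comm w g', conj_trivial]
        nlinarith [Real.sin_sq_add_cos_sq α]
      nlinarith [norm_nonneg m]
    rw [← hZm]
    exact h.abs_hessian_le hS hq hq0 ht1 hm1 htm ht (by rw [hZm]; exact mul_ne_zero hα hgn.ne')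
      (mem_planeThrough q t m) hC
      (maxCurvature_le_of_segment hSb hκ ht1 hm1 htm (by linarith) hseg)
  have hlim : Tendsto (fun α : ℝ => C * |Real.sin α * ‖g‖|) (𝓝[>] 0) (𝓝 0) := by
    have : Continuous fun α : ℝ => C * |Real.sin α * ‖g‖| := by fun_prop
    have h1 := this.tendsto 0
    simp only [Real.sin_zero, zero_mul, abs_zero, mul_zero] at h1
    exact h1.mono_left nhdsWithin_le_nhds
  have hle := ge_of_tendsto hlim (b := |fderiv ℝ (fderiv ℝ Z) q t t|) (by
    filter_upwards [Ioo_mem_nhdsGT Real.pi_pos] with α hα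
    exact hkey α (Real.sin_pos_of_mem_Ioo hα).ne')
  have := abs_pos.2 hneg.ne
  linarith

theorem IsGraphChart.hessian_add {S : Set E} {p ν : E} {Z : E → ℝ} {r : ℝ}
    (h : IsGraphChart S p ν Z r) {q : E} {s : ℝ} (hq : q ∈ ball p r) (hqs : q + s • ν ∈ ball p r) :
    fderiv ℝ (fderiv ℝ Z) (q + s • ν) = fderiv ℝ (fderiv ℝ Z) q ∧
      fderiv ℝ Z (q + s • ν) = fderiv ℝ Z q := by
  have h1 : (fun x => Z (x + s • ν)) =ᶠ[𝓝 q] fun x => Z x + s := by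
    have h2 : ∀ᶠ x in 𝓝 q, x + s • ν ∈ ball p r :=
      ((continuous_add_const (s • ν)).tendsto q).eventually_mem (isOpen_ball.mem_nhds hqs)
    filter_upwards [isOpen_ball.mem_nhds hq, h2] with x hx hxs using h.apply_add x hx s hxs
  have h2 := h1.fderiv (𝕜 := ℝ)
  have h3 := h2.fderiv (𝕜 := ℝ)
  have e1 : fderiv ℝ (fun x => Z (x + s • ν)) = fun x => fderiv ℝ Z (x + s • ν) := by
    ext1 x; rw [fderiv_comp_add_right]
  have e2 : fderiv ℝ (fun x => Z x + s) = fderiv ℝ Z := by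
    ext1 x; rw [fderiv_add_const]
  rw [e1, e2] at h2 h3
  refine ⟨?_, h2.eq_of_nhds⟩
  have := h3.eq_of_nhds
  rwa [fderiv_comp_add_right] at this

/-- In dimension at least three, a set with a finite curvature constant is locally convex: a chart
is a convex function, because its Hessian is nonnegative on the tangent vectors and vanishes on the
normal. -/
theorem exists_convex_inter_ball [FiniteDimensional ℝ E] [MeasurableSpace E] [BorelSpace E]
    (hdim : 3 ≤ Module.finrank ℝ E) {S : Set E} (hS : IsClosed S) (hSb : Bornology.IsBounded S)
    (hC : HasC2Boundary S) (hκ : curvatureConst S ≠ ⊤) {p : E} (hp : p ∈ S) :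
    ∃ r > 0, Convex ℝ (S ∩ ball p r) := by
  by_cases hpi : p ∈ interior S
  · obtain ⟨r, hr, hb⟩ := Metric.mem_nhds_iff.1 (mem_interior_iff_mem_nhds.1 hpi)
    refine ⟨r, hr, ?_⟩
    rw [inter_eq_right.2 hb]
    exact convex_ball p r
  obtain ⟨ν, Z, r, h⟩ := exists_graphChart hS hC (p := p) (by rw [hS.frontier_eq]; exact ⟨hp, hpi⟩)
  have hpb : p ∈ ball p r := mem_ball_self h.pos
  have h1 : ∀ᶠ x in 𝓝 p, x ∈ ball p r ∧ x + (-Z x) • ν ∈ ball p r := by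
    have : ContinuousAt (fun x => x + (-Z x) • ν) p :=
      continuousAt_id.add (((h.contDiffAt hpb).continuousAt.neg).smul_const ν)
    exact Filter.Eventually.and (isOpen_ball.mem_nhds hpb)
      (this.eventually_mem (isOpen_ball.mem_nhds (by simpa [h.apply_center] using hpb)))
  obtain ⟨r', hr', hb⟩ := Metric.mem_nhds_iff.1 h1
  have hpos : ∀ x ∈ ball p r', ∀ w, 0 ≤ fderiv ℝ (fderiv ℝ Z) x w w := by
    intro x hx w
    obtain ⟨hx1, hx2⟩ := hb hx
    obtain ⟨e1, e2⟩ := h.hessian_add hx1 hx2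
    set t := w - fderiv ℝ Z x w • ν with ht
    have hw : w = t + fderiv ℝ Z x w • ν := by rw [ht]; abel
    have hν : ∀ y, fderiv ℝ (fderiv ℝ Z) x y ν = 0 := h.hessian_normal hx1
    have hν' : ∀ y, fderiv ℝ (fderiv ℝ Z) x ν y = 0 := fun y => by
      rw [h.hessian_comm hx1, hν]
    have h2 : fderiv ℝ (fderiv ℝ Z) x w w = fderiv ℝ (fderiv ℝ Z) x t t := by
      conv_lhs => rw [hw]
      simp only [map_add, map_smul, add_apply, smul_apply, hν, hν', smul_zero, add_zero]
    rw [h2, ← e1]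
    refine h.hessian_nonneg hdim hS hSb hκ hx2 ?_ ?_
    · rw [h.apply_add x hx1 _ hx2]; ring
    · rw [e2, ht, map_sub, map_smul, h.fderiv_normal hx1]; simp
  refine ⟨r', hr', fun x hx y hy a b ha hb' hab => ?_⟩
  have hball := convex_ball p r' hx.2 hy.2 ha hb' hab
  refine ⟨?_, hball⟩
  rw [h.mem_iff _ (hb hball).1]
  have hline : ∀ τ ∈ Icc (0 : ℝ) 1, x + τ • (y - x) ∈ ball p r' := fun τ hτ => by
    have := convex_ball p r' hx.2 hy.2 (sub_nonneg.2 hτ.2) hτ.1 (sub_add_cancel 1 τ)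
    convert! this using 1
    module
  set f : ℝ → ℝ := fun τ => Z (x + τ • (y - x)) with hf
  have hd := fun τ (hτ : τ ∈ Icc (0 : ℝ) 1) => h.hasDerivAt_line (w := y - x) (hb (hline τ hτ)).1
  have hconv : ConvexOn ℝ (Icc 0 1) f := by
    refine convexOn_of_deriv2_nonneg' (convex_Icc 0 1)
      (fun τ hτ => (hd τ hτ).1.differentiableAt.differentiableWithinAt)
      (fun τ hτ => (hd τ hτ).2.differentiableAt.differentiableWithinAt) (fun τ hτ => ?_)
    rw [Function.iterate_succ, Function.iterate_one, Function.comp_apply, (hd τ hτ).2.deriv]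
    exact hpos _ (hline τ hτ) _
  have h3 := hconv.2 (x := 0) (y := 1) ⟨le_rfl, zero_le_one⟩ ⟨zero_le_one, le_rfl⟩ ha hb' hab
  have h4 : f 0 ≤ 0 := by
    simpa [hf] using (h.mem_iff x (hb hx.2).1).1 hx.1
  have h5 : f 1 ≤ 0 := by
    simpa [hf] using (h.mem_iff y (hb hy.2).1).1 hy.1
  have h6 : f (a • 0 + b • 1) = Z (a • x + b • y) := by
    simp only [hf, smul_eq_mul, mul_zero, zero_add, mul_one]
    congr 1
    rw [show a = 1 - b by linarith]
    module
  rw [h6] at h3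
  simp only [smul_eq_mul] at h3
  nlinarith

theorem sees_iff_forall {S : Set E} {u v : E} :
    Sees S u v ↔ ∀ l ∈ Icc (0 : ℝ) 1, u + l • (v - u) ∈ S := by
  rw [Sees, segment_eq_image', image_subset_iff]
  rfl

/-- In a locally convex closed set, the points seen by a point of the set are also seen by every
interior point that sees this point. -/
theorem Sees.trans_of_locally_convex {S : Set E} (hS : IsClosed S)
    (hloc : ∀ p ∈ S, ∃ r > 0, Convex ℝ (S ∩ ball p r)) {u v x : E} (hv : v ∈ interior S)
    (huv : Sees S u v) (hux : Sees S u x) : Sees S v x := by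
  have hseg : ∀ y, Sees S v y ↔ ∀ l ∈ Icc (0 : ℝ) 1, v + l • (y - v) ∈ S := fun y =>
    sees_iff_forall
  -- a segment of `S` that starts at `v` stays in the interior of `S` up to its end
  have hint : ∀ y, Sees S v y → ∀ l ∈ Ico (0 : ℝ) 1, v + l • (y - v) ∈ interior S := by
    intro y hy l₀ hl₀
    by_contra hno
    have hmem := (hseg y).1 hy
    have hcont : Continuous fun l : ℝ => v + l • (y - v) := by fun_prop
    obtain ⟨l, ⟨hl, hlI⟩, hleast⟩ :
        ∃ l, IsLeast (Icc 0 l₀ ∩ {l : ℝ | v + l • (y - v) ∉ interior S}) l :=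
      (isCompact_Icc.inter_right
        (isOpen_interior.isClosed_compl.preimage hcont)).exists_isLeast ⟨l₀, ⟨hl₀.1, le_rfl⟩, hno⟩
    have hl0 : 0 < l := by
      refine lt_of_le_of_ne hl.1 fun h0 => hlI ?_
      simpa [← h0] using hv
    have hl1 : l < 1 := hl.2.trans_lt hl₀.2
    obtain ⟨r, hr, hconv⟩ := hloc _ (hmem l ⟨hl.1, hl1.le⟩)
    have hnb : ∀ᶠ l' in 𝓝 l, v + l' • (y - v) ∈ ball (v + l • (y - v)) r :=
      hcont.continuousAt.eventually_mem (ball_mem_nhds _ hr)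
    obtain ⟨d, hd, hdb⟩ := Metric.mem_nhds_iff.1 hnb
    obtain ⟨l₁, hl₁, hl₁l⟩ : ∃ l₁, max 0 (l - d) < l₁ ∧ l₁ < l :=
      exists_between (max_lt hl0 (by linarith))
    obtain ⟨l₂, hl₂, hl₂b⟩ : ∃ l₂, l < l₂ ∧ l₂ < min 1 (l + d) :=
      exists_between (lt_min hl1 (by linarith))
    have h1 : v + l₁ • (y - v) ∈ interior (S ∩ ball (v + l • (y - v)) r) := by
      rw [interior_inter, isOpen_ball.interior_eq]
      refine ⟨?_, hdb ?_⟩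
      · by_contra h
        exact absurd (hleast ⟨⟨((le_max_left _ _).trans hl₁.le), hl₁l.le.trans hl.2⟩, h⟩)
          (not_le.2 hl₁l)
      · rw [mem_ball, Real.dist_eq, abs_lt]
        constructor <;> linarith [(le_max_right 0 (l - d)).trans_lt hl₁]
    have h2 : v + l₂ • (y - v) ∈ S ∩ ball (v + l • (y - v)) r :=
      ⟨hmem l₂ ⟨by linarith, (hl₂b.trans_le (min_le_left _ _)).le⟩, hdb (by
        rw [mem_ball, Real.dist_eq, abs_lt]
        constructor <;> linarith [hl₂b.trans_le (min_le_right 1 (l + d))])⟩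
    have h3 := hconv.openSegment_interior_self_subset_interior h1 h2
    refine hlI (interior_mono inter_subset_left (h3 ?_))
    rw [openSegment_eq_image']
    refine ⟨(l - l₁) / (l₂ - l₁), ⟨div_pos (by linarith) (by linarith),
      (div_lt_one (by linarith)).2 (by linarith)⟩, ?_⟩
    have h4 : (l - l₁) / (l₂ - l₁) * (l₂ - l₁) = l - l₁ :=
      div_mul_cancel₀ _ (by linarith)
    calc v + l₁ • (y - v) + ((l - l₁) / (l₂ - l₁)) • (v + l₂ • (y - v) - (v + l₁ • (y - v)))
        = v + (l₁ + (l - l₁) / (l₂ - l₁) * (l₂ - l₁)) • (y - v) := by module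
      _ = v + l • (y - v) := by rw [h4]; congr 2; ring
  -- sweep the segment from `u` to `x`
  have hux' : ∀ s ∈ Icc (0 : ℝ) 1, u + s • (x - u) ∈ S := fun s hs =>
    hux (by rw [segment_eq_image']; exact ⟨s, hs, rfl⟩)
  have hsub : Icc (0 : ℝ) 1 ⊆ {s | Sees S v (u + s • (x - u))} := by
    refine IsClosed.Icc_subset_of_forall_mem_nhdsWithin ?_ ?_ ?_
    · refine IsClosed.inter ?_ isClosed_Icc
      simp only [hseg, ofPred_forall]
      exact isClosed_iInter fun l => isClosed_iInter fun _ => hS.preimage (by fun_prop)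
    · simp only [mem_ofPred_eq, zero_smul, add_zero]
      rw [Sees, segment_symm]
      exact huv
    · rintro s ⟨hs, hs01⟩
      simp only [mem_ofPred_eq] at hs
      have hyc : Continuous fun s : ℝ => u + s • (x - u) := by fun_prop
      obtain ⟨r, hr, hconv⟩ := hloc _ (hux' s ⟨hs01.1, hs01.2.le⟩)
      obtain ⟨l₀, hl₀b, hl₀⟩ : ∃ l₀ : ℝ, v + l₀ • (u + s • (x - u) - v) ∈ ball (u + s • (x - u)) r ∧
          l₀ ∈ Ioo (0 : ℝ) 1 := by
        have h1 : ContinuousAt (fun l : ℝ => v + l • (u + s • (x - u) - v)) 1 := by fun_prop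
        have h2 : ∀ᶠ l in 𝓝[<] (1 : ℝ), v + l • (u + s • (x - u) - v) ∈ ball (u + s • (x - u)) r :=
          nhdsWithin_le_nhds (h1.eventually_mem (by
            rw [one_smul, add_sub_cancel]; exact ball_mem_nhds _ hr))
        exact (h2.and (Ioo_mem_nhdsLT one_pos)).exists
      have hev1 : ∀ᶠ s' in 𝓝 s,
          ∀ l ∈ Icc (0 : ℝ) l₀, v + l • (u + s' • (x - u) - v) ∈ interior S := by
        refine isCompact_Icc.eventually_forall_of_forall_eventually fun l hl => ?_
        have h1 : Continuous fun z : ℝ × ℝ => v + z.2 • (u + z.1 • (x - u) - v) := by fun_prop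
        exact h1.continuousAt.eventually_mem (isOpen_interior.mem_nhds
          (hint _ hs l ⟨hl.1, hl.2.trans_lt hl₀.2⟩))
      have hev2 : ∀ᶠ s' in 𝓝 s, v + l₀ • (u + s' • (x - u) - v) ∈ ball (u + s • (x - u)) r := by
        have h1 : Continuous fun s' : ℝ => v + l₀ • (u + s' • (x - u) - v) := by fun_prop
        exact h1.continuousAt.eventually_mem (isOpen_ball.mem_nhds hl₀b)
      have hev3 : ∀ᶠ s' in 𝓝 s, u + s' • (x - u) ∈ ball (u + s • (x - u)) r :=
        hyc.continuousAt.eventually_mem (ball_mem_nhds _ hr)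
      filter_upwards [nhdsWithin_le_nhds hev1, nhdsWithin_le_nhds hev2, nhdsWithin_le_nhds hev3,
        Ioo_mem_nhdsGT hs01.2] with s' h1 h2 h3 h4
      rw [hseg]
      intro l hl
      rcases le_total l l₀ with h | h
      · exact interior_subset (h1 l ⟨hl.1, h⟩)
      · have ha : v + l₀ • (u + s' • (x - u) - v) ∈ S ∩ ball (u + s • (x - u)) r :=
          ⟨interior_subset (h1 l₀ ⟨hl₀.1.le, le_rfl⟩), h2⟩
        have hb : u + s' • (x - u) ∈ S ∩ ball (u + s • (x - u)) r :=
          ⟨hux' s' ⟨hs01.1.trans h4.1.le, h4.2.le⟩, h3⟩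
        refine (hconv.segment_subset ha hb ?_).1
        rw [segment_eq_image']
        refine ⟨(l - l₀) / (1 - l₀), ⟨div_nonneg (by linarith) (by linarith [hl₀.2]),
          (div_le_one (by linarith [hl₀.2])).2 (by linarith [hl.2])⟩, ?_⟩
        have h5 : (l - l₀) / (1 - l₀) * (1 - l₀) = l - l₀ :=
          div_mul_cancel₀ _ (by linarith [hl₀.2])
        calc v + l₀ • (u + s' • (x - u) - v) + ((l - l₀) / (1 - l₀)) •
              (u + s' • (x - u) - (v + l₀ • (u + s' • (x - u) - v)))
            = v + (l₀ + (l - l₀) / (1 - l₀) * (1 - l₀)) • (u + s' • (x - u) - v) := by module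
          _ = v + l • (u + s' • (x - u) - v) := by rw [h5]; congr 2; ring
  simpa using hsub ⟨zero_le_one, le_rfl⟩

/-! ### Obstacles and islands in the plane -/

/-- A set `T` in the plane has caps of size at least `1 / K` if no component of its complement
sticks out of a disc by a cap whose points are closer than `1 / K` to the centre of the disc. -/
def HasLargeCaps (T : Set ℂ) (K : ℝ) : Prop :=
  ∀ (W : Set ℂ) (c : ℂ) (r₀ s : ℝ), 0 ≤ r₀ → IsOpen W → W.Nonempty → (∀ w ∈ W, w ∉ T) →
    (∀ x ∈ closure W, x ∈ W ∨ x ∈ T ∨ dist x c ≤ r₀) →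
    (∀ w ∈ W, r₀ < dist w c ∧ dist w c ≤ s) → 1 ≤ K * s

theorem hasLargeCaps_preimage [FiniteDimensional ℝ E] (hdim : Module.finrank ℝ E = 2)
    {S : Set E} (hS : IsClosed S) (hC : HasC2Boundary S) {K : ℝ} (hK : 0 ≤ K)
    (hcurv : maxCurvature (frontier S) ≤ ENNReal.ofReal K) (A : ℂ ≃ᵢ E) :
    HasLargeCaps (A ⁻¹' S) K := by
  intro W c r₀ s hr₀ hWo hWne hWT hWcl hWr
  refine one_le_curvature_mul_of_cap hdim hS hC hK hcurv (W := A '' W) (c := A c) hr₀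
    (A.toHomeomorph.isOpenMap W hWo) (hWne.image A) ?_ ?_ ?_
  · rintro _ ⟨w, hw, rfl⟩
    exact hWT w hw
  · intro x hx
    have hx' : x ∈ A '' closure W := by
      have := A.toHomeomorph.image_closure W
      change A '' closure W = closure (A '' W) at this
      rwa [this]
    obtain ⟨w, hw, rfl⟩ := hx'
    rcases hWcl w hw with h | h | h
    · exact Or.inl ⟨w, h, rfl⟩
    · exact Or.inr (Or.inl h)
    · exact Or.inr (Or.inr (by rwa [A.dist_eq]))
  · rintro _ ⟨w, hw, rfl⟩
    rw [A.dist_eq]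
    exact hWr w hw

set_option maxHeartbeats 400000 in
/-- An obstacle `o` below a segment of `T` on the real axis which starts in the centre of a disc
contained in `T` is far from this centre, if it is close to the axis compared with its distance from
the end of the segment. -/
theorem HasLargeCaps.le_of_obstacle {T : Set ℂ} {K : ℝ} (hK : 0 < K) (hT : HasLargeCaps T K)
    (hTc : IsClosed T) {ε δ τ : ℝ} {o : ℂ} (hε : 0 < ε) (hδε : 7 * δ < ε)
    (hball : closedBall 0 ε ⊆ T)
    (hray : ∀ x ∈ Icc 0 τ, (x : ℂ) ∈ T) (hoT : o ∉ T) (ho0 : 0 < o.re) (hoτ : o.re < τ)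
    (ho2 : o.im < 0) (hoδ : -o.im ≤ δ) (hoim : -o.im * τ ≤ 6 / 5 * δ * (τ - o.re)) :
    ε ≤ 5 * K * (o.re * τ) := by
  by_contra! hlt
  set ρ := K⁻¹ with hρ
  have hρ0 : 0 < ρ := inv_pos.2 hK
  have hlt : o.re * τ < ρ * ε / 5 := by
    have h1 : ρ * (5 * K * (o.re * τ)) < ρ * ε := mul_lt_mul_of_pos_left hlt hρ0
    have h2 : ρ * (5 * K * (o.re * τ)) = 5 * (o.re * τ) := by rw [hρ]; field_simp
    linarith
  have hτ : 0 < τ := ho0.trans hoτ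
  have hδ0 : 0 < δ := by linarith
  -- size of the obstacle's coordinates
  have ho1 : 98 / 100 * ε < o.re := by
    have h1 : ε ^ 2 < o.re ^ 2 + o.im ^ 2 := by
      have h2 : ε < ‖o‖ := by
        by_contra! h
        exact hoT (hball (by simpa using h))
      have h3 := Complex.sq_norm o
      rw [Complex.normSq_apply] at h3
      nlinarith [norm_nonneg o]
    have h2 : o.im ^ 2 ≤ (ε / 7) ^ 2 := by
      rw [← neg_sq o.im]
      exact pow_le_pow_left₀ (by linarith) (by linarith) 2
    by_contra! h
    nlinarith
  have hτρ : τ ≤ 205 / 1000 * ρ := by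
    by_contra! h
    nlinarith [mul_pos hρ0 hε]
  have hετ : ε ≤ 103 / 100 * τ := by nlinarith
  have hερ : ε ≤ 22 / 100 * ρ := by nlinarith
  -- The cap is what the two discs about `c = (a, -b)` through `(τ, 0)` and through `(0, -ε)` leave
  -- of the rectangle below the segment. These discs cover its right and its lower side, and `a`
  -- is chosen such that `o` lies outside of the first disc.
  set a := τ + 3 / 5 * ρ * δ / τ with ha
  set b := ρ / 2 with hb
  have haτ : (a - τ) * τ = 3 / 5 * ρ * δ := by rw [ha]; field_simp; ring
  have haτ0 : τ < a := by rw [ha]; linarith [show 0 < 3 / 5 * ρ * δ / τ by positivity]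
  have haρ : a ≤ 3 / 10 * ρ := by
    have h1 : a - τ ≤ 9 / 100 * ρ := by
      have h2 : (a - τ) * τ ≤ (9 / 100 * ρ) * τ := by rw [haτ]; nlinarith
      exact le_of_mul_le_mul_right h2 hτ
    linarith
  set c : ℂ := ⟨a, -b⟩ with hc
  have hdist : ∀ w : ℂ, dist w c ^ 2 = (w.re - a) ^ 2 + (w.im + b) ^ 2 := fun w => by
    rw [Complex.dist_eq_re_im, Real.sq_sqrt (by positivity)]
    simp only [hc]
    ring
  set r₂ := max ((a - τ) ^ 2 + b ^ 2) (a ^ 2 + (b - ε) ^ 2) with hr₂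
  have hr₂0 : 0 ≤ r₂ := le_max_of_le_left (by positivity)
  have hle : ∀ w : ℂ, dist w c ≤ √r₂ ↔ (w.re - a) ^ 2 + (w.im + b) ^ 2 ≤ r₂ := fun w => by
    rw [← hdist, Real.le_sqrt dist_nonneg hr₂0]
  set W : Set ℂ := {w | w ∉ T ∧ 0 < w.re ∧ w.re < τ ∧ -ε < w.im ∧ w.im < 0 ∧ √r₂ < dist w c} with hW
  have hre : Continuous Complex.re := Complex.continuous_re
  have him : Continuous Complex.im := Complex.continuous_im
  have hdc : Continuous fun w : ℂ => dist w c := by fun_prop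
  have hWo : IsOpen W :=
    hTc.isOpen_compl.inter ((isOpen_lt continuous_const hre).inter
      ((isOpen_lt hre continuous_const).inter ((isOpen_lt continuous_const him).inter
        ((isOpen_lt him continuous_const).inter (isOpen_lt continuous_const hdc)))))
  have hWcl : ∀ x ∈ closure W, 0 ≤ x.re ∧ x.re ≤ τ ∧ -ε ≤ x.im ∧ x.im ≤ 0 := by
    have hcl : IsClosed {x : ℂ | 0 ≤ x.re ∧ x.re ≤ τ ∧ -ε ≤ x.im ∧ x.im ≤ 0} :=
      (isClosed_le continuous_const hre).inter ((isClosed_le hre continuous_const).inter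
        ((isClosed_le continuous_const him).inter (isClosed_le him continuous_const)))
    exact closure_minimal (fun w hw => ⟨hw.2.1.le, hw.2.2.1.le, hw.2.2.2.1.le, hw.2.2.2.2.1.le⟩) hcl
  -- the obstacle lies outside of the disc
  have ho : √r₂ < dist o c := by
    rw [← not_le, hle, not_le, hr₂, max_lt_iff]
    constructor
    · have h1 : ρ * -o.im ≤ 2 * (a - τ) * (τ - o.re) := by
        have h2 : ρ * -o.im * τ ≤ 2 * (a - τ) * (τ - o.re) * τ := by nlinarith
        exact le_of_mul_le_mul_right h2 hτ
      nlinarith [mul_pos (sub_pos.2 hoτ) (sub_pos.2 hoτ), sq_nonneg o.im]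
    · have h1 : (a - τ) * o.re ≤ 3 / 5 * ρ * δ := by
        rw [← haτ]
        exact mul_le_mul_of_nonneg_left hoτ.le (by linarith)
      have h2 : 6 / 7 * ε * (ρ - 8 / 7 * ε) ≤ (ε + o.im) * (ρ + o.im - ε) :=
        mul_le_mul (by linarith) (by linarith) (by linarith) (by linarith)
      have h3 : ρ * (7 * δ) ≤ ρ * ε := mul_le_mul_of_nonneg_left hδε.le hρ0.le
      have h4 : ε * ε ≤ ε * (22 / 100 * ρ) := mul_le_mul_of_nonneg_left hερ hε.le
      have h5 : (o.re - a) ^ 2 + (o.im + b) ^ 2 - (a ^ 2 + (b - ε) ^ 2) =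
          o.re ^ 2 - 2 * ((a - τ) * o.re + o.re * τ) + (ε + o.im) * (ρ + o.im - ε) := by
        rw [hb]; ring
      linarith [mul_pos hρ0 hε, sq_nonneg o.re]
  have hcap := hT W c √r₂ √(a ^ 2 + b ^ 2) (Real.sqrt_nonneg _) hWo
    ⟨o, hoT, ho0, hoτ, by linarith, ho2, ho⟩ (fun w hw => hw.1) ?_ ?_
  · exfalso
    have h1 : ρ ≤ √(a ^ 2 + b ^ 2) := by
      have : ρ * 1 ≤ ρ * (K * √(a ^ 2 + b ^ 2)) := mul_le_mul_of_nonneg_left hcap hρ0.le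
      rwa [mul_one, ← mul_assoc, hρ, inv_mul_cancel₀ hK.ne', one_mul] at this
    rw [Real.le_sqrt hρ0.le (by positivity)] at h1
    have h2 : a ^ 2 ≤ (3 / 10 * ρ) ^ 2 := pow_le_pow_left₀ (hτ.trans haτ0).le haρ 2
    rw [hb] at h1
    linarith [mul_pos hρ0 hρ0, show (3 / 10 * ρ) ^ 2 = 9 / 100 * (ρ * ρ) by ring,
      show (ρ / 2) ^ 2 = 1 / 4 * (ρ * ρ) by ring, show ρ ^ 2 = ρ * ρ by ring]
  · intro x hx
    obtain ⟨h1, h2, h3, h4⟩ := hWcl x hx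
    by_cases hxT : x ∈ T
    · exact Or.inr (Or.inl hxT)
    by_cases hxd : dist x c ≤ √r₂
    · exact Or.inr (Or.inr hxd)
    left
    have hxd' := hxd
    rw [hle, not_le, hr₂, max_lt_iff] at hxd'
    refine ⟨hxT, lt_of_le_of_ne h1 fun h0 => hxT ?_, lt_of_le_of_ne h2 fun h0 => ?_,
      lt_of_le_of_ne h3 fun h0 => ?_, lt_of_le_of_ne h4 fun h0 => hxT ?_, not_le.1 hxd⟩
    · refine hball ?_
      rw [mem_closedBall_zero_iff]
      calc ‖x‖ ≤ |x.re| + |x.im| := Complex.norm_le_abs_re_add_abs_im x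
        _ ≤ ε := by rw [← h0, abs_zero, zero_add, abs_le]; constructor <;> linarith
    · rw [h0] at hxd'
      nlinarith [hxd'.1]
    · rw [← h0] at hxd'
      nlinarith [hxd'.2]
    · have : x = (x.re : ℂ) := Complex.ext rfl (by simp [h0])
      rw [this]
      exact hray _ ⟨h1, h2⟩
  · intro w hw
    refine ⟨hw.2.2.2.2.2, ?_⟩
    rw [Real.le_sqrt dist_nonneg (by positivity), hdist]
    obtain ⟨-, h1, h2, h3, h4, -⟩ := hw
    have h5 : (w.re - a) ^ 2 ≤ a ^ 2 := by nlinarith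
    have h6 : (w.im + b) ^ 2 ≤ b ^ 2 := by nlinarith
    linarith

/-- The point of the plane with given polar coordinates. -/
def polarPt (p : ℝ × ℝ) : ℂ := p.1 * Complex.exp (p.2 * Complex.I)

@[fun_prop]
theorem continuous_polarPt : Continuous polarPt := by
  unfold polarPt
  fun_prop

theorem polarPt_norm_arg (z : ℂ) : polarPt (‖z‖, z.arg) = z := Complex.norm_mul_exp_arg_mul_I z

theorem norm_polarPt {p : ℝ × ℝ} (hp : 0 ≤ p.1) : ‖polarPt p‖ = p.1 := by
  rw [polarPt, norm_mul, Complex.norm_exp_ofReal_mul_I, mul_one, Complex.norm_real,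
    Real.norm_of_nonneg hp]

theorem arg_polarPt {p : ℝ × ℝ} (hp : 0 < p.1) (h : p.2 ∈ Ioc (-Real.pi) Real.pi) :
    (polarPt p).arg = p.2 := by
  rw [polarPt, Complex.arg_real_mul _ hp, Complex.arg_exp_mul_I,
    toIocMod_eq_self]
  convert! h using 2
  ring

/-- An island in the complement of `T` extends, from the point with the largest angle at which it is
seen from the origin, further away from the origin by the order of the radius of curvature. Here
the island is given in polar coordinates, and the largest angle is zero. -/
theorem HasLargeCaps.le_of_island {T : Set ℂ} {K : ℝ} (hK : 0 < K) (hT : HasLargeCaps T K)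
    {D : Set (ℝ × ℝ)} (hDo : IsOpen D) (hDT : ∀ p ∈ D, polarPt p ∉ T)
    (hDcl : ∀ p ∈ closure D, p ∈ D ∨ polarPt p ∈ T) (hD0 : ∀ p ∈ D, 0 < p.1 ∧ p.2 < 0)
    {rp rs : ℝ} (hrp : 0 < rp) (hp : (rp, (0 : ℝ)) ∈ closure D) (hrs : ∀ p ∈ D, p.1 ≤ rs) :
    1 / (2 * K) ≤ rs - rp := by
  by_contra! hlt
  set b := 1 / (2 * K) with hb
  have hb0 : 0 < b := by positivity
  have hKb : K * b = 1 / 2 := by rw [hb]; field_simp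
  obtain ⟨e, he, herp⟩ : ∃ e, max (rs - b) 0 < e ∧ e < rp :=
    exists_between (max_lt (by linarith) hrp)
  have he0 : 0 < e := (le_max_right _ _).trans_lt he
  have hes : rs - b < e := (le_max_left _ _).trans_lt he
  -- the disc of radius `b` about `c` touches the axis at `e`, on the near side of the tip
  set c : ℂ := ⟨e, -b⟩ with hc
  have hdist : ∀ w : ℂ, dist w c ^ 2 = (w.re - e) ^ 2 + (w.im + b) ^ 2 := fun w => by
    rw [Complex.dist_eq_re_im, Real.sq_sqrt (by positivity)]
    simp only [hc]
    ring
  have hre : Continuous Complex.re := Complex.continuous_re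
  have him : Continuous Complex.im := Complex.continuous_im
  have hdc : Continuous fun w : ℂ => dist w c := by fun_prop
  set f : ℂ → ℝ × ℝ := fun w => (‖w‖, w.arg) with hf
  have hfc : ∀ w : ℂ, 0 < w.re → ContinuousAt f w := fun w hw =>
    continuous_norm.continuousAt.prodMk (Complex.continuousAt_arg (Or.inl hw))
  have hfp : ∀ w, polarPt (f w) = w := polarPt_norm_arg
  set W : Set ℂ := {w | (e < w.re ∧ f w ∈ D) ∧ -b < w.im ∧ b < dist w c} with hW
  have hWo : IsOpen W := by
    refine IsOpen.inter ?_ ((isOpen_lt continuous_const him).inter (isOpen_lt continuous_const hdc))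
    refine ContinuousOn.isOpen_inter_preimage (f := f) (s := {w : ℂ | e < w.re})
      (fun w hw => (hfc w (he0.trans hw)).continuousWithinAt)
      (isOpen_lt continuous_const hre) hDo
  have hWim : ∀ w ∈ W, w.im < 0 := fun w hw => Complex.arg_neg_iff.1 (hD0 _ hw.1.2).2
  have hWre : ∀ w ∈ W, w.re ≤ rs := fun w hw =>
    ((le_abs_self _).trans (Complex.abs_re_le_norm w)).trans (hrs _ hw.1.2)
  have hWcl : ∀ x ∈ closure W, e ≤ x.re ∧ x.re ≤ rs ∧ -b ≤ x.im ∧ x.im ≤ 0 := by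
    have hcl : IsClosed {x : ℂ | e ≤ x.re ∧ x.re ≤ rs ∧ -b ≤ x.im ∧ x.im ≤ 0} :=
      (isClosed_le continuous_const hre).inter ((isClosed_le hre continuous_const).inter
        ((isClosed_le continuous_const him).inter (isClosed_le him continuous_const)))
    exact closure_minimal (fun w hw => ⟨hw.1.1.le, hWre w hw, hw.2.1.le, (hWim w hw).le⟩) hcl
  have hWne : W.Nonempty := by
    have h1 : ∀ᶠ p in 𝓝 (rp, (0 : ℝ)), (e < (polarPt p).re ∧ -b < (polarPt p).im ∧
        b < dist (polarPt p) c) ∧ -Real.pi < p.2 := by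
      have h0 : polarPt (rp, 0) = rp := by simp [polarPt]
      have hopen : IsOpen {p : ℝ × ℝ | (e < (polarPt p).re ∧ -b < (polarPt p).im ∧
          b < dist (polarPt p) c) ∧ -Real.pi < p.2} :=
        ((isOpen_lt continuous_const (hre.comp continuous_polarPt)).inter
          ((isOpen_lt continuous_const (him.comp continuous_polarPt)).inter
          (isOpen_lt continuous_const (hdc.comp continuous_polarPt)))).inter
          (isOpen_lt continuous_const continuous_snd)
      refine hopen.mem_nhds ⟨⟨?_, ?_, ?_⟩, ?_⟩
      · rw [h0]; simpa using herp
      · rw [h0]; simpa using hb0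
      · rw [h0]
        by_contra! h
        have h2 := pow_le_pow_left₀ dist_nonneg h 2
        rw [hdist] at h2
        simp only [Complex.ofReal_re, Complex.ofReal_im] at h2
        nlinarith [mul_pos (sub_pos.2 herp) (sub_pos.2 herp)]
      · simpa using Real.pi_pos
    obtain ⟨p, hp1, hpD⟩ := mem_closure_iff_nhds.1 hp _ h1
    have hfpp : f (polarPt p) = p := by
      have h2 := hD0 p hpD
      simp only [hf]
      rw [norm_polarPt h2.1.le, arg_polarPt h2.1 ⟨hp1.2, h2.2.le.trans Real.pi_pos.le⟩]
    exact ⟨polarPt p, ⟨hp1.1.1, by rwa [hfpp]⟩, hp1.1.2⟩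
  have hcap := hT W c b √(2 * b ^ 2) hb0.le hWo hWne (fun w hw => by
    have := hDT _ hw.1.2
    rwa [hfp] at this) ?_ ?_
  · have h1 : 2 * b ≤ √(2 * b ^ 2) := by
      have : b * 1 ≤ b * (K * √(2 * b ^ 2)) := mul_le_mul_of_nonneg_left hcap hb0.le
      nlinarith
    rw [Real.le_sqrt (by linarith) (by positivity)] at h1
    nlinarith
  · intro x hx
    obtain ⟨h1, h2, h3, h4⟩ := hWcl x hx
    have hfx : f x ∈ closure D := by
      refine mem_closure_iff_nhds.2 fun U hU => ?_
      obtain ⟨w, hwU, hwW⟩ :=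
        mem_closure_iff_nhds.1 hx _ ((hfc x (he0.trans_le h1)).preimage_mem_nhds hU)
      exact ⟨f w, hwU, hwW.1.2⟩
    rcases hDcl _ hfx with h | h
    · by_cases hxd : dist x c ≤ b
      · exact Or.inr (Or.inr hxd)
      left
      have hxd' : ¬ dist x c ^ 2 ≤ b ^ 2 := fun h' =>
        hxd (le_of_sq_le_sq h' hb0.le)
      rw [hdist, not_le] at hxd'
      refine ⟨⟨lt_of_le_of_ne h1 fun h0 => ?_, h⟩, lt_of_le_of_ne h3 fun h0 => ?_, not_le.1 hxd⟩
      · rw [← h0] at hxd'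
        nlinarith
      · rw [← h0] at hxd'
        nlinarith
    · rw [hfp] at h
      exact Or.inr (Or.inl h)
  · intro w hw
    refine ⟨hw.2.2, ?_⟩
    rw [Real.le_sqrt dist_nonneg (by positivity), hdist]
    have h1 := hw.1.1
    have h2 := hWre w hw
    have h3 := hw.2.1
    have h4 := hWim w hw
    nlinarith

/-! ### The coarea inequality, and counting -/

/-- The coarea inequality for the one-dimensional Hausdorff measure: the number of points in the
fibres of a `1`-Lipschitz function has a measurable majorant whose integral is at most the length
of the set. -/
theorem exists_lintegral_le_hausdorffMeasure {X : Type*} [MetricSpace X] [MeasurableSpace X]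
    [BorelSpace X] {f : X → ℝ} (hf : LipschitzWith 1 f) {A : Set X} (hA : μH[1] A ≠ ⊤) :
    ∃ g : ℝ → ℝ≥0∞, Measurable g ∧ ∫⁻ t, g t ≤ μH[1] A ∧
      ∀ (t : ℝ) (Z : Finset X), ↑Z ⊆ A → (∀ z ∈ Z, f z = t) → (Z.card : ℝ≥0∞) ≤ g t := by
  set r : ℕ → ℝ≥0∞ := fun k => ((k : ℝ≥0∞) + 1)⁻¹ with hr
  have hr0 : ∀ k, 0 < r k := fun k => by simp [hr]
  have hrlim : Tendsto r atTop (𝓝 0) := by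
    have := ENNReal.tendsto_inv_nat_nhds_zero.comp (tendsto_add_atTop_nat 1)
    refine this.congr fun k => ?_
    simp [hr]
  have hcov : ∀ k, ∃ c : ℕ → Set X, A ⊆ ⋃ n, c n ∧ (∀ n, ediam (c n) ≤ r k) ∧
      ∑' n, ⨆ _ : (c n).Nonempty, ediam (c n) ^ (1 : ℝ) < μH[1] A + r k := by
    intro k
    have h1 : ⨅ (c : ℕ → Set X) (_ : A ⊆ ⋃ n, c n) (_ : ∀ n, ediam (c n) ≤ r k),
        ∑' n, ⨆ _ : (c n).Nonempty, ediam (c n) ^ (1 : ℝ) ≤ μH[1] A := by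
      rw [Measure.hausdorffMeasure_apply]
      exact le_iSup₂ (f := fun (r : ℝ≥0∞) (_ : 0 < r) =>
        ⨅ (c : ℕ → Set X) (_ : A ⊆ ⋃ n, c n) (_ : ∀ n, ediam (c n) ≤ r),
          ∑' n, ⨆ _ : (c n).Nonempty, ediam (c n) ^ (1 : ℝ)) (r k) (hr0 k)
    have h2 := h1.trans_lt (ENNReal.lt_add_right hA (hr0 k).ne')
    simp only [iInf_lt_iff] at h2
    obtain ⟨c, hc1, hc2, hc3⟩ := h2
    exact ⟨c, hc1, hc2, hc3⟩
  choose c hcA hcd hcs using hcov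
  set g : ℕ → ℝ → ℝ≥0∞ := fun k t => ∑' n, (closure (f '' c k n)).indicator 1 t with hg
  have hgm : ∀ k, Measurable (g k) := fun k =>
    Measurable.tsum fun n => measurable_one.indicator isClosed_closure.measurableSet
  refine ⟨fun t => liminf (fun k => g k t) atTop, Measurable.liminf hgm, ?_, ?_⟩
  · have h1 : ∀ k, ∫⁻ t, g k t ≤ μH[1] A + r k := by
      intro k
      simp only [hg]
      rw [lintegral_tsum fun n =>
        (measurable_one.indicator isClosed_closure.measurableSet).aemeasurable]
      refine (ENNReal.tsum_le_tsum fun n => ?_).trans (hcs k).le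
      rw [lintegral_indicator_one isClosed_closure.measurableSet]
      rcases (c k n).eq_empty_or_nonempty with h | h
      · simp [h]
      · rw [ciSup_pos h, ENNReal.rpow_one]
        calc volume (closure (f '' c k n)) ≤ ediam (closure (f '' c k n)) := Real.volume_le_diam _
          _ = ediam (f '' c k n) := by rw [ediam_closure]
          _ ≤ ediam (c k n) := by simpa using hf.ediam_image_le (c k n)
    calc ∫⁻ t, liminf (fun k => g k t) atTop ≤ liminf (fun k => ∫⁻ t, g k t) atTop :=
          lintegral_liminf_le hgm
      _ ≤ liminf (fun k => μH[1] A + r k) atTop :=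
          liminf_le_liminf (Eventually.of_forall h1)
      _ = μH[1] A := by
          have := (tendsto_const_nhds (x := μH[1] A)).add hrlim
          rw [add_zero] at this
          exact this.liminf_eq
  · intro t Z hZA hZt
    refine le_liminf_of_le (by isBoundedDefault) ?_
    have hsep : ∀ᶠ k in atTop, ∀ z ∈ Z, ∀ z' ∈ Z, z ≠ z' → r k < edist z z' := by
      rw [Finset.eventually_all]
      intro z _
      rw [Finset.eventually_all]
      intro z' _
      by_cases h : z = z'
      · simp [h]
      · filter_upwards [hrlim.eventually_lt_const (edist_pos.2 h)] with k hk _ using hk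
    filter_upwards [hsep] with k hk
    have hn : ∀ z ∈ Z, ∃ n, z ∈ c k n := fun z hz => mem_iUnion.1 (hcA k (hZA hz))
    choose! n hn using hn
    have hinj : Set.InjOn n Z := by
      intro z hz z' hz' h
      by_contra hne
      have h1 := edist_le_ediam_of_mem (hn z hz) (h ▸ hn z' hz')
      exact absurd (h1.trans (hcd k _)) (not_le.2 (hk z hz z' hz' hne))
    classical
    calc (Z.card : ℝ≥0∞) = ∑ m ∈ Z.image n, (1 : ℝ≥0∞) := by
          rw [Finset.sum_const, Finset.card_image_of_injOn hinj]; simp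
      _ ≤ ∑ m ∈ Z.image n, (closure (f '' c k m)).indicator 1 t := by
          refine Finset.sum_le_sum fun m hm => ?_
          obtain ⟨z, hz, rfl⟩ := Finset.mem_image.1 hm
          rw [indicator_of_mem]
          · simp
          · exact subset_closure ⟨z, hn z hz, hZt z hz⟩
      _ ≤ g k t := ENNReal.sum_le_tsum _

/-- A set of reals is small if any two points of the set that are not close to each other are
separated by one of finitely many given points. -/
theorem volume_le_of_separated {s : Set ℝ} {ω : ℝ} (Z : Finset ℝ)
    (h : ∀ x ∈ s, ∀ y ∈ s, x < y → y - x ≤ ω ∨ ∃ z ∈ Z, x ≤ z ∧ z < y) :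
    volume s ≤ (Z.card + 1) * ENNReal.ofReal ω := by
  have hbase : ∀ s : Set ℝ, (∀ x ∈ s, ∀ y ∈ s, x < y → y - x ≤ ω) →
      volume s ≤ ENNReal.ofReal ω := by
    intro s hs
    refine (Real.volume_le_diam s).trans (ediam_le fun x hx y hy => ?_)
    rw [edist_dist, Real.dist_eq]
    rcases lt_trichotomy x y with h | h | h
    · rw [abs_sub_comm, abs_of_pos (sub_pos.2 h)]
      exact ENNReal.ofReal_le_ofReal (hs x hx y hy h)
    · simp [h]
    · rw [abs_of_pos (sub_pos.2 h)]
      exact ENNReal.ofReal_le_ofReal (hs y hy x hx h)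
  induction Z using Finset.induction_on_max generalizing s with
  | empty =>
    simpa using hbase s fun x hx y hy hxy => by simpa using h x hx y hy hxy
  | insert z Z hz ih =>
    have hzZ : z ∉ Z := fun h => lt_irrefl _ (hz z h)
    have h1 : volume (s ∩ Iic z) ≤ (Z.card + 1) * ENNReal.ofReal ω := by
      refine ih fun x hx y hy hxy => ?_
      rcases h x hx.1 y hy.1 hxy with h' | ⟨w, hw, hxw, hwy⟩
      · exact Or.inl h'
      · rcases Finset.mem_insert.1 hw with rfl | hw
        · exact absurd hy.2 (not_le.2 hwy)
        · exact Or.inr ⟨w, hw, hxw, hwy⟩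
    have h2 : volume (s ∩ Ioi z) ≤ ENNReal.ofReal ω := by
      refine hbase _ fun x hx y hy hxy => ?_
      rcases h x hx.1 y hy.1 hxy with h' | ⟨w, hw, hxw, hwy⟩
      · exact h'
      · have hzx : z < x := hx.2
        rcases Finset.mem_insert.1 hw with rfl | hw
        · linarith
        · linarith [hz w hw]
    calc volume s ≤ volume (s ∩ Iic z ∪ s ∩ Ioi z) := by
          refine measure_mono fun x hx => ?_
          rcases le_or_gt x z with h | h
          · exact Or.inl ⟨hx, h⟩
          · exact Or.inr ⟨hx, h⟩
      _ ≤ _ := (measure_union_le _ _).trans (add_le_add h1 h2)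
      _ = ((insert z Z).card + 1) * ENNReal.ofReal ω := by
          rw [Finset.card_insert_of_notMem hzZ]
          push_cast
          ring

/-- A variant of `volume_le_of_separated` in which the number of separating points is bounded
by an extended number. -/
theorem volume_le_of_separated_of_card_le {s Z : Set ℝ} {ω : ℝ} (hω : 0 < ω) {g : ℝ≥0∞}
    (hg : ∀ F : Finset ℝ, ↑F ⊆ Z → (F.card : ℝ≥0∞) ≤ g)
    (h : ∀ x ∈ s, ∀ y ∈ s, x < y → y - x ≤ ω ∨ ∃ z ∈ Z, x ≤ z ∧ z < y) :
    volume s ≤ (g + 1) * ENNReal.ofReal ω := by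
  by_cases hZ : Z.Finite
  · refine (volume_le_of_separated (ω := ω) hZ.toFinset fun x hx y hy hxy => ?_).trans ?_
    · simpa using h x hx y hy hxy
    · gcongr
      exact hg _ (by simp)
  · have htop : g = ⊤ := by
      refine ENNReal.eq_top_of_forall_nnreal_le fun r => ?_
      obtain ⟨F, hF, hcard⟩ := Set.Infinite.exists_subset_card_eq hZ ⌈r⌉₊
      refine le_trans ?_ (hg F hF)
      rw [hcard]
      exact_mod_cast Nat.le_ceil r
    rw [htop, top_add, ENNReal.top_mul (by simpa using hω)]
    exact le_top

/-! ### Shadows -/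

theorem polarPt_add (r φ ψ : ℝ) :
    polarPt (r, φ + ψ) = Complex.exp (ψ * Complex.I) * polarPt (r, φ) := by
  simp only [polarPt]
  push_cast
  rw [add_mul, Complex.exp_add]
  ring

theorem polarPt_sub_two_pi (r φ : ℝ) : polarPt (r, φ - 2 * Real.pi) = polarPt (r, φ) := by
  simp only [polarPt]
  push_cast
  rw [sub_mul, Complex.exp_sub, Complex.exp_two_pi_mul_I, div_one]

/-- The point with polar coordinates `(t, φ)` is seen from the origin in `T`. -/
def Lit (T : Set ℂ) (t φ : ℝ) : Prop := ∀ s ∈ Icc (0 : ℝ) 1, polarPt (s * t, φ) ∈ T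

theorem lit_iff {T : Set ℂ} {t φ : ℝ} (ht : 0 < t) :
    Lit T t φ ↔ ∀ r ∈ Icc 0 t, polarPt (r, φ) ∈ T := by
  constructor
  · intro h r hr
    have := h (r / t) ⟨div_nonneg hr.1 ht.le, (div_le_one ht).2 hr.2⟩
    rwa [div_mul_cancel₀ _ ht.ne'] at this
  · intro h s hs
    exact h _ ⟨mul_nonneg hs.1 ht.le, mul_le_of_le_one_left ht.le hs.2⟩

theorem Lit.mono {T : Set ℂ} {t t' φ : ℝ} (h : Lit T t φ) (ht' : 0 < t') (htt : t' ≤ t) :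
    Lit T t' φ := by
  rw [lit_iff ht']
  rw [lit_iff (ht'.trans_le htt)] at h
  exact fun r hr => h r ⟨hr.1, hr.2.trans htt⟩

/-- The lit point with polar coordinates `(t, θ)` has, on the side of smaller angles and
within the angle `ω`, a dark angle `β` from which on all points of the circle of radius `t` are
dark down to a point, at the angle `α`, which does not belong to `T`. The angles are
taken to be rational, for the sake of measurability. -/
def NearShadow (T : Set ℂ) (ω t θ : ℝ) : Prop :=
  0 < t ∧ Lit T t θ ∧ ∃ α β : ℚ, α < β ∧ (β : ℝ) < θ ∧ θ < β + ω ∧ polarPt (t, α) ∉ T ∧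
    ∀ φ ∈ Icc (α : ℝ) β, ¬ Lit T t φ

theorem NearShadow.of_real {T : Set ℂ} (hT : IsClosed T) {ω t θ α β r : ℝ} (ht : 0 < t)
    (hlit : Lit T t θ) (hαβ : α ≤ β) (hβθ : β < θ) (hθω : θ < β + ω) (hα : polarPt (t, α) ∉ T)
    (hr : r ∈ Icc 0 t) (hβ : polarPt (r, β) ∉ T) (hdark : ∀ φ ∈ Icc α β, ¬ Lit T t φ) :
    NearShadow T ω t θ := by
  have hopen : ∀ r φ : ℝ, polarPt (r, φ) ∉ T → ∀ᶠ φ' in 𝓝 φ, polarPt (r, φ') ∉ T := by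
    intro r φ h
    have : Continuous fun φ' : ℝ => polarPt (r, φ') := by fun_prop
    exact this.continuousAt.eventually_mem (hT.isOpen_compl.mem_nhds h)
  obtain ⟨η₁, hη₁, h1⟩ := Metric.mem_nhds_iff.1 (hopen t α hα)
  obtain ⟨η₂, hη₂, h2⟩ := Metric.mem_nhds_iff.1 (hopen r β hβ)
  set η := min (min η₁ η₂) (θ - β) with hη
  have hη0 : 0 < η := lt_min (lt_min hη₁ hη₂) (by linarith)
  have hηη₁ : η ≤ η₁ := (min_le_left _ _).trans (min_le_left _ _)
  have hηη₂ : η ≤ η₂ := (min_le_left _ _).trans (min_le_right _ _)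
  have hηθ : η ≤ θ - β := min_le_right _ _
  obtain ⟨α', hα1, hα2⟩ := exists_rat_btwn (show α < α + η by linarith)
  obtain ⟨β', hβ1, hβ2⟩ := exists_rat_btwn
    (show max (α' : ℝ) β < β + η from max_lt (by linarith) (by linarith))
  have hβ3 : β < β' := (le_max_right _ _).trans_lt hβ1
  refine ⟨ht, hlit, α', β', by exact_mod_cast (le_max_left _ _).trans_lt hβ1, by linarith,
    by linarith, ?_, fun φ hφ => ?_⟩
  · refine h1 ?_
    rw [mem_ball, Real.dist_eq, abs_lt]
    constructor <;> linarith
  · rcases le_or_gt φ β with h | h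
    · exact hdark φ ⟨by linarith [hφ.1], h⟩
    · intro hl
      rw [lit_iff ht] at hl
      have hφη : φ ∈ ball β η₂ := by
        rw [mem_ball, Real.dist_eq, abs_lt]
        constructor <;> linarith [hφ.2]
      exact h2 hφη (hl r hr)

/-- The points outside of `T`, in polar coordinates, with radius less than `t` and with angle in the
period below `θ`. -/
def darkBox (T : Set ℂ) (t θ : ℝ) : Set (ℝ × ℝ) :=
  (Ioo 0 t ×ˢ Ioo (θ - 2 * Real.pi) θ) ∩ {p | polarPt p ∉ T}

theorem isOpen_darkBox {T : Set ℂ} (hT : IsClosed T) (t θ : ℝ) : IsOpen (darkBox T t θ) :=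
  (isOpen_Ioo.prod isOpen_Ioo).inter (hT.isOpen_compl.preimage continuous_polarPt)

/-- Below a lit ray, a component of the complement of `T` inside a disc either reaches the
boundary circle of the disc, and then casts a shadow there, or it is an island. -/
theorem nearShadow_or_island {T : Set ℂ} (hT : IsClosed T) {ω t θ : ℝ} (ht : 0 < t)
    (hlit : Lit T t θ) {o : ℝ × ℝ} (ho : o ∈ darkBox T t θ) (hω : θ < o.2 + ω) :
    NearShadow T ω t θ ∨ ∀ p ∈ closure (connectedComponentIn (darkBox T t θ) o),
      p ∈ connectedComponentIn (darkBox T t θ) o ∨ polarPt p ∈ T := by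
  set D := connectedComponentIn (darkBox T t θ) o with hD
  refine or_iff_not_imp_right.2 fun hno => ?_
  push Not at hno
  obtain ⟨p, hpcl, hpD, hpT⟩ := hno
  have hDsub : D ⊆ darkBox T t θ := connectedComponentIn_subset _ _
  have hoD : o ∈ D := mem_connectedComponentIn ho
  have hpre : IsPreconnected (insert p D) :=
    isPreconnected_connectedComponentIn.subset_closure (subset_insert _ _)
      (insert_subset hpcl subset_closure)
  have hlit' := (lit_iff ht).1 hlit
  -- the point `p` lies on the circle
  have hDbox : D ⊆ Icc 0 t ×ˢ Icc (θ - 2 * Real.pi) θ := fun q hq =>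
    ⟨Ioo_subset_Icc_self (hDsub hq).1.1, Ioo_subset_Icc_self (hDsub hq).1.2⟩
  have hpbox : p ∈ Icc 0 t ×ˢ Icc (θ - 2 * Real.pi) θ :=
    closure_minimal hDbox (isClosed_Icc.prod isClosed_Icc) hpcl
  have hp2 : p.2 ∈ Ioo (θ - 2 * Real.pi) θ := by
    refine ⟨lt_of_le_of_ne hpbox.2.1 fun h => hpT ?_, lt_of_le_of_ne hpbox.2.2 fun h => hpT ?_⟩
    · rw [show p = (p.1, θ - 2 * Real.pi) from Prod.ext rfl h.symm, polarPt_sub_two_pi]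
      exact hlit' _ hpbox.1
    · rw [show p = (p.1, θ) from Prod.ext rfl h]
      exact hlit' _ hpbox.1
  have hp1 : p.1 = t := by
    by_contra hne
    have hp0 : 0 < p.1 := by
      refine lt_of_le_of_ne hpbox.1.1 fun h => hpT ?_
      have := hlit' 0 ⟨le_rfl, ht.le⟩
      simp only [polarPt, Complex.ofReal_zero, zero_mul] at this
      simpa only [polarPt, ← h, Complex.ofReal_zero, zero_mul] using this
    have hpO : p ∈ darkBox T t θ := ⟨⟨⟨hp0, lt_of_le_of_ne hpbox.1.2 hne⟩, hp2⟩, hpT⟩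
    exact hpD (hpre.subset_connectedComponentIn (mem_insert_of_mem _ hoD)
      (insert_subset hpO hDsub) (mem_insert _ _))
  have hdark : ∀ q ∈ insert p D, ¬ Lit T t q.2 := by
    intro q hq hl
    rw [lit_iff ht] at hl
    rcases mem_insert_iff.1 hq with rfl | hq
    · exact hpT (hl _ hpbox.1)
    · exact (hDsub hq).2 (hl _ (Ioo_subset_Icc_self (hDsub hq).1.1))
  have hp : polarPt (t, p.2) ∉ T := by rwa [← hp1]
  rcases le_total p.2 o.2 with h | h
  · refine NearShadow.of_real hT (α := p.2) (β := o.2) (r := o.1) ht hlit h ho.1.2.2 hω hp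
      (Ioo_subset_Icc_self ho.1.1) ho.2 fun φ hφ => ?_
    have him : (Prod.snd '' insert p D).OrdConnected :=
      (hpre.image Prod.snd continuous_snd.continuousOn).ordConnected
    obtain ⟨q, hq, hqφ⟩ := him.out ⟨p, mem_insert _ _, rfl⟩ ⟨o, mem_insert_of_mem _ hoD, rfl⟩ hφ
    rw [← hqφ]
    exact hdark q hq
  · refine NearShadow.of_real hT (α := p.2) (β := p.2) (r := t) ht hlit le_rfl hp2.2 (by linarith)
      hp ⟨ht.le, le_rfl⟩ hp fun φ hφ => ?_
    rw [Icc_self, mem_singleton_iff] at hφ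
    rw [hφ]
    exact hdark p (mem_insert _ _)

/-- An island below a lit ray casts, along the ray, shadows on a set of radii whose length is of
the order of the radius of curvature. -/
theorem exists_nearShadow_of_island {T : Set ℂ} (hT : IsClosed T) {K : ℝ} (hK : 0 < K)
    (hcap : ∀ ψ : ℝ, HasLargeCaps ((fun z => Complex.exp (ψ * Complex.I) * z) ⁻¹' T) K)
    {ε : ℝ} (hε : 0 < ε) (hball : closedBall 0 ε ⊆ T) {ω t θ : ℝ}
    (hlit : Lit T t θ) {o : ℝ × ℝ} (ho : o ∈ darkBox T t θ) (hω : θ < o.2 + ω)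
    (hisl : ∀ p ∈ closure (connectedComponentIn (darkBox T t θ) o),
      p ∈ connectedComponentIn (darkBox T t θ) o ∨ polarPt p ∈ T) :
    ∃ a b : ℝ, 1 / (2 * K) ≤ b - a ∧ ∀ s ∈ Ioo a b, NearShadow T ω s θ := by
  set D := connectedComponentIn (darkBox T t θ) o with hD
  have hDsub : D ⊆ darkBox T t θ := connectedComponentIn_subset _ _
  have hoD : o ∈ D := mem_connectedComponentIn ho
  have hDo : IsOpen D := (isOpen_darkBox hT t θ).connectedComponentIn
  have hDε : ∀ p ∈ D, ε ≤ p.1 := by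
    intro p hp
    by_contra! h
    refine (hDsub hp).2 (hball ?_)
    rw [mem_closedBall_zero_iff, norm_polarPt (hDsub hp).1.1.1.le]
    exact h.le
  have hcomp : IsCompact (closure D) := by
    refine (isCompact_Icc.prod isCompact_Icc : IsCompact
      (Icc 0 t ×ˢ Icc (θ - 2 * Real.pi) θ)).of_isClosed_subset isClosed_closure ?_
    exact closure_minimal (fun q hq => ⟨Ioo_subset_Icc_self (hDsub hq).1.1,
      Ioo_subset_Icc_self (hDsub hq).1.2⟩) (isClosed_Icc.prod isClosed_Icc)
  have hne : (closure D).Nonempty := ⟨o, subset_closure hoD⟩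
  -- the point with the largest angle, and the largest radius
  obtain ⟨q, hq, hqmax⟩ := hcomp.exists_isMaxOn hne (f := Prod.snd) continuous_snd.continuousOn
  obtain ⟨m, hm, hmmax⟩ := hcomp.exists_isMaxOn hne (f := Prod.fst) continuous_fst.continuousOn
  have hqmax : ∀ p ∈ closure D, p.2 ≤ q.2 := fun p hp => hqmax hp
  have hmmax : ∀ p ∈ closure D, p.1 ≤ m.1 := fun p hp => hmmax hp
  have hqlt : ∀ p ∈ D, p.2 < q.2 := by
    intro p hp
    have h1 : Continuous fun η : ℝ => (p.1, p.2 + η) := by fun_prop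
    have h2 : ∀ᶠ η in 𝓝[>] (0 : ℝ), (p.1, p.2 + η) ∈ D :=
      nhdsWithin_le_nhds (h1.continuousAt.eventually_mem (hDo.mem_nhds (by simpa using hp)))
    obtain ⟨η, hη, hη0⟩ := (h2.and self_mem_nhdsWithin).exists
    have hη0 : 0 < η := hη0
    have := hqmax _ (subset_closure hη)
    simp only at this
    linarith
  have hq1 : ε ≤ q.1 :=
    closure_minimal (fun p hp => hDε p hp) (isClosed_le continuous_const continuous_fst) hq
  refine ⟨q.1, m.1, ?_, fun s hs => ?_⟩
  · set e : ℝ × ℝ ≃ₜ ℝ × ℝ := (Homeomorph.refl ℝ).prodCongr (Homeomorph.addRight q.2) with he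
    have hea : ∀ p : ℝ × ℝ, e p = (p.1, p.2 + q.2) := fun p => rfl
    have hpol : ∀ p, polarPt (e p) = Complex.exp (q.2 * Complex.I) * polarPt p := fun p => by
      rw [hea, polarPt_add]
    have hcl : closure (e ⁻¹' D) = e ⁻¹' closure D := (e.preimage_closure D).symm
    refine (hcap q.2).le_of_island hK (D := e ⁻¹' D) (hDo.preimage e.continuous) ?_ ?_ ?_
      (hε.trans_le hq1) ?_ ?_
    · intro p hp
      rw [mem_preimage, ← hpol]
      exact (hDsub hp).2
    · intro p hp
      rw [hcl] at hp
      rcases hisl _ hp with h | h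
      · exact Or.inl h
      · right
        rwa [mem_preimage, ← hpol]
    · intro p hp
      have h1 := hDε _ hp
      have h2 := hqlt _ hp
      rw [hea] at h1 h2
      simp only at h1 h2
      exact ⟨by linarith, by linarith⟩
    · rw [hcl, mem_preimage, hea]
      simpa using hq
    · intro p hp
      simpa [hea] using hmmax _ (subset_closure hp)
  · have hs0 : 0 < s := by linarith [hs.1]
    have hst : s < t := by
      have h1 : m.1 ≤ t := closure_minimal (fun p hp => (hDsub hp).1.1.2.le)
        (isClosed_le continuous_fst continuous_const) hm
      linarith [hs.2]
    have hlits := hlit.mono hs0 hst.le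
    -- a point of the island close to the one with the largest angle
    obtain ⟨o', ho'D, ho'1, ho'2⟩ : ∃ o' ∈ D, o'.1 < s ∧ θ < o'.2 + ω := by
      have h1 : IsOpen {p : ℝ × ℝ | p.1 < s ∧ θ < p.2 + ω} :=
        (isOpen_lt continuous_fst continuous_const).inter
          (isOpen_lt continuous_const (continuous_snd.add continuous_const))
      obtain ⟨o', h2, h3⟩ := mem_closure_iff_nhds.1 hq _ (h1.mem_nhds
        ⟨hs.1, by linarith [hqmax o (subset_closure hoD)]⟩)
      exact ⟨o', h3, h2⟩
    have ho'box : o' ∈ darkBox T s θ :=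
      ⟨⟨⟨(hDsub ho'D).1.1.1, ho'1⟩, (hDsub ho'D).1.2⟩, (hDsub ho'D).2⟩
    rcases nearShadow_or_island hT hs0 hlits ho'box ho'2 with h | h
    · exact h
    exfalso
    set D' := connectedComponentIn (darkBox T s θ) o' with hD'
    have hDD' : D ⊆ D' := by
      refine isPreconnected_connectedComponentIn.subset_left_of_subset_union
        (isOpen_darkBox hT s θ).connectedComponentIn isClosed_closure.isOpen_compl
        (disjoint_left.2 fun x hx hx' => hx' (subset_closure hx)) (fun x hx => ?_)
        ⟨o', ho'D, mem_connectedComponentIn ho'box⟩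
      by_cases hxc : x ∈ closure D'
      · exact Or.inl ((h x hxc).resolve_right (hDsub hx).2)
      · exact Or.inr hxc
    obtain ⟨x, hx1, hxD⟩ := mem_closure_iff_nhds.1 hm _
      ((isOpen_lt continuous_const continuous_fst).mem_nhds hs.2)
    have hx2 := ((connectedComponentIn_subset _ _) (hDD' hxD)).1.1.2
    have hx1 : s < x.1 := hx1
    linarith

/-- An obstacle between the point `δ` of the real axis and a lit point: its polar angle and,
by the curvature bound, its distance to the origin. -/
theorem exists_obstacle {T : Set ℂ} (hT : IsClosed T) {K : ℝ} (hK : 0 < K)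
    (hcap : ∀ ψ : ℝ, HasLargeCaps ((fun z => Complex.exp (ψ * Complex.I) * z) ⁻¹' T) K)
    {ε δ : ℝ} (hε : 0 < ε) (hball : closedBall 0 ε ⊆ T) (hδ : 0 < δ) (hδε : 7 * δ < ε)
    {τ θ : ℝ} (hτ : 0 < τ) (hθ : θ ∈ Ioo 0 Real.pi) (hlit : Lit T τ θ)
    (hbad : ¬ segment ℝ (δ : ℂ) (polarPt (τ, θ)) ⊆ T) :
    ∃ o ∈ darkBox T τ θ, θ < o.2 + 5 * K * δ / ε * τ ∧ θ < o.2 + 21 / 20 * δ / ε := by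
  obtain ⟨x, hx, hxT⟩ := not_subset.1 hbad
  obtain ⟨a, l, ha, hl, hal, rfl⟩ := hx
  obtain rfl : a = 1 - l := by linarith
  have hlit' := (lit_iff hτ).1 hlit
  have hl1 : l < 1 := by
    refine lt_of_le_of_ne (by linarith) fun h => hxT ?_
    rw [h, sub_self, zero_smul, one_smul, zero_add]
    exact hlit' τ ⟨hτ.le, le_rfl⟩
  have hετ : ε < τ := by
    by_contra! h
    refine hxT (hball ((convex_closedBall (0 : ℂ) ε) ?_ ?_ ha hl hal))
    · rw [mem_closedBall_zero_iff, Complex.norm_real, Real.norm_of_nonneg hδ.le]; linarith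
    · rw [mem_closedBall_zero_iff, norm_polarPt hτ.le]; exact h
  set e := Complex.exp (θ * Complex.I) with he
  have he1 : ‖e‖ = 1 := Complex.norm_exp_ofReal_mul_I θ
  -- the obstacle in the frame of the lit ray
  set o' : ℂ := ⟨(1 - l) * (δ * Real.cos θ) + l * τ, -((1 - l) * (δ * Real.sin θ))⟩ with ho'
  have heo : e * o' = (1 - l) • (δ : ℂ) + l • polarPt (τ, θ) := by
    have h1 : o' = (1 - l) • ((δ : ℂ) * Complex.exp (-(θ * Complex.I))) + l • (τ : ℂ) := by
      rw [← neg_mul, ← Complex.ofReal_neg, Complex.exp_mul_I, ← Complex.ofReal_cos,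
        ← Complex.ofReal_sin]
      apply Complex.ext
      · simp only [ho', Complex.add_re, Complex.smul_re, Complex.mul_re,
          Complex.ofReal_re, Complex.ofReal_im, Complex.I_re, Complex.I_im, smul_eq_mul,
          Real.cos_neg, Real.sin_neg]
        ring
      · simp only [ho', Complex.add_im, Complex.smul_im, Complex.mul_re, Complex.mul_im,
          Complex.add_re, Complex.ofReal_re, Complex.ofReal_im, Complex.I_re, Complex.I_im,
          smul_eq_mul, Real.cos_neg, Real.sin_neg]
        ring
    rw [h1, mul_add, mul_smul_comm, mul_smul_comm, mul_left_comm, he, ← Complex.exp_add,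
      add_neg_cancel, Complex.exp_zero, mul_one, polarPt, mul_comm (Complex.exp _)]
  have hsin := Real.sin_pos_of_mem_Ioo hθ
  have hl1' : 0 < 1 - l := by linarith
  have hoT : e * o' ∉ T := by rwa [heo]
  have hnorm : ‖o'‖ = ‖e * o'‖ := by rw [norm_mul, he1, one_mul]
  have hoε : ε < ‖o'‖ := by
    by_contra! h
    exact hoT (hball (by rw [mem_closedBall_zero_iff, ← hnorm]; exact h))
  have hoτ : ‖o'‖ < τ := by
    rw [hnorm, heo]
    calc ‖(1 - l) • (δ : ℂ) + l • polarPt (τ, θ)‖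
        ≤ ‖(1 - l) • (δ : ℂ)‖ + ‖l • polarPt (τ, θ)‖ := norm_add_le _ _
      _ = (1 - l) * δ + l * τ := by
          rw [norm_smul, norm_smul, norm_polarPt hτ.le, Complex.norm_real,
            Real.norm_of_nonneg hδ.le, Real.norm_of_nonneg hl1'.le, Real.norm_of_nonneg hl]
      _ < τ := by nlinarith
  have him0 : o'.im < 0 := by
    have : 0 < (1 - l) * (δ * Real.sin θ) := by positivity
    simpa [ho'] using this
  have himδ : -o'.im ≤ δ := by
    simp only [ho', neg_neg]
    calc (1 - l) * (δ * Real.sin θ) ≤ 1 * (δ * 1) := by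
          gcongr
          · linarith
          · exact Real.sin_le_one θ
      _ = δ := by ring
  have hre1 : 98 / 100 * ε < o'.re := by
    have h1 : ε ^ 2 < o'.re ^ 2 + o'.im ^ 2 := by
      have h3 := Complex.sq_norm o'
      rw [Complex.normSq_apply] at h3
      nlinarith [norm_nonneg o']
    have h2 : o'.im ^ 2 ≤ (ε / 7) ^ 2 := by
      rw [← neg_sq o'.im]
      exact pow_le_pow_left₀ (by linarith) (by linarith) 2
    have h3 : -δ ≤ o'.re := by
      simp only [ho']
      have h4 : -1 ≤ Real.cos θ := Real.neg_one_le_cos θ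
      have h5 : 0 ≤ l * τ := by positivity
      have h6 : (1 - l) * (δ * -1) ≤ (1 - l) * (δ * Real.cos θ) := by gcongr
      nlinarith
    by_contra! h
    nlinarith
  have hre0 : 0 < o'.re := by linarith
  have hτre : τ - o'.re = (1 - l) * (τ - δ * Real.cos θ) := by simp only [ho']; ring
  have hcosδ : δ * Real.cos θ ≤ δ := mul_le_of_le_one_right hδ.le (Real.cos_le_one θ)
  have hreτ : o'.re < τ := by
    have : 0 < (1 - l) * (τ - δ * Real.cos θ) := mul_pos hl1' (by linarith)
    linarith
  have hoim : -o'.im * τ ≤ 6 / 5 * δ * (τ - o'.re) := by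
    rw [hτre]
    simp only [ho', neg_neg]
    have h1 : Real.sin θ * τ ≤ 6 / 5 * (τ - δ * Real.cos θ) := by
      have := mul_le_of_le_one_left hτ.le (Real.sin_le_one θ)
      linarith
    have h2 : (1 - l) * δ * (Real.sin θ * τ) ≤ (1 - l) * δ * (6 / 5 * (τ - δ * Real.cos θ)) :=
      mul_le_mul_of_nonneg_left h1 (by positivity)
    linarith
  have hA := (hcap θ).le_of_obstacle hK (hT.preimage (by fun_prop)) (o := o') hε hδε
    (fun z hz => hball (by
      rw [mem_closedBall_zero_iff, norm_mul, ← he, he1, one_mul]; simpa using hz))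
    (fun x hx => by
      rw [mem_preimage, mul_comm]
      exact hlit' x hx) hoT hre0 hreτ him0 himδ hoim
  have harg0 : o'.arg < 0 := Complex.arg_neg_iff.2 him0
  have harg1 : -(Real.pi / 2) < o'.arg := Complex.neg_pi_div_two_lt_arg_iff.2 (Or.inl hre0)
  have hang : -o'.arg < δ / o'.re := by
    have h1 := Real.lt_tan (x := -o'.arg) (by linarith) (by linarith)
    rw [Real.tan_neg, Complex.tan_arg, ← neg_div] at h1
    exact h1.trans_le (div_le_div_of_nonneg_right himδ hre0.le)
  have hpt : polarPt (‖o'‖, θ + o'.arg) = e * o' := by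
    rw [add_comm, polarPt_add, polarPt_norm_arg]
  refine ⟨(‖o'‖, θ + o'.arg), ⟨⟨⟨by linarith, hoτ⟩, ?_, ?_⟩, ?_⟩, ?_, ?_⟩
  · linarith [Real.pi_pos]
  · simp only; linarith
  · rw [mem_ofPred_eq, hpt]
    exact hoT
  · have : δ / o'.re ≤ 5 * K * δ / ε * τ := by
      rw [div_mul_eq_mul_div, div_le_div_iff₀ hre0 hε]
      have := mul_le_mul_of_nonneg_left hA hδ.le
      linarith
    simp only
    linarith
  · have : δ / o'.re ≤ 21 / 20 * δ / ε := by
      rw [div_le_div_iff₀ hre0 hε]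
      have := mul_le_mul_of_nonneg_left hre1.le hδ.le
      nlinarith [mul_pos hδ hε]
    simp only
    linarith

/-! ### The measure of the points that are lost -/

theorem isClosed_setOf_lit {T : Set ℂ} (hT : IsClosed T) :
    IsClosed {p : ℝ × ℝ | Lit T p.1 p.2} := by
  simp only [Lit, ofPred_forall]
  exact isClosed_iInter fun s => isClosed_iInter fun _ => hT.preimage (by fun_prop)

theorem measurableSet_nearShadow {T : Set ℂ} (hT : IsClosed T) {ω : ℝ → ℝ} (hω : Continuous ω) :
    MeasurableSet {p : ℝ × ℝ | NearShadow T (ω p.1) p.1 p.2} := by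
  have hdark : ∀ α β : ℚ, MeasurableSet {t : ℝ | 0 < t ∧ ∀ φ ∈ Icc (α : ℝ) β, ¬ Lit T t φ} := by
    intro α β
    refine OrdConnected.measurableSet (IsUpperSet.ordConnected fun t t' htt ht => ?_)
    exact ⟨ht.1.trans_le htt, fun φ hφ hl => ht.2 φ hφ (hl.mono ht.1 htt)⟩
  have heq : {p : ℝ × ℝ | NearShadow T (ω p.1) p.1 p.2} = {p : ℝ × ℝ | Lit T p.1 p.2} ∩
      ⋃ (α : ℚ) (β : ℚ) (_ : α < β), ({p : ℝ × ℝ | (β : ℝ) < p.2} ∩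
        {p : ℝ × ℝ | p.2 < β + ω p.1} ∩ {p : ℝ × ℝ | polarPt (p.1, α) ∉ T}) ∩
        Prod.fst ⁻¹' {t : ℝ | 0 < t ∧ ∀ φ ∈ Icc (α : ℝ) β, ¬ Lit T t φ} := by
    ext p
    simp only [NearShadow, mem_ofPred_eq, mem_inter_iff, mem_iUnion, mem_preimage, exists_prop]
    constructor
    · rintro ⟨h0, h1, α, β, h2, h3, h4, h5, h6⟩
      exact ⟨h1, α, β, h2, ⟨⟨h3, h4⟩, h5⟩, h0, h6⟩
    · rintro ⟨h1, α, β, h2, ⟨⟨h3, h4⟩, h5⟩, h0, h6⟩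
      exact ⟨h0, h1, α, β, h2, h3, h4, h5, h6⟩
  rw [heq]
  refine (isClosed_setOf_lit hT).measurableSet.inter (MeasurableSet.iUnion fun α =>
    MeasurableSet.iUnion fun β => MeasurableSet.iUnion fun _ => ?_)
  refine MeasurableSet.inter (MeasurableSet.inter (MeasurableSet.inter ?_ ?_) ?_)
    (measurable_fst (hdark α β))
  · exact (isOpen_lt continuous_const continuous_snd).measurableSet
  · exact (isOpen_lt continuous_snd (by fun_prop)).measurableSet
  · exact (hT.isOpen_compl.preimage (f := fun p : ℝ × ℝ => polarPt (p.1, (α : ℝ)))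
      (by fun_prop)).measurableSet

/-- Angles near a shadow at the radius `t` that are not close to each other are separated by a
boundary point on the circle of radius `t`. -/
theorem volume_nearShadow_le {T : Set ℂ} (hT : IsClosed T) {ω t : ℝ} (hω : 0 < ω) {g : ℝ≥0∞}
    (hg : ∀ F : Finset ℂ, ↑F ⊆ frontier T → (∀ z ∈ F, ‖z‖ = t) → (F.card : ℝ≥0∞) ≤ g) :
    volume {θ | θ ∈ Ioo 0 Real.pi ∧ NearShadow T ω t θ} ≤ 2 * g * ENNReal.ofReal ω := by
  set s := {θ | θ ∈ Ioo 0 Real.pi ∧ NearShadow T ω t θ} with hs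
  rcases s.eq_empty_or_nonempty with h | ⟨θ₀, hθ₀⟩
  · simp [h]
  have ht : 0 < t := hθ₀.2.1
  have hfr : ∀ a b : ℝ, a ≤ b → (polarPt (t, a) ∈ T ∧ polarPt (t, b) ∉ T ∨
      polarPt (t, a) ∉ T ∧ polarPt (t, b) ∈ T) → ∃ z ∈ Icc a b, polarPt (t, z) ∈ frontier T := by
    intro a b hab h
    have hpre : IsPreconnected ((fun φ : ℝ => polarPt (t, φ)) '' Icc a b) :=
      isPreconnected_Icc.image _ (by fun_prop)
    have ha : polarPt (t, a) ∈ (fun φ : ℝ => polarPt (t, φ)) '' Icc a b :=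
      ⟨a, ⟨le_rfl, hab⟩, rfl⟩
    have hb : polarPt (t, b) ∈ (fun φ : ℝ => polarPt (t, φ)) '' Icc a b :=
      ⟨b, ⟨hab, le_rfl⟩, rfl⟩
    obtain ⟨_, ⟨z, hz, rfl⟩, hzf⟩ : (((fun φ : ℝ => polarPt (t, φ)) '' Icc a b) ∩
        frontier T).Nonempty := by
      rcases h with h | h
      · exact inter_frontier_nonempty_of_isPreconnected hpre ⟨_, ha, h.1⟩ ⟨_, hb, h.2⟩
      · exact inter_frontier_nonempty_of_isPreconnected hpre ⟨_, hb, h.2⟩ ⟨_, ha, h.1⟩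
    exact ⟨z, hz, hzf⟩
  have hmemT : ∀ θ ∈ s, polarPt (t, θ) ∈ T := fun θ hθ =>
    (lit_iff ht).1 hθ.2.2.1 t ⟨ht.le, le_rfl⟩
  have hnorm : ∀ φ, ‖polarPt (t, φ)‖ = t := fun φ => norm_polarPt ht.le
  -- there is at least one boundary point on the circle
  have hg1 : 1 ≤ g := by
    obtain ⟨-, α, β, hαβ, hβ, -, hα, -⟩ := hθ₀.2.2
    have h2 : (α : ℝ) < β := by exact_mod_cast hαβ
    obtain ⟨z, -, hz⟩ := hfr α θ₀ (by linarith) (Or.inr ⟨hα, hmemT _ hθ₀⟩)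
    simpa using hg {polarPt (t, z)} (by simpa using hz) (by simp [hnorm])
  have hcount := volume_le_of_separated_of_card_le (s := s)
    (Z := {φ | φ ∈ Ioo 0 Real.pi ∧ polarPt (t, φ) ∈ frontier T}) hω (g := g) ?_ ?_
  · refine hcount.trans ?_
    gcongr
    rw [two_mul]
    gcongr
  · intro F hF
    classical
    have hinj : Set.InjOn (fun φ : ℝ => polarPt (t, φ)) F := by
      intro x hx y hy hxy
      have h1 := (hF hx).1
      have h2 := (hF hy).1
      have h3 := congrArg Complex.arg hxy
      simp only at h3
      rwa [arg_polarPt ht ⟨by linarith [h1.1, Real.pi_pos], h1.2.le⟩,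
        arg_polarPt ht ⟨by linarith [h2.1, Real.pi_pos], h2.2.le⟩] at h3
    have := hg (F.image fun φ : ℝ => polarPt (t, φ)) ?_ ?_
    · rwa [Finset.card_image_of_injOn hinj] at this
    · intro z hz
      obtain ⟨φ, hφ, rfl⟩ := Finset.mem_image.1 (Finset.mem_coe.1 hz)
      exact (hF hφ).2
    · intro z hz
      obtain ⟨φ, hφ, rfl⟩ := Finset.mem_image.1 hz
      exact hnorm φ
  · intro x hx y hy hxy
    obtain ⟨-, α, β, hαβ, hβ, hω', hα, hdark⟩ := hy.2.2
    have hαβ' : (α : ℝ) < β := by exact_mod_cast hαβ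
    rcases le_or_gt (β : ℝ) x with h | h
    · left; linarith
    · right
      have hxα : x < α := by
        by_contra! h'
        exact hdark x ⟨h', h.le⟩ hx.2.2.1
      obtain ⟨z, hz, hzf⟩ := hfr x α hxα.le (Or.inl ⟨hmemT x hx, hα⟩)
      have hzα : z ≠ α := fun h' => hα (h' ▸ hT.frontier_subset hzf)
      have hz1 : z < α := lt_of_le_of_ne hz.2 hzα
      exact ⟨z, ⟨⟨by linarith [hx.1.1, hz.1], by linarith [hy.1.2]⟩, hzf⟩, hz.1, by linarith⟩

/-- The points in the upper half plane, in polar coordinates, that are seen from the origin but not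
from the point `δ` of the real axis. -/
def lostSet (T : Set ℂ) (δ : ℝ) : Set (ℝ × ℝ) :=
  {p | 0 < p.1 ∧ p.2 ∈ Ioo 0 Real.pi ∧ Lit T p.1 p.2 ∧ ¬ segment ℝ (δ : ℂ) (polarPt p) ⊆ T}

/-- The points seen from the origin but not from `δ` have small measure for the densities `h` that
occur for a step of Hit-and-Run from the origin. Such a point either lies itself near a shadow, or
on a ray that contains many points near a shadow. -/
theorem lintegral_lostSet_le {T : Set ℂ} (hT : IsClosed T) {K : ℝ} (hK : 0 < K)
    (hcap : ∀ ψ : ℝ, HasLargeCaps ((fun z => Complex.exp (ψ * Complex.I) * z) ⁻¹' T) K)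
    {ε δ : ℝ} (hε : 0 < ε) (hball : closedBall 0 ε ⊆ T) (hδ : 0 < δ) (hδε : 7 * δ < ε)
    {g : ℝ → ℝ≥0∞} (hgm : Measurable g)
    (hg : ∀ (t : ℝ) (F : Finset ℂ), ↑F ⊆ frontier T → (∀ z ∈ F, ‖z‖ = t) → (F.card : ℝ≥0∞) ≤ g t)
    {R : ℝ} (hR : 0 ≤ R) (hgR : ∫⁻ t, g t ≤ ENNReal.ofReal R) (hKR : 15 * (δ * (K * R)) ≤ ε)
    {h : ℝ → ℝ≥0∞} (hh1 : ∀ t θ, 0 < t → Lit T t θ → h θ ≤ ENNReal.ofReal (1 / (Real.pi * t)))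
    (hh2 : ∀ θ, h θ * volume {t | 0 < t ∧ Lit T t θ} ≤ ENNReal.ofReal (1 / Real.pi))
    (hhm : Measurable h) :
    ∫⁻ p, (lostSet T δ).indicator (fun p => h p.2) p ≤ ENNReal.ofReal (31 / 100) := by
  have hπ := Real.pi_pos
  set c₁ := 5 * K * δ / ε with hc₁
  have hc₁0 : 0 < c₁ := by positivity
  set ω₂ := 21 / 20 * δ / ε with hω₂
  have hω₂0 : 0 < ω₂ := by positivity
  set up : Set (ℝ × ℝ) := {p | p.2 ∈ Ioo 0 Real.pi} with hup
  have hupm : MeasurableSet up := measurable_snd measurableSet_Ioo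
  set M₁ : Set (ℝ × ℝ) := up ∩ {p | NearShadow T (c₁ * p.1) p.1 p.2} with hM₁
  set M₂ : Set (ℝ × ℝ) := up ∩ {p | NearShadow T ω₂ p.1 p.2} with hM₂
  have hM₁m : MeasurableSet M₁ := hupm.inter (measurableSet_nearShadow hT (ω := fun t => c₁ * t)
    (by fun_prop))
  have hM₂m : MeasurableSet M₂ := hupm.inter (measurableSet_nearShadow hT (ω := fun _ => ω₂)
    (by fun_prop))
  set B : Set ℝ := {θ | ENNReal.ofReal (1 / (2 * K)) ≤ volume ((fun t => (t, θ)) ⁻¹' M₂)} with hB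
  have hvm : Measurable fun θ => volume ((fun t => (t, θ)) ⁻¹' M₂) :=
    measurable_measure_prodMk_right hM₂m
  have hBm : MeasurableSet B := measurableSet_le measurable_const hvm
  set Lset : Set (ℝ × ℝ) := {p | 0 < p.1 ∧ Lit T p.1 p.2} with hLset
  have hLm : MeasurableSet Lset :=
    (isOpen_lt continuous_const continuous_fst).measurableSet.inter
      (isClosed_setOf_lit hT).measurableSet
  -- the sections of the sets of points near a shadow
  have hsec : ∀ (t ω : ℝ), 0 < ω → volume {θ | θ ∈ Ioo 0 Real.pi ∧ NearShadow T ω t θ} ≤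
      2 * g t * ENNReal.ofReal ω := fun t ω hω => volume_nearShadow_le hT hω (hg t)
  have hpoint : ∀ p, (lostSet T δ).indicator (fun p => h p.2) p ≤
      M₁.indicator (fun p => ENNReal.ofReal (1 / (Real.pi * p.1))) p +
        (Lset ∩ Prod.snd ⁻¹' B).indicator (fun p => h p.2) p := by
    intro p
    by_cases hp : p ∈ lostSet T δ
    swap
    · rw [indicator_of_notMem hp]; exact zero_le
    rw [indicator_of_mem hp]
    obtain ⟨hp1, hp2, hlit, hbad⟩ := hp
    obtain ⟨o, ho, ho1, ho2⟩ := exists_obstacle hT hK hcap hε hball hδ hδε hp1 hp2 hlit hbad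
    by_cases hM : p ∈ M₁
    · rw [indicator_of_mem hM]
      exact (hh1 _ _ hp1 hlit).trans le_self_add
    · have hB' : p.2 ∈ B := by
        rcases nearShadow_or_island hT hp1 hlit ho ho1 with h' | h'
        · exact absurd ⟨hp2, h'⟩ hM
        obtain ⟨a, b, hab, hs⟩ := exists_nearShadow_of_island hT hK hcap hε hball hlit ho ho2 h'
        calc ENNReal.ofReal (1 / (2 * K)) ≤ ENNReal.ofReal (b - a) := ENNReal.ofReal_le_ofReal hab
          _ = volume (Ioo a b) := Real.volume_Ioo.symm
          _ ≤ volume ((fun t => (t, p.2)) ⁻¹' M₂) :=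
              measure_mono fun s hs' => show (s, p.2) ∈ M₂ from ⟨hp2, hs s hs'⟩
      rw [indicator_of_mem (s := Lset ∩ Prod.snd ⁻¹' B) ⟨⟨hp1, hlit⟩, hB'⟩]
      exact le_add_self
  have hm1 : Measurable (M₁.indicator fun p : ℝ × ℝ => ENNReal.ofReal (1 / (Real.pi * p.1))) :=
    Measurable.indicator (by fun_prop) hM₁m
  have hm2 : Measurable ((Lset ∩ Prod.snd ⁻¹' B).indicator fun p : ℝ × ℝ => h p.2) :=
    Measurable.indicator (by fun_prop) (hLm.inter (measurable_snd hBm))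
  -- the points near a shadow
  have hI1 : ∫⁻ p, M₁.indicator (fun p => ENNReal.ofReal (1 / (Real.pi * p.1))) p ≤
      ENNReal.ofReal (2 * R * (c₁ / Real.pi)) := by
    rw [Measure.volume_eq_prod, lintegral_prod _ hm1.aemeasurable]
    have hin : ∀ t : ℝ, ∫⁻ θ, M₁.indicator (fun p => ENNReal.ofReal (1 / (Real.pi * p.1))) (t, θ) ≤
        2 * g t * ENNReal.ofReal (c₁ / Real.pi) := by
      intro t
      rcases le_or_gt t 0 with ht | ht
      · have : ∀ θ, M₁.indicator (fun p => ENNReal.ofReal (1 / (Real.pi * p.1))) (t, θ) = 0 :=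
          fun θ => indicator_of_notMem (fun h' => absurd h'.2.1 (not_lt.2 ht)) _
        simp only [this, lintegral_zero]
        exact zero_le
      · have h1 : ∀ θ, M₁.indicator (fun p => ENNReal.ofReal (1 / (Real.pi * p.1))) (t, θ) =
            {θ | θ ∈ Ioo 0 Real.pi ∧ NearShadow T (c₁ * t) t θ}.indicator
              (fun _ => ENNReal.ofReal (1 / (Real.pi * t))) θ := fun θ => rfl
        simp only [h1]
        have hms : MeasurableSet {θ | θ ∈ Ioo 0 Real.pi ∧ NearShadow T (c₁ * t) t θ} :=
          measurable_prodMk_left hM₁m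
        rw [lintegral_indicator_const hms]
        calc _ ≤ ENNReal.ofReal (1 / (Real.pi * t)) * (2 * g t * ENNReal.ofReal (c₁ * t)) := by
              gcongr
              exact hsec t (c₁ * t) (by positivity)
          _ = 2 * g t * (ENNReal.ofReal (1 / (Real.pi * t)) * ENNReal.ofReal (c₁ * t)) := by ring
          _ = _ := by
              rw [← ENNReal.ofReal_mul (by positivity)]
              congr 2
              field_simp
    calc _ ≤ ∫⁻ t, 2 * g t * ENNReal.ofReal (c₁ / Real.pi) := lintegral_mono hin
      _ = 2 * (∫⁻ t, g t) * ENNReal.ofReal (c₁ / Real.pi) := by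
          rw [lintegral_mul_const _ (hgm.const_mul 2), lintegral_const_mul _ hgm]
      _ ≤ 2 * ENNReal.ofReal R * ENNReal.ofReal (c₁ / Real.pi) := by gcongr
      _ = _ := by
          rw [ENNReal.ofReal_mul (by positivity), ENNReal.ofReal_mul (by norm_num)]
          simp
  -- the rays with many points near a shadow
  have hB2 : volume B ≤ ENNReal.ofReal (2 * K * (2 * R * ω₂)) := by
    have h1 := mul_meas_ge_le_lintegral₀ hvm.aemeasurable (μ := volume)
      (ENNReal.ofReal (1 / (2 * K)))
    have h2 : ∫⁻ θ, volume ((fun t => (t, θ)) ⁻¹' M₂) ≤ ENNReal.ofReal (2 * R * ω₂) := by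
      rw [← Measure.prod_apply_symm (μ := volume) (ν := volume) hM₂m, Measure.prod_apply hM₂m]
      calc _ ≤ ∫⁻ t, 2 * g t * ENNReal.ofReal ω₂ := lintegral_mono fun t => hsec t ω₂ hω₂0
        _ = 2 * (∫⁻ t, g t) * ENNReal.ofReal ω₂ := by
            rw [lintegral_mul_const _ (hgm.const_mul 2), lintegral_const_mul _ hgm]
        _ ≤ 2 * ENNReal.ofReal R * ENNReal.ofReal ω₂ := by gcongr
        _ = _ := by
            rw [ENNReal.ofReal_mul (by positivity), ENNReal.ofReal_mul (by norm_num)]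
            simp
    have h3 : ENNReal.ofReal (1 / (2 * K)) * volume B ≤ ENNReal.ofReal (2 * R * ω₂) := h1.trans h2
    calc volume B = ENNReal.ofReal (2 * K) * (ENNReal.ofReal (1 / (2 * K)) * volume B) := by
          rw [← mul_assoc, ← ENNReal.ofReal_mul (by positivity), mul_one_div_cancel (by positivity),
            ENNReal.ofReal_one, one_mul]
      _ ≤ ENNReal.ofReal (2 * K) * ENNReal.ofReal (2 * R * ω₂) := by gcongr
      _ = _ := (ENNReal.ofReal_mul (by positivity)).symm
  have hI2 : ∫⁻ p, (Lset ∩ Prod.snd ⁻¹' B).indicator (fun p => h p.2) p ≤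
      ENNReal.ofReal (2 * K * (2 * R * ω₂) * (1 / Real.pi)) := by
    rw [Measure.volume_eq_prod, lintegral_prod_symm _ hm2.aemeasurable]
    have hin : ∀ θ : ℝ, ∫⁻ t, (Lset ∩ Prod.snd ⁻¹' B).indicator (fun p => h p.2) (t, θ) ≤
        B.indicator (fun _ => ENNReal.ofReal (1 / Real.pi)) θ := by
      intro θ
      by_cases hθ : θ ∈ B
      · rw [indicator_of_mem hθ]
        have h1 : ∀ t, (Lset ∩ Prod.snd ⁻¹' B).indicator (fun p => h p.2) (t, θ) =
            {t | 0 < t ∧ Lit T t θ}.indicator (fun _ => h θ) t := by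
          intro t
          simp only [indicator]
          congr 1
          simp only [mem_inter_iff, mem_preimage, hθ, and_true, hLset, mem_ofPred_eq]
        simp only [h1]
        have hms : MeasurableSet {t | 0 < t ∧ Lit T t θ} := measurable_prodMk_right hLm
        rw [lintegral_indicator_const hms]
        exact hh2 θ
      · have : ∀ t, (Lset ∩ Prod.snd ⁻¹' B).indicator (fun p => h p.2) (t, θ) = 0 :=
          fun t => indicator_of_notMem (fun h' => hθ h'.2) _
        simp [this]
    calc _ ≤ ∫⁻ θ, B.indicator (fun _ => ENNReal.ofReal (1 / Real.pi)) θ := lintegral_mono hin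
      _ = ENNReal.ofReal (1 / Real.pi) * volume B := lintegral_indicator_const hBm _
      _ ≤ ENNReal.ofReal (1 / Real.pi) * ENNReal.ofReal (2 * K * (2 * R * ω₂)) := by gcongr
      _ = _ := by rw [← ENNReal.ofReal_mul (by positivity), mul_comm]
  calc _ ≤ ∫⁻ p, (M₁.indicator (fun p => ENNReal.ofReal (1 / (Real.pi * p.1))) p +
        (Lset ∩ Prod.snd ⁻¹' B).indicator (fun p => h p.2) p) := lintegral_mono hpoint
    _ = _ := lintegral_add_left hm1 _
    _ ≤ _ := add_le_add hI1 hI2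
    _ = ENNReal.ofReal (2 * R * (c₁ / Real.pi) + 2 * K * (2 * R * ω₂) * (1 / Real.pi)) :=
        (ENNReal.ofReal_add (by positivity) (by positivity)).symm
    _ ≤ _ := by
        refine ENNReal.ofReal_le_ofReal ?_
        have h1 : 2 * R * (c₁ / Real.pi) + 2 * K * (2 * R * ω₂) * (1 / Real.pi) =
            71 / 5 * (δ * (K * R)) / (ε * Real.pi) := by
          rw [hc₁, hω₂]
          field_simp
          ring
        rw [h1, div_le_iff₀ (by positivity)]
        have h3 := Real.pi_gt_d2
        nlinarith

/-! ### Visibility and chords -/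

theorem mem_chordParams_iff {S : Set E} {u w : E} (hu : u ∈ S) {t : ℝ} :
    t ∈ chordParams S u w ↔ Sees S u (u + t • w) := by
  have hpt : ∀ l : ℝ, u + l • (u + t • w - u) = u + (l * t) • w := fun l => by module
  have h0 : (0 : ℝ) ∈ {t : ℝ | u + t • w ∈ S} := by simpa using hu
  simp only [sees_iff_forall, hpt]
  constructor
  · intro ht l hl
    have hord : (chordParams S u w).OrdConnected :=
      isPreconnected_connectedComponentIn.ordConnected
    have h0' : (0 : ℝ) ∈ chordParams S u w := mem_connectedComponentIn h0
    have h1 : l * t ∈ uIcc 0 t := by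
      rw [mem_uIcc]
      rcases le_total 0 t with h | h
      · exact Or.inl ⟨mul_nonneg hl.1 h, mul_le_of_le_one_left h hl.2⟩
      · exact Or.inr ⟨by nlinarith [hl.1, hl.2], mul_nonpos_of_nonneg_of_nonpos hl.1 h⟩
    have h2 : chordParams S u w ⊆ {t : ℝ | u + t • w ∈ S} := connectedComponentIn_subset _ _
    exact h2 (hord.uIcc_subset h0' ht h1)
  · intro h
    have hpre : IsPreconnected ((fun l : ℝ => l * t) '' Icc 0 1) :=
      isPreconnected_Icc.image _ (by fun_prop)
    refine hpre.subset_connectedComponentIn ⟨0, ⟨le_rfl, zero_le_one⟩, zero_mul t⟩ ?_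
      ⟨1, ⟨zero_le_one, le_rfl⟩, one_mul t⟩
    rintro _ ⟨l, hl, rfl⟩
    exact h l hl

theorem isClosed_setOf_sees {S : Set E} (hS : IsClosed S) (u : E) : IsClosed {x | Sees S u x} := by
  simp only [sees_iff_forall, ofPred_forall]
  exact isClosed_iInter fun l => isClosed_iInter fun _ => hS.preimage (by fun_prop)

theorem isClosed_setOf_sees_add {S : Set E} (hS : IsClosed S) (u : E) :
    IsClosed {p : E × ℝ | Sees S u (u + p.2 • p.1)} :=
  (isClosed_setOf_sees hS u).preimage (f := fun p : E × ℝ => u + p.2 • p.1) (by fun_prop)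

theorem chordParams_eq {S : Set E} {u : E} (hu : u ∈ S) (w : E) :
    chordParams S u w = {t | Sees S u (u + t • w)} := by
  ext t
  exact mem_chordParams_iff hu

theorem volume_chordParams_smul {S : Set E} {u : E} (hu : u ∈ S) (w : E) {r : ℝ} (hr : r ≠ 0) :
    volume (chordParams S u (r • w)) = ENNReal.ofReal |r⁻¹| * volume (chordParams S u w) := by
  rw [← Real.volume_preimage_mul_left hr]
  congr 1
  ext t
  rw [mem_preimage, mem_chordParams_iff hu, mem_chordParams_iff hu, smul_smul, mul_comm]

theorem ofReal_le_volume_chordParams {S : Set E} {u : E} {ε : ℝ} (hε : 0 < ε)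
    (hball : closedBall u ε ⊆ S) {w : E} (hw : w ≠ 0) :
    ENNReal.ofReal (2 * ε / ‖w‖) ≤ volume (chordParams S u w) := by
  have hw' : 0 < ‖w‖ := norm_pos_iff.2 hw
  have hu : u ∈ S := hball (mem_closedBall_self hε.le)
  calc ENNReal.ofReal (2 * ε / ‖w‖) = volume (Icc (-(ε / ‖w‖)) (ε / ‖w‖)) := by
        rw [Real.volume_Icc]; congr 1; ring
    _ ≤ _ := by
        refine measure_mono fun t ht => (mem_chordParams_iff hu).2 ?_
        refine ((convex_closedBall u ε).segment_subset (mem_closedBall_self hε.le) ?_).trans hball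
        rw [mem_closedBall, dist_eq_norm, add_sub_cancel_left, norm_smul, Real.norm_eq_abs]
        rw [← le_div_iff₀ hw']
        exact abs_le.2 ht

theorem volume_chordParams_le {S : Set E} (hS : Bornology.IsBounded S) {u : E} (hu : u ∈ S) {w : E}
    (hw : w ≠ 0) : volume (chordParams S u w) ≤ ENNReal.ofReal (diam S / ‖w‖) := by
  have hw' : 0 < ‖w‖ := norm_pos_iff.2 hw
  refine (Real.volume_le_diam _).trans (ediam_le fun t ht t' ht' => ?_)
  rw [edist_dist]
  refine ENNReal.ofReal_le_ofReal ?_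
  rw [le_div_iff₀ hw']
  have h1 : u + t • w ∈ S := (mem_chordParams_iff hu).1 ht (right_mem_segment _ _ _)
  have h2 : u + t' • w ∈ S := (mem_chordParams_iff hu).1 ht' (right_mem_segment _ _ _)
  have h3 := dist_le_diam_of_mem hS h1 h2
  rwa [dist_add_left, dist_eq_norm, ← sub_smul, norm_smul, ← dist_eq_norm] at h3

theorem measurable_volume_chordParams [MeasurableSpace E] [BorelSpace E] [FiniteDimensional ℝ E]
    {S : Set E} (hS : IsClosed S) {u : E} (hu : u ∈ S) :
    Measurable fun w => volume (chordParams S u w) := by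
  simp only [chordParams_eq hu]
  exact measurable_measure_prodMk_left (isClosed_setOf_sees_add hS u).measurableSet

/-! ### The surface measure of the sphere -/

section Sphere

variable [MeasurableSpace E] [BorelSpace E] [FiniteDimensional ℝ E]

open Pointwise in
theorem lintegral_toSphere_comp (L : E ≃ₗᵢ[ℝ] E) {f : E → ℝ≥0∞} (hf : Measurable f) :
    ∫⁻ θ : sphere (0 : E) 1, f (L θ) ∂(volume : Measure E).toSphere =
      ∫⁻ θ : sphere (0 : E) 1, f θ ∂(volume : Measure E).toSphere := by
  set Φ : sphere (0 : E) 1 → sphere (0 : E) 1 := fun θ => ⟨L θ, by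
    rw [mem_sphere_zero_iff_norm, L.norm_map]; exact norm_eq_of_mem_sphere θ⟩ with hΦ
  have hΦm : Measurable Φ := by
    have : Continuous Φ := (L.continuous.comp continuous_subtype_val).subtype_mk _
    exact this.measurable
  have hmap : ((volume : Measure E).toSphere).map Φ = (volume : Measure E).toSphere := by
    ext s hs
    rw [Measure.map_apply hΦm hs, Measure.toSphere_apply' _ hs, Measure.toSphere_apply' _ (hΦm hs)]
    congr 1
    have himg : Ioo (0 : ℝ) 1 • ((↑) '' (Φ ⁻¹' s) : Set E) =
        L ⁻¹' (Ioo (0 : ℝ) 1 • ((↑) '' s : Set E)) := by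
      ext x
      simp only [Set.mem_smul, mem_image, mem_preimage]
      constructor
      · rintro ⟨r, hr, _, ⟨θ, hθ, rfl⟩, rfl⟩
        exact ⟨r, hr, _, ⟨Φ θ, hθ, rfl⟩, by simp [hΦ]⟩
      · rintro ⟨r, hr, _, ⟨θ, hθ, rfl⟩, hx⟩
        refine ⟨r, hr, L.symm θ, ⟨⟨L.symm θ, by
          rw [mem_sphere_zero_iff_norm, L.symm.norm_map]; exact norm_eq_of_mem_sphere θ⟩, ?_, rfl⟩,
          ?_⟩
        · convert! hθ using 1
          exact Subtype.ext (L.apply_symm_apply _)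
        · rw [← map_smul, hx, L.symm_apply_apply]
    rw [himg]
    exact L.measurePreserving.measure_preimage_equiv (f := L.toMeasurableEquiv) _
  calc _ = ∫⁻ θ, f ((Φ θ : sphere (0 : E) 1) : E) ∂(volume : Measure E).toSphere := rfl
    _ = ∫⁻ θ : sphere (0 : E) 1, f θ ∂((volume : Measure E).toSphere).map Φ :=
        (lintegral_map (f := fun θ : sphere (0 : E) 1 => f θ) (by fun_prop) hΦm).symm
    _ = _ := by rw [hmap]

/-- Integration in polar coordinates. -/
theorem lintegral_eq_lintegral_toSphere [Nontrivial E] {f : E → ℝ≥0∞} (hf : Measurable f) :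
    ∫⁻ x, f x = ∫⁻ θ : sphere (0 : E) 1, ∫⁻ t in Ioi (0 : ℝ),
      ENNReal.ofReal (t ^ (Module.finrank ℝ E - 1)) * f (t • (θ : E))
        ∂volume ∂(volume : Measure E).toSphere := by
  set d := Module.finrank ℝ E
  have hmp := (volume : Measure E).measurePreserving_homeomorphUnitSphereProd
  have hfm : Measurable fun p : sphere (0 : E) 1 × Ioi (0 : ℝ) => f (p.2.1 • (p.1 : E)) :=
    hf.comp (by fun_prop)
  calc ∫⁻ x, f x = ∫⁻ x in ({0}ᶜ : Set E), f x := by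
        rw [restrict_compl_singleton]
    _ = ∫⁻ x : ({0}ᶜ : Set E), f x.1 ∂((volume : Measure E).comap Subtype.val) :=
        (lintegral_subtype_comap (measurableSet_singleton (0 : E)).compl f).symm
    _ = ∫⁻ x : ({0}ᶜ : Set E), (fun p : sphere (0 : E) 1 × Ioi (0 : ℝ) => f (p.2.1 • (p.1 : E)))
          (homeomorphUnitSphereProd E x) ∂((volume : Measure E).comap Subtype.val) := by
        refine lintegral_congr fun x => ?_
        congr 1
        have := congrArg Subtype.val ((homeomorphUnitSphereProd E).symm_apply_apply x)
        rw [homeomorphUnitSphereProd_symm_apply_coe] at this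
        exact this.symm
    _ = ∫⁻ p : sphere (0 : E) 1 × Ioi (0 : ℝ), f (p.2.1 • (p.1 : E))
          ∂((volume : Measure E).toSphere.prod (Measure.volumeIoiPow (d - 1))) :=
        hmp.lintegral_comp hfm
    _ = ∫⁻ θ : sphere (0 : E) 1, ∫⁻ t : Ioi (0 : ℝ), f (t.1 • (θ : E))
          ∂(Measure.volumeIoiPow (d - 1)) ∂(volume : Measure E).toSphere :=
        lintegral_prod _ hfm.aemeasurable
    _ = _ := by
        refine lintegral_congr fun θ => ?_
        rw [Measure.volumeIoiPow, lintegral_withDensity_eq_lintegral_mul _ (by fun_prop)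
          (by fun_prop)]
        exact lintegral_subtype_comap measurableSet_Ioi
          (fun t => ENNReal.ofReal (t ^ (d - 1)) * f (t • (θ : E)))

/-- The squares of the coordinates of a point of the sphere add up to one and have, by symmetry,
the same mean. -/
theorem lintegral_inner_sq_toSphere {e : E} (he : ‖e‖ = 1) :
    Module.finrank ℝ E * ∫⁻ θ : sphere (0 : E) 1, ENNReal.ofReal (inner ℝ (θ : E) e ^ 2)
      ∂(volume : Measure E).toSphere = (volume : Measure E).toSphere univ := by
  set b := stdOrthonormalBasis ℝ E
  have hm : ∀ e : E, Measurable fun x : E => ENNReal.ofReal (inner ℝ x e ^ 2) := fun e => by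
    fun_prop
  have hsame : ∀ i, ∫⁻ θ : sphere (0 : E) 1, ENNReal.ofReal (inner ℝ (θ : E) (b i) ^ 2)
      ∂(volume : Measure E).toSphere = ∫⁻ θ : sphere (0 : E) 1,
        ENNReal.ofReal (inner ℝ (θ : E) e ^ 2) ∂(volume : Measure E).toSphere := by
    intro i
    set L := (Submodule.span ℝ {b i - e})ᗮ.reflection
    have hL : L (b i) = e := Submodule.reflection_sub (by rw [he, b.norm_eq_one])
    rw [← lintegral_toSphere_comp L (hm e)]
    refine lintegral_congr fun θ => ?_
    rw [← hL, L.inner_map_map]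
  have hsum : ∑ i, ∫⁻ θ : sphere (0 : E) 1, ENNReal.ofReal (inner ℝ (θ : E) (b i) ^ 2)
      ∂(volume : Measure E).toSphere = (volume : Measure E).toSphere univ := by
    rw [← lintegral_finsetSum (f := fun i (θ : sphere (0 : E) 1) =>
      ENNReal.ofReal (inner ℝ (θ : E) (b i) ^ 2)) _
      fun i _ => (hm (b i)).comp measurable_subtype_coe]
    rw [← lintegral_one]
    refine lintegral_congr fun θ => ?_
    rw [← ENNReal.ofReal_sum_of_nonneg fun i _ => sq_nonneg _]
    have h1 := b.sum_sq_norm_inner_left (θ : E)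
    simp only [Real.norm_eq_abs, sq_abs] at h1
    rw [h1, norm_eq_of_mem_sphere θ]
    simp
  rw [← hsum, Finset.sum_congr rfl fun i _ => hsame i]
  simp

end Sphere

/-! ### The density of a step -/

section

theorem coe_sphere_ne_zero {F : Type*} [NormedAddCommGroup F] (θ : sphere (0 : F) 1) :
    (θ : F) ≠ 0 := fun h => by
  have := norm_eq_of_mem_sphere θ
  simp [h] at this

theorem volume_chordParams_ne_zero {S : Set E} {u : E} {ε : ℝ} (hε : 0 < ε)
    (hball : closedBall u ε ⊆ S) {w : E} (hw : w ≠ 0) : volume (chordParams S u w) ≠ 0 := by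
  have h1 := ofReal_le_volume_chordParams hε hball hw
  have h2 : 0 < ‖w‖ := norm_pos_iff.2 hw
  exact ((ENNReal.ofReal_pos.2 (by positivity)).trans_le h1).ne'

theorem volume_chordParams_ne_top {S : Set E} (hS : Bornology.IsBounded S) {u : E} (hu : u ∈ S)
    {w : E} (hw : w ≠ 0) : volume (chordParams S u w) ≠ ⊤ :=
  ((volume_chordParams_le hS hu hw).trans_lt ENNReal.ofReal_lt_top).ne

variable [MeasurableSpace E] [BorelSpace E] [FiniteDimensional ℝ E]

variable (E) in
/-- The surface area of the unit sphere. -/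
def sphereArea : ℝ≥0∞ := (volume : Measure E).toSphere univ

theorem sphereArea_ne_top : sphereArea E ≠ ⊤ := measure_ne_top _ _

theorem sphereArea_ne_zero [Nontrivial E] : sphereArea E ≠ 0 := by
  rw [sphereArea, Ne, Measure.measure_univ_eq_zero]
  exact Measure.toSphere_ne_zero _

/-- The density of the distribution of a step of Hit-and-Run from `u`. If `x` is seen from `u`,
then the product of `volume (chordParams S u (x - u))` with `‖x - u‖` is the length of the chord
through `u` and `x`. The value at `u` itself is of no significance. -/
def stepDensity (S : Set E) (u x : E) : ℝ≥0∞ :=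
  {x | Sees S u x}.indicator (fun x => 2 / (sphereArea E * volume (chordParams S u (x - u)) *
    ENNReal.ofReal (‖x - u‖ ^ Module.finrank ℝ E))) x

theorem measurable_stepDensity {S : Set E} (hS : IsClosed S) {u : E} (hu : u ∈ S) :
    Measurable (stepDensity S u) := by
  refine Measurable.indicator ?_ (isClosed_setOf_sees hS u).measurableSet
  have := (measurable_volume_chordParams hS hu).comp (measurable_id.sub_const u)
  exact (measurable_const (a := (2 : ℝ≥0∞))).div
    ((this.const_mul _).mul (by fun_prop))

/-- Polar coordinates about `u` turn the definition of a step into an integral of a density. Each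
chord is parametrised by two opposite directions, whence the numerator `2` of the density. -/
theorem stepProb_eq_lintegral [Nontrivial E] {S : Set E} (hS : IsClosed S) {u : E} (hu : u ∈ S)
    {A : Set E} (hA : MeasurableSet A) :
    stepProb S u A = ∫⁻ x in A, stepDensity S u x := by
  set σ := (volume : Measure E).toSphere with hσ
  set ℓ : E → ℝ≥0∞ := fun w => volume (chordParams S u w) with hℓ
  -- the part of the chord on the positive side
  set V : E → ℝ≥0∞ := fun w => volume {t : ℝ | (Sees S u (u + t • w) ∧ u + t • w ∈ A) ∧ 0 < t}
    with hV
  have hcl := (isClosed_setOf_sees_add hS u).measurableSet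
  have hAm : MeasurableSet {p : E × ℝ | u + p.2 • p.1 ∈ A} :=
    hA.preimage (f := fun p : E × ℝ => u + p.2 • p.1) (by fun_prop)
  have hVm : Measurable V :=
    measurable_measure_prodMk_left (s := {p : E × ℝ | (Sees S u (u + p.2 • p.1) ∧
      u + p.2 • p.1 ∈ A) ∧ 0 < p.2}) ((hcl.inter hAm).inter
        (isOpen_lt continuous_const continuous_snd).measurableSet)
  have hℓm : Measurable ℓ := measurable_volume_chordParams hS hu
  have hℓneg : ∀ w, ℓ (-w) = ℓ w := fun w => by
    have := volume_chordParams_smul hu w (r := -1) (by norm_num)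
    simpa using this
  have hsplit : ∀ w, volume (chordParams S u w ∩ {t : ℝ | u + t • w ∈ A}) = V w + V (-w) := by
    intro w
    set B := chordParams S u w ∩ {t : ℝ | u + t • w ∈ A} with hB
    have hBeq : B = {t : ℝ | Sees S u (u + t • w) ∧ u + t • w ∈ A} := by
      rw [hB, chordParams_eq hu]; rfl
    have hBm : MeasurableSet B := by
      rw [hBeq]
      exact measurable_prodMk_left (x := w) (hcl.inter hAm)
    have h1 : volume (B ∩ Ioi 0) = V w := by rw [hBeq]; rfl
    have h2 : volume (B \ Ioi 0) = V (-w) := by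
      have h3 : volume (B \ Ioi 0) = volume (B ∩ Iio 0) := by
        refine measure_congr ?_
        have : (Iic (0 : ℝ) : Set ℝ) =ᵐ[volume] Iio 0 := Iio_ae_eq_Iic.symm
        have h4 := (ae_eq_refl (μ := volume) B).inter this
        rwa [← compl_Ioi, ← sdiff_eq] at h4
      rw [h3, ← Measure.measure_neg volume (B ∩ Iio 0)]
      congr 1
      ext t
      simp only [Set.mem_neg, mem_inter_iff, hBeq, mem_ofPred_eq, mem_Iio, neg_smul, smul_neg,
        Left.neg_neg_iff]
    rw [← h1, ← h2, measure_inter_add_sdiff _ measurableSet_Ioi]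
  have hleft : stepProb S u A = (∫⁻ θ : sphere (0 : E) 1, 2 * (V θ / ℓ θ) ∂σ) / sphereArea E := by
    have h1 : ∫⁻ θ : sphere (0 : E) 1, V (-θ) / ℓ (-θ) ∂σ = ∫⁻ θ : sphere (0 : E) 1, V θ / ℓ θ ∂σ :=
      lintegral_toSphere_comp (LinearIsometryEquiv.neg ℝ) (f := fun w => V w / ℓ w)
        (hVm.div hℓm)
    unfold stepProb
    simp only
    congr 1
    calc _ = ∫⁻ θ : sphere (0 : E) 1, (V θ / ℓ θ + V (-θ) / ℓ (-θ)) ∂σ := by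
          refine lintegral_congr fun θ => ?_
          rw [hsplit, hℓneg, ENNReal.add_div]
      _ = ∫⁻ θ : sphere (0 : E) 1, V θ / ℓ θ ∂σ + ∫⁻ θ : sphere (0 : E) 1, V (-θ) / ℓ (-θ) ∂σ :=
          lintegral_add_left ((hVm.div hℓm).comp measurable_subtype_coe) _
      _ = 2 * ∫⁻ θ : sphere (0 : E) 1, V θ / ℓ θ ∂σ := by rw [h1, two_mul]
      _ = _ := (lintegral_const_mul _ ((hVm.div hℓm).comp measurable_subtype_coe)).symm
  have hFm : Measurable (A.indicator (stepDensity S u)) :=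
    (measurable_stepDensity hS hu).indicator hA
  rw [← lintegral_indicator hA, ← lintegral_add_left_eq_self _ u,
    lintegral_eq_lintegral_toSphere (f := fun x => A.indicator (stepDensity S u) (u + x))
      (hFm.comp (measurable_const_add u)), hleft,
    div_eq_mul_inv, ← lintegral_mul_const]
  swap
  · exact ((hVm.div hℓm).const_mul 2).comp measurable_subtype_coe
  refine lintegral_congr fun θ => ?_
  have hθ := coe_sphere_ne_zero θ
  have hin : ∀ t ∈ Ioi (0 : ℝ), ENNReal.ofReal (t ^ (Module.finrank ℝ E - 1)) *
      A.indicator (stepDensity S u) (u + t • (θ : E)) =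
      {t : ℝ | (Sees S u (u + t • (θ : E)) ∧ u + t • (θ : E) ∈ A) ∧ 0 < t}.indicator
        (fun _ => 2 / (sphereArea E * ℓ θ)) t := by
    intro t ht
    have ht : 0 < t := ht
    by_cases hA' : u + t • (θ : E) ∈ A
    swap
    · rw [indicator_of_notMem hA', indicator_of_notMem (fun h => hA' h.1.2), mul_zero]
    rw [indicator_of_mem hA', stepDensity]
    by_cases hs : Sees S u (u + t • (θ : E))
    swap
    · rw [indicator_of_notMem (s := {x | Sees S u x}) hs, indicator_of_notMem (fun h => hs h.1.1),
        mul_zero]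
    rw [indicator_of_mem (s := {x | Sees S u x}) hs, indicator_of_mem (s := {t : ℝ |
      (Sees S u (u + t • (θ : E)) ∧ u + t • (θ : E) ∈ A) ∧ 0 < t}) ⟨⟨hs, hA'⟩, ht⟩,
      add_sub_cancel_left, volume_chordParams_smul hu _ ht.ne', norm_smul, norm_eq_of_mem_sphere θ,
      mul_one, Real.norm_of_nonneg ht.le, abs_of_pos (inv_pos.2 ht)]
    have hd : 0 < Module.finrank ℝ E := Module.finrank_pos
    have h1 : sphereArea E * (ENNReal.ofReal t⁻¹ * volume (chordParams S u (θ : E))) *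
        ENNReal.ofReal (t ^ Module.finrank ℝ E) =
        ENNReal.ofReal (t ^ (Module.finrank ℝ E - 1)) * (sphereArea E * ℓ θ) := by
      have h2 : ENNReal.ofReal t⁻¹ * ENNReal.ofReal (t ^ Module.finrank ℝ E) =
          ENNReal.ofReal (t ^ (Module.finrank ℝ E - 1)) := by
        rw [← ENNReal.ofReal_mul (inv_nonneg.2 ht.le)]
        congr 1
        obtain ⟨k, hk⟩ := Nat.exists_eq_succ_of_ne_zero hd.ne'
        rw [hk, Nat.succ_sub_one, pow_succ]
        field_simp
      rw [← h2]
      ring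
    rw [h1, ← mul_div_assoc, ENNReal.mul_div_mul_left _ _ (by
      simpa using pow_pos ht _) ENNReal.ofReal_ne_top]
  rw [setLIntegral_congr_fun measurableSet_Ioi hin]
  have hms : MeasurableSet {t : ℝ | (Sees S u (u + t • (θ : E)) ∧ u + t • (θ : E) ∈ A) ∧ 0 < t} :=
    measurable_prodMk_left (x := (θ : E)) (t := {p : E × ℝ | (Sees S u (u + p.2 • p.1) ∧
      u + p.2 • p.1 ∈ A) ∧ 0 < p.2}) ((hcl.inter hAm).inter
        (isOpen_lt continuous_const continuous_snd).measurableSet)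
  rw [lintegral_indicator_const hms, Measure.restrict_apply hms, inter_eq_left.2 fun t ht => ht.2]
  have h3 : sphereArea E ≠ 0 := sphereArea_ne_zero
  have h4 : sphereArea E ≠ ⊤ := sphereArea_ne_top
  rw [div_eq_mul_inv, div_eq_mul_inv, ENNReal.mul_inv (Or.inl h3) (Or.inl h4)]
  ring

theorem stepProb_univ [Nontrivial E] {S : Set E}
    (hSb : Bornology.IsBounded S) {u : E} {ε : ℝ} (hε : 0 < ε) (hball : closedBall u ε ⊆ S) :
    stepProb S u univ = 1 := by
  have hu : u ∈ S := hball (mem_closedBall_self hε.le)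
  have h1 : ∀ θ : sphere (0 : E) 1, volume (chordParams S u θ ∩ {t : ℝ | u + t • (θ : E) ∈ univ}) /
      volume (chordParams S u θ) = 1 := by
    intro θ
    have hθ := coe_sphere_ne_zero θ
    simp only [mem_univ, ofPred_true, inter_univ]
    exact ENNReal.div_self (volume_chordParams_ne_zero hε hball hθ)
      (volume_chordParams_ne_top hSb hu hθ)
  unfold stepProb
  simp only [h1, lintegral_one]
  exact ENNReal.div_self sphereArea_ne_zero sphereArea_ne_top

end

/-! ### The invisible points in the plane -/

section

/-- A unit vector of a plane is the image of `1` under an isometry from the complex plane. -/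
theorem exists_linearIsometryEquiv_complex [FiniteDimensional ℝ E]
    (hdim : Module.finrank ℝ E = 2) {e : E} (he : ‖e‖ = 1) : ∃ L : ℂ ≃ₗᵢ[ℝ] E, L 1 = e := by
  have hv : Orthonormal ℝ (({0} : Set (Fin 2)).domRestrict fun _ => e) := by
    refine ⟨fun _ => he, fun i j hij => ?_⟩
    exact absurd (Subsingleton.elim i j) hij
  obtain ⟨b, hb⟩ := hv.exists_orthonormalBasis_extension_of_card_eq (by simpa using hdim)
  refine ⟨Complex.orthonormalBasisOneI.equiv b (Equiv.refl _), ?_⟩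
  have h1 : (Complex.orthonormalBasisOneI 0 : ℂ) = 1 := by simp
  rw [← h1, OrthonormalBasis.equiv_apply_basis]
  exact hb 0 rfl

/-- The isometry `z ↦ u + L z`. -/
def affineIsometry (u : E) (L : ℂ ≃ₗᵢ[ℝ] E) : ℂ ≃ᵢ E :=
  L.toIsometryEquiv.trans (IsometryEquiv.addLeft u)

theorem affineIsometry_apply (u : E) (L : ℂ ≃ₗᵢ[ℝ] E) (z : ℂ) : affineIsometry u L z = u + L z :=
  rfl

theorem polarPt_eq_smul (p : ℝ × ℝ) : polarPt p = p.1 • Complex.exp (p.2 * Complex.I) := by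
  rw [polarPt, Complex.real_smul]

theorem lit_preimage_iff {S : Set E} {u : E} {L : ℂ ≃ₗᵢ[ℝ] E} {t θ : ℝ} :
    Lit (affineIsometry u L ⁻¹' S) t θ ↔ Sees S u (u + L (polarPt (t, θ))) := by
  rw [Lit, sees_iff_forall]
  refine forall₂_congr fun l _ => ?_
  rw [mem_preimage, affineIsometry_apply, add_sub_cancel_left, ← map_smul, polarPt_eq_smul,
    polarPt_eq_smul, smul_smul]

theorem segment_subset_preimage_iff {S : Set E} {u : E} {L : ℂ ≃ₗᵢ[ℝ] E} {z w : ℂ} :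
    segment ℝ z w ⊆ affineIsometry u L ⁻¹' S ↔ Sees S (u + L z) (u + L w) := by
  rw [segment_eq_image', image_subset_iff, sees_iff_forall]
  refine forall₂_congr fun l _ => ?_
  rw [mem_preimage, mem_preimage, affineIsometry_apply, map_add, map_smul, map_sub,
    add_sub_add_left_eq_sub, add_assoc]

variable [MeasurableSpace E] [BorelSpace E] [FiniteDimensional ℝ E]

/-- The density, with respect to the polar coordinates of a plane, of a step of Hit-and-Run. -/
def polarDensity (S : Set E) (u : E) (L : ℂ ≃ₗᵢ[ℝ] E) (φ : ℝ) : ℝ≥0∞ :=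
  (ENNReal.ofReal Real.pi * volume (chordParams S u (L (Complex.exp (φ * Complex.I)))))⁻¹

/-- The probability that a step from `u` ends, on one side of the line through `u` and the point
with coordinate `δ`, at a point that is not seen from the latter. -/
theorem lintegral_polarDensity_lostSet_le (hdim : Module.finrank ℝ E = 2) {S : Set E}
    (hS : IsClosed S) (hSb : Bornology.IsBounded S) (hC : HasC2Boundary S) {K R : ℝ} (hK : 0 < K)
    (hcurv : maxCurvature (frontier S) ≤ ENNReal.ofReal K) (hR : 0 ≤ R)
    (hlen : μH[1] (frontier S) ≤ ENNReal.ofReal R) {u : E} {ε δ : ℝ} (hε : 0 < ε)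
    (hball : closedBall u ε ⊆ S) (hδ : 0 < δ) (hδε : 7 * δ < ε) (hKR : 15 * (δ * (K * R)) ≤ ε)
    (L : ℂ ≃ₗᵢ[ℝ] E) :
    ∫⁻ p, (lostSet (affineIsometry u L ⁻¹' S) δ).indicator (fun p => polarDensity S u L p.2) p ≤
      ENNReal.ofReal (31 / 100) := by
  have hu : u ∈ S := hball (mem_closedBall_self hε.le)
  set A := affineIsometry u L with hA
  have hne : ∀ φ : ℝ, L (Complex.exp (φ * Complex.I)) ≠ 0 := fun φ => by
    simp [Complex.exp_ne_zero]
  have hL : ∀ t θ, L (polarPt (t, θ)) = t • L (Complex.exp (θ * Complex.I)) := fun t θ => by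
    rw [polarPt_eq_smul, map_smul]
  have hlip : LipschitzWith 1 fun x : E => dist x u := LipschitzWith.dist_left u
  obtain ⟨g, hgm, hgi, hg⟩ := exists_lintegral_le_hausdorffMeasure hlip
    (A := frontier S) (hlen.trans_lt ENNReal.ofReal_lt_top).ne
  have hπ := Real.pi_pos
  refine lintegral_lostSet_le (hS.preimage A.continuous) hK ?_ hε ?_ hδ hδε hgm ?_ hR
    (hgi.trans hlen) hKR ?_ ?_ ?_
  · intro ψ
    have h1 : (fun z => Complex.exp (ψ * Complex.I) * z) ⁻¹' (A ⁻¹' S) =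
        (((rotation (Circle.exp ψ)).toIsometryEquiv).trans A) ⁻¹' S := by
      ext z
      simp [rotation_apply, Circle.coe_exp]
    rw [h1]
    exact hasLargeCaps_preimage hdim hS hC hK.le hcurv _
  · intro z hz
    refine hball ?_
    rw [mem_closedBall, hA, affineIsometry_apply, dist_eq_norm, add_sub_cancel_left, L.norm_map]
    simpa using hz
  · intro t F hF hFt
    classical
    have h1 := hg t (F.image A) ?_ ?_
    · rwa [Finset.card_image_of_injective _ A.injective] at h1
    · intro x hx
      obtain ⟨z, hz, rfl⟩ := Finset.mem_image.1 (Finset.mem_coe.1 hx)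
      have h2 := A.toHomeomorph.preimage_frontier S
      change A ⁻¹' frontier S = frontier (A ⁻¹' S) at h2
      have h3 := hF (Finset.mem_coe.2 hz)
      rw [← h2] at h3
      exact h3
    · intro x hx
      obtain ⟨z, hz, rfl⟩ := Finset.mem_image.1 hx
      rw [hA, affineIsometry_apply, dist_eq_norm, add_sub_cancel_left, L.norm_map, hFt z hz]
  · intro t θ ht hlit
    rw [polarDensity, one_div, ENNReal.ofReal_inv_of_pos (by positivity), ENNReal.inv_le_inv,
      ENNReal.ofReal_mul hπ.le]
    gcongr
    calc ENNReal.ofReal t = volume (Icc 0 t) := by rw [Real.volume_Icc, sub_zero]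
      _ ≤ _ := by
        refine measure_mono fun r hr => (mem_chordParams_iff hu).2 ?_
        rw [← hL]
        rcases hr.1.eq_or_lt with h0 | h0
        · rw [← h0, hL, zero_smul, add_zero, Sees, segment_same]
          simpa using hu
        · exact lit_preimage_iff.1 (hlit.mono h0 hr.2)
  · intro θ
    have h1 : volume {t | 0 < t ∧ Lit (A ⁻¹' S) t θ} ≤
        volume (chordParams S u (L (Complex.exp (θ * Complex.I)))) := by
      refine measure_mono fun t ht => (mem_chordParams_iff hu).2 ?_
      rw [← hL]
      exact lit_preimage_iff.1 ht.2
    have h2 := volume_chordParams_ne_zero hε hball (hne θ)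
    have h3 := volume_chordParams_ne_top hSb hu (hne θ)
    calc _ ≤ polarDensity S u L θ * volume (chordParams S u (L (Complex.exp (θ * Complex.I)))) := by
          gcongr
      _ = ENNReal.ofReal (1 / Real.pi) := by
          rw [polarDensity, ENNReal.mul_inv (Or.inr h3) (Or.inr h2), mul_assoc,
            ENNReal.inv_mul_cancel h2 h3, mul_one, one_div, ENNReal.ofReal_inv_of_pos hπ]
      _ ≤ _ := le_rfl
  · have h1 : Measurable fun φ : ℝ => L (Complex.exp (φ * Complex.I)) := by
      have : Continuous fun φ : ℝ => L (Complex.exp (φ * Complex.I)) := by fun_prop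
      exact this.measurable
    exact (((measurable_volume_chordParams hS hu).comp h1).const_mul _).inv

theorem sphereArea_of_finrank_eq_two (hdim : Module.finrank ℝ E = 2) :
    sphereArea E = 2 * ENNReal.ofReal Real.pi := by
  have : Nontrivial E := Module.nontrivial_of_finrank_pos (R := ℝ) (by omega)
  rw [sphereArea, Measure.toSphere_apply_univ, hdim,
    InnerProductSpace.volume_ball_of_dim_even (k := 1) (by omega)]
  simp [hdim]

/-- In the plane, a point `v` close to `u` sees most of the points that a step from `u` reaches. -/
theorem stepProb_not_sees_le (hdim : Module.finrank ℝ E = 2) {S : Set E}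
    (hS : IsClosed S) (hSb : Bornology.IsBounded S) (hC : HasC2Boundary S) {K R : ℝ} (hK : 0 < K)
    (hcurv : maxCurvature (frontier S) ≤ ENNReal.ofReal K) (hR : 0 ≤ R)
    (hlen : μH[1] (frontier S) ≤ ENNReal.ofReal R) {u v : E} {ε : ℝ} (hε : 0 < ε)
    (hball : closedBall u ε ⊆ S) (huv : u ≠ v) (hδε : 7 * dist u v < ε)
    (hKR : 15 * (dist u v * (K * R)) ≤ ε) :
    stepProb S u {x | ¬ Sees S v x} ≤ ENNReal.ofReal (62 / 100) := by
  have : Nontrivial E := Module.nontrivial_of_finrank_pos (R := ℝ) (by omega)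
  have hu : u ∈ S := hball (mem_closedBall_self hε.le)
  have hπ := Real.pi_pos
  set δ := dist u v with hδ
  have hδ0 : 0 < δ := dist_pos.2 huv
  have hδn : ‖v - u‖ = δ := by rw [hδ, dist_comm, dist_eq_norm]
  obtain ⟨L, hL⟩ := exists_linearIsometryEquiv_complex hdim (e := δ⁻¹ • (v - u)) (by
    rw [norm_smul, hδn, norm_inv, Real.norm_of_nonneg hδ0.le, inv_mul_cancel₀ hδ0.ne'])
  have hLδ : ∀ M : ℂ ≃ₗᵢ[ℝ] E, M 1 = L 1 → u + M (δ : ℂ) = v := fun M hM => by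
    have h1 : (δ : ℂ) = δ • (1 : ℂ) := by simp
    rw [h1, map_smul, hM, hL, smul_smul, mul_inv_cancel₀ hδ0.ne', one_smul, add_sub_cancel]
  -- the reflected frame
  set L' : ℂ ≃ₗᵢ[ℝ] E := RCLike.conjLIE.trans L with hL'
  have hL'1 : L' 1 = L 1 := by simp [hL']
  have hconj : ∀ r φ : ℝ, L' (polarPt (r, φ)) = L (polarPt (r, -φ)) := fun r φ => by
    simp only [hL', LinearIsometryEquiv.trans_apply, polarPt]
    congr 1
    simp [RCLike.conjLIE_apply, ← Complex.exp_conj]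
  have hAm : MeasurableSet {x | ¬ Sees S v x} := (isClosed_setOf_sees hS v).measurableSet.compl
  set F : E → ℝ≥0∞ := {x | ¬ Sees S v x}.indicator (stepDensity S u) with hF
  have hFm : Measurable F := (measurable_stepDensity hS hu).indicator hAm
  -- the integrand in polar coordinates
  have hpolar : ∀ M : ℂ ≃ₗᵢ[ℝ] E, M 1 = L 1 → ∀ r φ : ℝ, 0 < r → φ ∈ Ioo 0 Real.pi →
      ENNReal.ofReal r * F (u + M (polarPt (r, φ))) =
        (lostSet (affineIsometry u M ⁻¹' S) δ).indicator (fun p => polarDensity S u M p.2)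
          (r, φ) := by
    intro M hM r φ hr hφ
    have hMp : M (polarPt (r, φ)) = r • M (Complex.exp (φ * Complex.I)) := by
      rw [polarPt_eq_smul, map_smul]
    have hmem : (r, φ) ∈ lostSet (affineIsometry u M ⁻¹' S) δ ↔
        Sees S u (u + M (polarPt (r, φ))) ∧ ¬ Sees S v (u + M (polarPt (r, φ))) := by
      have h1 := segment_subset_preimage_iff (S := S) (u := u) (L := M) (z := δ)
        (w := polarPt (r, φ))
      rw [hLδ M hM] at h1
      rw [← h1, ← lit_preimage_iff]
      exact ⟨fun h => h.2.2, fun h => ⟨hr, hφ, h⟩⟩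
    by_cases hv : Sees S v (u + M (polarPt (r, φ)))
    · rw [indicator_of_notMem (fun h => (hmem.1 h).2 hv), hF,
        indicator_of_notMem (s := {x | ¬ Sees S v x}) (fun h => h hv), mul_zero]
    rw [hF, indicator_of_mem (s := {x | ¬ Sees S v x}) hv, stepDensity]
    by_cases hs : Sees S u (u + M (polarPt (r, φ)))
    swap
    · rw [indicator_of_notMem (fun h => hs (hmem.1 h).1),
        indicator_of_notMem (s := {x | Sees S u x}) hs, mul_zero]
    rw [indicator_of_mem (hmem.2 ⟨hs, hv⟩), indicator_of_mem (s := {x | Sees S u x}) hs,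
      add_sub_cancel_left, hMp, volume_chordParams_smul hu _ hr.ne', norm_smul, M.norm_map,
      Complex.norm_exp_ofReal_mul_I, mul_one, Real.norm_of_nonneg hr.le,
      abs_of_pos (inv_pos.2 hr), sphereArea_of_finrank_eq_two hdim, hdim, polarDensity]
    set ℓ := volume (chordParams S u (M (Complex.exp (φ * Complex.I))))
    have h1 : 2 * ENNReal.ofReal Real.pi * (ENNReal.ofReal r⁻¹ * ℓ) * ENNReal.ofReal (r ^ 2) =
        ENNReal.ofReal r * (2 * (ENNReal.ofReal Real.pi * ℓ)) := by
      have h2 : ENNReal.ofReal r⁻¹ * ENNReal.ofReal (r ^ 2) = ENNReal.ofReal r := by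
        rw [← ENNReal.ofReal_mul (inv_nonneg.2 hr.le)]
        congr 1
        field_simp
      rw [← h2]
      ring
    rw [h1, ← mul_div_assoc, ENNReal.mul_div_mul_left _ _ (by simpa using hr)
      ENNReal.ofReal_ne_top]
    conv_lhs => rw [← mul_one (2 : ℝ≥0∞), mul_assoc, one_mul]
    rw [ENNReal.mul_div_mul_left _ _ two_ne_zero ENNReal.ofNat_ne_top, one_div]
  have hside : ∀ M : ℂ ≃ₗᵢ[ℝ] E, M 1 = L 1 →
      ∫⁻ p in Ioi (0 : ℝ) ×ˢ Ioo 0 Real.pi, ENNReal.ofReal p.1 * F (u + M (polarPt p)) ≤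
        ENNReal.ofReal (31 / 100) := by
    intro M hM
    refine le_trans ?_ (lintegral_polarDensity_lostSet_le hdim hS hSb hC hK hcurv hR hlen hε hball
      hδ0 hδε hKR M)
    rw [← lintegral_indicator (measurableSet_Ioi.prod measurableSet_Ioo)]
    refine lintegral_mono fun p => ?_
    by_cases hp : p ∈ Ioi (0 : ℝ) ×ˢ Ioo 0 Real.pi
    · rw [indicator_of_mem hp]
      exact (hpolar M hM p.1 p.2 hp.1 hp.2).le
    · rw [indicator_of_notMem hp]
      exact zero_le
  set G : ℝ × ℝ → ℝ≥0∞ := fun p => ENNReal.ofReal p.1 * F (u + L (polarPt p)) with hG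
  have hlow : ∫⁻ p in Ioi (0 : ℝ) ×ˢ Ioo (-Real.pi) 0, G p =
      ∫⁻ p in Ioi (0 : ℝ) ×ˢ Ioo 0 Real.pi, ENNReal.ofReal p.1 * F (u + L' (polarPt p)) := by
    have hmp : MeasurePreserving (Prod.map id Neg.neg : ℝ × ℝ → ℝ × ℝ) volume volume :=
      (MeasurePreserving.id volume).prod (Measure.measurePreserving_neg volume)
    have hemb : MeasurableEmbedding (Prod.map id Neg.neg : ℝ × ℝ → ℝ × ℝ) :=
      ((MeasurableEquiv.refl ℝ).prodCongr (MeasurableEquiv.neg ℝ)).measurableEmbedding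
    rw [← hmp.setLIntegral_comp_preimage_emb hemb]
    have hpre : (Prod.map id Neg.neg : ℝ × ℝ → ℝ × ℝ) ⁻¹' (Ioi (0 : ℝ) ×ˢ Ioo (-Real.pi) 0) =
        Ioi (0 : ℝ) ×ˢ Ioo 0 Real.pi := by
      ext p
      simp only [mem_preimage, mem_prod, Prod.map_fst, Prod.map_snd, id, mem_Ioi, mem_Ioo]
      constructor
      · rintro ⟨h1, h2, h3⟩; exact ⟨h1, by linarith, by linarith⟩
      · rintro ⟨h1, h2, h3⟩; exact ⟨h1, by linarith, by linarith⟩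
    rw [hpre]
    refine lintegral_congr fun p => ?_
    simp only [hG, Prod.map_fst, id]
    rw [show polarPt p = polarPt (p.1, p.2) from rfl, hconj]
    rfl
  have hnull : ∫⁻ p in (univ : Set ℝ) ×ˢ {(0 : ℝ)}, G p = 0 := by
    refine setLIntegral_measure_zero _ _ ?_
    rw [Measure.volume_eq_prod, Measure.prod_prod]
    simp
  calc stepProb S u {x | ¬ Sees S v x} = ∫⁻ x, F x := by
        rw [stepProb_eq_lintegral hS hu hAm, hF, lintegral_indicator hAm]
    _ = ∫⁻ z : ℂ, F (u + L z) := by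
        rw [← lintegral_add_left_eq_self _ u]
        exact (L.measurePreserving.lintegral_comp (f := fun x => F (u + x))
          (hFm.comp (measurable_const_add u))).symm
    _ = ∫⁻ p in polarCoord.target, G p := by
        rw [← Complex.lintegral_comp_polarCoord_symm]
        refine lintegral_congr fun p => ?_
        rw [Complex.polarCoord_symm_apply, smul_eq_mul, hG]
        simp only [polarPt]
        rw [Complex.exp_mul_I, Complex.ofReal_cos, Complex.ofReal_sin]
    _ ≤ ∫⁻ p in (Ioi (0 : ℝ) ×ˢ Ioo 0 Real.pi ∪ Ioi (0 : ℝ) ×ˢ Ioo (-Real.pi) 0) ∪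
          (univ : Set ℝ) ×ˢ {(0 : ℝ)}, G p := by
        refine lintegral_mono_set fun p hp => ?_
        rw [polarCoord_target] at hp
        rcases lt_trichotomy p.2 0 with h | h | h
        · exact Or.inl (Or.inr ⟨hp.1, hp.2.1, h⟩)
        · exact Or.inr ⟨mem_univ _, h⟩
        · exact Or.inl (Or.inl ⟨hp.1, h, hp.2.2⟩)
    _ ≤ _ := (lintegral_union_le _ _ _).trans (add_le_add (lintegral_union_le _ _ _) le_rfl)
    _ ≤ ENNReal.ofReal (31 / 100) + ENNReal.ofReal (31 / 100) + 0 := by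
        rw [hnull, hlow]
        exact add_le_add (add_le_add (hside L rfl) (hside L' hL'1)) le_rfl
    _ = _ := by
        rw [add_zero, ← ENNReal.ofReal_add (by norm_num) (by norm_num)]
        norm_num

end

/-! ### Comparison of two steps -/

section

variable [MeasurableSpace E] [BorelSpace E] [FiniteDimensional ℝ E]

/-- The distribution of a step of Hit-and-Run from `u`. -/
def stepMeasure (S : Set E) (u : E) : Measure E := volume.withDensity (stepDensity S u)

theorem stepMeasure_apply [Nontrivial E] {S : Set E} (hS : IsClosed S) {u : E} (hu : u ∈ S)
    {A : Set E} (hA : MeasurableSet A) : stepMeasure S u A = stepProb S u A := by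
  rw [stepMeasure, withDensity_apply _ hA, stepProb_eq_lintegral hS hu hA]

theorem isProbabilityMeasure_stepMeasure [Nontrivial E] {S : Set E} (hS : IsClosed S)
    (hSb : Bornology.IsBounded S) {u : E} {ε : ℝ} (hε : 0 < ε) (hball : closedBall u ε ⊆ S) :
    IsProbabilityMeasure (stepMeasure S u) :=
  ⟨by rw [stepMeasure_apply hS (hball (mem_closedBall_self hε.le)) MeasurableSet.univ,
    stepProb_univ hSb hε hball]⟩

/-- A closed ball of radius less than `stepRadius S u` has probability less than `1 / 8`, and these
balls exhaust the open ball. -/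
theorem stepMeasure_ball_stepRadius_le [Nontrivial E] {S : Set E} (hS : IsClosed S) {u : E}
    (hu : u ∈ S) : stepMeasure S u (ball u (stepRadius S u)) ≤ 1 / 8 := by
  set F := stepRadius S u with hF
  have hlt : ∀ r < F, stepMeasure S u (closedBall u r) ≤ 1 / 8 := by
    intro r hr
    rw [stepMeasure_apply hS hu isClosed_closedBall.measurableSet]
    by_contra! h
    refine absurd (csInf_le ⟨0, fun s hs => ?_⟩ (show r ∈ {r : ℝ | 1 / 8 ≤
      stepProb S u (closedBall u r)} from h.le)) (not_le.2 hr)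
    by_contra! hs0
    have hs' : (1 / 8 : ℝ≥0∞) ≤ stepProb S u (closedBall u s) := hs
    rw [closedBall_eq_empty.2 hs0] at hs'
    simp [stepProb] at hs'
  have hU : ball u F = ⋃ n : ℕ, closedBall u (F - 1 / ((n : ℝ) + 1)) := by
    ext x
    simp only [mem_ball, mem_iUnion, mem_closedBall]
    constructor
    · intro h
      obtain ⟨n, hn⟩ := exists_nat_one_div_lt (sub_pos.2 h)
      exact ⟨n, by linarith⟩
    · rintro ⟨n, hn⟩
      have : 0 < 1 / ((n : ℝ) + 1) := by positivity
      linarith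
  have hmono : Monotone fun n : ℕ => closedBall u (F - 1 / ((n : ℝ) + 1)) := by
    intro n m hnm
    refine closedBall_subset_closedBall ?_
    have := Nat.one_div_le_one_div (α := ℝ) hnm
    linarith
  rw [hU, hmono.measure_iUnion]
  refine iSup_le fun n => hlt _ ?_
  have : 0 < 1 / ((n : ℝ) + 1) := by positivity
  linarith

/-- The direction of a step is nearly orthogonal to a given one with high probability, by
Chebyshev's inequality. -/
theorem stepProb_inner_le [Nontrivial E] {S : Set E} {u e : E} (he : ‖e‖ = 1) :
    stepProb S u {x | 2 / √(Module.finrank ℝ E) * ‖x - u‖ < |inner ℝ (x - u) e|} ≤ 1 / 4 := by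
  set d := Module.finrank ℝ E with hd
  have hd0 : 0 < d := Module.finrank_pos
  have hdr : (0 : ℝ) < d := by exact_mod_cast hd0
  set σ := (volume : Measure E).toSphere with hσ
  set c : Set (sphere (0 : E) 1) := {θ | 2 / √d < |inner ℝ (θ : E) e|} with hc
  have hcm : MeasurableSet c :=
    (isOpen_lt continuous_const (by fun_prop)).measurableSet
  have hle : ∀ θ : sphere (0 : E) 1, volume (chordParams S u θ ∩ {t : ℝ | u + t • (θ : E) ∈
      {x | 2 / √d * ‖x - u‖ < |inner ℝ (x - u) e|}}) / volume (chordParams S u θ) ≤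
      c.indicator 1 θ := by
    intro θ
    by_cases hθ : θ ∈ c
    · rw [indicator_of_mem hθ]
      exact (ENNReal.div_le_div_right (measure_mono inter_subset_left) _).trans
        ENNReal.div_self_le_one
    · have hempty : {t : ℝ | u + t • (θ : E) ∈
          {x | 2 / √d * ‖x - u‖ < |inner ℝ (x - u) e|}} = ∅ := by
        refine eq_empty_of_forall_notMem fun t ht => hθ ?_
        have ht : 2 / √d * ‖u + t • (θ : E) - u‖ < |inner ℝ (u + t • (θ : E) - u) e| := ht
        rw [add_sub_cancel_left, norm_smul, norm_eq_of_mem_sphere θ, mul_one, inner_smul_left,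
          conj_trivial, abs_mul, Real.norm_eq_abs, mul_comm] at ht
        exact lt_of_mul_lt_mul_left ht (abs_nonneg t)
      rw [indicator_of_notMem hθ, hempty, inter_empty, measure_empty, ENNReal.zero_div]
  have hmarkov : 4 * σ c ≤ σ univ := by
    have h1 := mul_meas_ge_le_lintegral (μ := σ) (f := fun θ : sphere (0 : E) 1 =>
      ENNReal.ofReal (inner ℝ (θ : E) e ^ 2)) (by fun_prop) (ENNReal.ofReal (4 / d))
    have h2 : c ⊆ {θ : sphere (0 : E) 1 | ENNReal.ofReal (4 / d) ≤
        ENNReal.ofReal (inner ℝ (θ : E) e ^ 2)} := by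
      intro θ hθ
      have hθ : 2 / √d < |inner ℝ (θ : E) e| := hθ
      refine ENNReal.ofReal_le_ofReal ?_
      have h3 := pow_le_pow_left₀ (by positivity) hθ.le 2
      rw [sq_abs, div_pow, Real.sq_sqrt hdr.le] at h3
      linarith
    have h4 : (4 : ℝ≥0∞) = d * ENNReal.ofReal (4 / d) := by
      rw [← ENNReal.ofReal_natCast, ← ENNReal.ofReal_mul hdr.le, mul_div_cancel₀ _ hdr.ne']
      simp
    calc 4 * σ c = d * (ENNReal.ofReal (4 / d) * σ c) := by rw [← mul_assoc, ← h4]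
      _ ≤ d * (ENNReal.ofReal (4 / d) * σ {θ : sphere (0 : E) 1 | ENNReal.ofReal (4 / d) ≤
          ENNReal.ofReal (inner ℝ (θ : E) e ^ 2)}) := by gcongr
      _ ≤ d * ∫⁻ θ : sphere (0 : E) 1, ENNReal.ofReal (inner ℝ (θ : E) e ^ 2) ∂σ := by gcongr
      _ = σ univ := lintegral_inner_sq_toSphere he
  have hσ0 : σ univ ≠ 0 := sphereArea_ne_zero
  have hσt : σ univ ≠ ⊤ := sphereArea_ne_top
  unfold stepProb
  simp only
  calc _ ≤ (∫⁻ θ, c.indicator 1 θ ∂σ) / σ univ :=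
        ENNReal.div_le_div_right (lintegral_mono hle) _
    _ = σ c / σ univ := by rw [lintegral_indicator_one hcm]
    _ ≤ 1 / 4 := by
        rw [ENNReal.div_le_iff hσ0 hσt, mul_comm, ← mul_div_assoc, mul_one]
        rw [ENNReal.le_div_iff_mul_le (Or.inl (by norm_num)) (Or.inl (by norm_num)), mul_comm]
        exact hmarkov

/-- The densities of the steps from two points are comparable at a point that both of them see. -/
theorem mul_stepDensity_le [Nontrivial E] {S : Set E} (hSb : Bornology.IsBounded S) {u v x : E}
    {ε C : ℝ} (hε : 0 < ε) (hball : closedBall u ε ⊆ S) (hv : v ∈ S) (hC : 0 < C)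
    (hD : 0 < diam S) (hux : x ≠ u)
    (hsees : Sees S u x → Sees S v x)
    (hle : ‖x - v‖ ^ (Module.finrank ℝ E - 1) ≤ C * ‖x - u‖ ^ (Module.finrank ℝ E - 1)) :
    ENNReal.ofReal (2 * ε / (diam S * C)) * stepDensity S u x ≤ stepDensity S v x := by
  by_cases hs : Sees S u x
  swap
  · rw [stepDensity, indicator_of_notMem (s := {x | Sees S u x}) hs, mul_zero]
    exact zero_le
  set d := Module.finrank ℝ E with hd
  obtain ⟨k, hk⟩ := Nat.exists_eq_succ_of_ne_zero (Module.finrank_pos (R := ℝ) (M := E)).ne'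
  have hdk : d = k + 1 := hk
  rw [hdk, Nat.add_sub_cancel] at hle
  rw [stepDensity, stepDensity, indicator_of_mem (s := {x | Sees S u x}) hs,
    indicator_of_mem (s := {x | Sees S v x}) (hsees hs), ← hd, hdk]
  by_cases hvx : x = v
  · subst hvx
    have h0 : (2 : ℝ≥0∞) / 0 = ⊤ := ENNReal.div_zero two_ne_zero
    simp [h0]
  have ha : 0 < ‖x - u‖ := norm_pos_iff.2 (sub_ne_zero.2 hux)
  have hb : 0 < ‖x - v‖ := norm_pos_iff.2 (sub_ne_zero.2 hvx)
  set a := ‖x - u‖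
  set b := ‖x - v‖
  have h1 : sphereArea E * ENNReal.ofReal (2 * ε * a ^ k) ≤
      sphereArea E * volume (chordParams S u (x - u)) * ENNReal.ofReal (a ^ (k + 1)) := by
    have h2 := ofReal_le_volume_chordParams hε hball (sub_ne_zero.2 hux)
    calc _ = sphereArea E * ENNReal.ofReal (2 * ε / a) * ENNReal.ofReal (a ^ (k + 1)) := by
          rw [mul_assoc (sphereArea E), ← ENNReal.ofReal_mul (by positivity)]
          congr 2
          field_simp
          ring
      _ ≤ _ := by gcongr
  have h2 : sphereArea E * volume (chordParams S v (x - v)) * ENNReal.ofReal (b ^ (k + 1)) ≤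
      sphereArea E * ENNReal.ofReal (diam S * b ^ k) := by
    have h3 := volume_chordParams_le hSb hv (sub_ne_zero.2 hvx)
    calc _ ≤ sphereArea E * ENNReal.ofReal (diam S / b) * ENNReal.ofReal (b ^ (k + 1)) := by
          gcongr
      _ = _ := by
          rw [mul_assoc (sphereArea E), ← ENNReal.ofReal_mul (by positivity)]
          congr 2
          field_simp
          ring
  have hσ0 : sphereArea E ≠ 0 := sphereArea_ne_zero
  have hσt : sphereArea E ≠ ⊤ := sphereArea_ne_top
  have h3 : ∀ X : ℝ, 0 < X → 2 / (sphereArea E * ENNReal.ofReal X) =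
      2 * (sphereArea E)⁻¹ * ENNReal.ofReal X⁻¹ := fun X hX => by
    rw [div_eq_mul_inv, ENNReal.mul_inv (Or.inl hσ0) (Or.inl hσt), ENNReal.ofReal_inv_of_pos hX,
      mul_assoc]
  calc _ ≤ ENNReal.ofReal (2 * ε / (diam S * C)) *
        (2 / (sphereArea E * ENNReal.ofReal (2 * ε * a ^ k))) := by gcongr
    _ = 2 * (sphereArea E)⁻¹ * ENNReal.ofReal (2 * ε / (diam S * C) * (2 * ε * a ^ k)⁻¹) := by
        rw [h3 _ (by positivity), ENNReal.ofReal_mul (by positivity)]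
        ring
    _ ≤ 2 * (sphereArea E)⁻¹ * ENNReal.ofReal (diam S * b ^ k)⁻¹ := by
        gcongr
        have h4 : 2 * ε / (diam S * C) * (2 * ε * a ^ k)⁻¹ = (diam S * (C * a ^ k))⁻¹ := by
          field_simp
        rw [h4]
        gcongr
    _ = 2 / (sphereArea E * ENNReal.ofReal (diam S * b ^ k)) := (h3 _ (by positivity)).symm
    _ ≤ _ := by gcongr

/-- If the density of the step from `v` is at least `c` times that of the step from `u` outside of
a set `B`, then these steps can be coupled with probability at least `c` outside of `B`. -/
theorem stepTV_le_of_mul_stepDensity_le [Nontrivial E] {S : Set E} (hS : IsClosed S)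
    (hSb : Bornology.IsBounded S) {u v : E} {ε : ℝ} (hε : 0 < ε) (hballu : closedBall u ε ⊆ S)
    (hballv : closedBall v ε ⊆ S) {B : Set E} (hB : MeasurableSet B) {c : ℝ} (hc0 : 0 ≤ c)
    (hc1 : c ≤ 1) (hle : ∀ x ∉ B, ENNReal.ofReal c * stepDensity S u x ≤ stepDensity S v x) :
    stepTV S u v ≤ 1 - c * (1 - (stepMeasure S u).real B) := by
  have hu : u ∈ S := hballu (mem_closedBall_self hε.le)
  have hv : v ∈ S := hballv (mem_closedBall_self hε.le)
  have := isProbabilityMeasure_stepMeasure hS hSb hε hballu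
  have := isProbabilityMeasure_stepMeasure hS hSb hε hballv
  set P := stepMeasure S u with hP
  set Q := stepMeasure S v with hQ
  have hkey : ∀ A, MeasurableSet A → P.real A - Q.real A ≤ 1 - c * (1 - P.real B) := by
    intro A hA
    have h1 : c * P.real (A \ B) ≤ Q.real A := by
      have h2 : ENNReal.ofReal c * P (A \ B) ≤ Q A := by
        calc _ = ∫⁻ x in A \ B, ENNReal.ofReal c * stepDensity S u x := by
              rw [hP, stepMeasure, withDensity_apply _ (MeasurableSet.diff hA hB),
                lintegral_const_mul _ (measurable_stepDensity hS hu)]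
          _ ≤ ∫⁻ x in A \ B, stepDensity S v x :=
              setLIntegral_mono (measurable_stepDensity hS hv) fun x hx => hle x hx.2
          _ = Q (A \ B) := by rw [hQ, stepMeasure, withDensity_apply _ (MeasurableSet.diff hA hB)]
          _ ≤ Q A := measure_mono sdiff_subset
      have h3 := ENNReal.toReal_mono (measure_ne_top Q A) h2
      rwa [ENNReal.toReal_mul, ENNReal.toReal_ofReal hc0] at h3
    have h2 : P.real A + P.real (Aᶜ \ B) ≤ 1 := by
      rw [← measureReal_union (disjoint_left.2 fun x hx hx' => hx'.1 hx)
        (MeasurableSet.diff hA.compl hB)]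
      exact measureReal_le_one
    have h3 : 1 - P.real B = P.real (A \ B) + P.real (Aᶜ \ B) := by
      rw [← probReal_compl_eq_one_sub hB, ← measureReal_union (disjoint_left.2 fun x hx hx' =>
        hx'.1 hx.1) (MeasurableSet.diff hA.compl hB), ← union_sdiff_distrib, union_compl_self,
        compl_eq_univ_sdiff]
    rw [h3]
    have h4 := mul_le_mul_of_nonneg_right hc1 (measureReal_nonneg (μ := P) (s := Aᶜ \ B))
    nlinarith
  unfold stepTV
  have : Nonempty {A : Set E // MeasurableSet A} := ⟨⟨∅, MeasurableSet.empty⟩⟩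
  refine ciSup_le fun A => ?_
  rw [← stepMeasure_apply hS hu A.2, ← stepMeasure_apply hS hv A.2]
  change |P.real A.1 - Q.real A.1| ≤ _
  rw [abs_le]
  have h1 := hkey A.1 A.2
  have h2 := hkey A.1ᶜ A.2.compl
  rw [probReal_compl_eq_one_sub A.2, probReal_compl_eq_one_sub A.2] at h2
  constructor <;> linarith

theorem stepTV_self (S : Set E) (u : E) : stepTV S u u = 0 := by
  simp [stepTV]

end

/-! ### The total variation distance -/

section

theorem closedBall_subset_of_mem_innerPart {S : Set E} (hS : IsClosed S) {ε : ℝ} (hε : 0 < ε)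
    {u : E} (hu : u ∈ innerPart S ε) : closedBall u ε ⊆ S := by
  rw [← closure_ball u hε.ne']
  refine hS.closure_subset_iff.2 ?_
  by_contra h
  obtain ⟨x, hx, hxS⟩ := not_subset.1 h
  obtain ⟨y, hy, hyf⟩ := inter_frontier_nonempty_of_isPreconnected
    (convex_ball u ε).isPreconnected ⟨u, mem_ball_self hε, hu.1⟩ ⟨x, hx, hxS⟩
  exact absurd (mem_ball'.1 hy) (not_lt.2 (hu.2.trans (infDist_le_dist_of_mem hyf)))

theorem two_mul_le_diam [Nontrivial E] {S : Set E} (hSb : Bornology.IsBounded S) {u : E} {ε : ℝ}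
    (hε : 0 < ε) (hball : closedBall u ε ⊆ S) : 2 * ε ≤ diam S := by
  obtain ⟨w, hw⟩ := exists_norm_eq E hε.le
  have h := dist_le_diam_of_mem hSb (x := u + w) (y := u - w)
    (hball (by simp [hw])) (hball (by simp [hw]))
  rwa [dist_eq_norm, show u + w - (u - w) = (2 : ℝ) • w by module, norm_smul, hw,
    Real.norm_of_nonneg zero_le_two] at h

/-- In a plane, the supremum over all planes is attained, trivially, at the only one. -/
theorem curvatureConst_eq_of_finrank_eq_two [MeasurableSpace E] [BorelSpace E]
    (hdim : Module.finrank ℝ E = 2) (S : Set E) :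
    curvatureConst S = maxCurvature (frontier S) * μH[1] (frontier S) := by
  refine le_antisymm (iSup_le fun H => ?_) ?_
  · gcongr
    · refine sSup_le_sSup ?_
      rintro k ⟨γ, a, b, hγ, hmem, ht⟩
      exact ⟨γ, a, b, hγ, fun t ht => ⟨(hmem t ht).1.1, (hmem t ht).2⟩, ht⟩
    · exact inter_subset_left
  · have h := le_iSup (fun H : {H : AffineSubspace ℝ E // Module.finrank ℝ H.direction = 2} =>
      maxCurvature (frontier S ∩ (H.1 : Set E)) * μH[1] (frontier S ∩ (H.1 : Set E)))
      ⟨⊤, by rw [AffineSubspace.direction_top, finrank_top, hdim]⟩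
    simpa [curvatureConst] using h

variable [MeasurableSpace E] [BorelSpace E] [FiniteDimensional ℝ E]

theorem HasBilipschitzEmbedding.isCompact {S : Set E} (h : HasBilipschitzEmbedding S) :
    IsCompact S := by
  obtain ⟨Ω, g, LΩ, LS, hΩ, -, -, hLS, rfl, hg, -⟩ := h
  exact hΩ.image_of_continuousOn (LipschitzOnWith.of_dist_le_mul (K := ⟨LS, hLS.le⟩)
    fun x hx y hy => (hg x hx y hy).2).continuousOn

/-- In dimension at least three, where `S` is locally convex, the step can only be lost inside of
the small ball about `u`, or along the directions that are close to that of `v - u`. -/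
theorem stepTV_le_of_locally_convex (hdim : 3 ≤ Module.finrank ℝ E) {S : Set E} (hS : IsClosed S)
    (hSb : Bornology.IsBounded S) (hloc : ∀ p ∈ S, ∃ r > 0, Convex ℝ (S ∩ ball p r)) {u v : E}
    {ε : ℝ} (hε : 0 < ε) (hballu : closedBall u ε ⊆ S) (hballv : closedBall v ε ⊆ S)
    (hsee : Sees S u v) (huv : u ≠ v)
    (hF : dist u v * √(Module.finrank ℝ E) < 2 * stepRadius S u) :
    stepTV S u v ≤ 1 - 2 * ε / (diam S * Real.exp 6) * (5 / 8) := by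
  have : Nontrivial E := Module.nontrivial_of_finrank_pos (R := ℝ) (by omega)
  set d := Module.finrank ℝ E with hd
  have hd0 : (0 : ℝ) < d := by exact_mod_cast (by omega : 0 < d)
  have hsd : 0 < √(d : ℝ) := Real.sqrt_pos.2 hd0
  have hu : u ∈ S := hballu (mem_closedBall_self hε.le)
  have hv : v ∈ S := hballv (mem_closedBall_self hε.le)
  have hvi : v ∈ interior S :=
    mem_interior_iff_mem_nhds.2 (mem_of_superset (closedBall_mem_nhds v hε) hballv)
  have := isProbabilityMeasure_stepMeasure hS hSb hε hballu
  have hDε := two_mul_le_diam hSb hε hballu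
  have hD : 0 < diam S := by linarith
  have hδ0 : 0 < dist u v := dist_pos.2 huv
  set δ := dist u v with hδ
  set F := stepRadius S u with hFdef
  have hF0 : 0 < F := by nlinarith [mul_pos hδ0 hsd]
  set e : E := δ⁻¹ • (u - v) with he
  have he1 : ‖e‖ = 1 := by
    rw [he, norm_smul, ← dist_eq_norm, ← hδ, Real.norm_of_nonneg (by positivity),
      inv_mul_cancel₀ hδ0.ne']
  have hue : u - v = δ • e := by rw [he, smul_smul, mul_inv_cancel₀ hδ0.ne', one_smul]
  set B₂ : Set E := {x | 2 / √d * ‖x - u‖ < |inner ℝ (x - u) e|} with hB₂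
  have hB₂m : MeasurableSet B₂ := (isOpen_lt (by fun_prop) (by fun_prop)).measurableSet
  have hBm : MeasurableSet (ball u F ∪ B₂) := measurableSet_ball.union hB₂m
  have hPB : (stepMeasure S u).real (ball u F ∪ B₂) ≤ 3 / 8 := by
    have h1 : stepMeasure S u (ball u F ∪ B₂) ≤ ENNReal.ofReal (3 / 8) := by
      calc _ ≤ stepMeasure S u (ball u F) + stepMeasure S u B₂ := measure_union_le _ _
        _ ≤ 1 / 8 + 1 / 4 := by
            gcongr
            · exact stepMeasure_ball_stepRadius_le hS hu
            · rw [stepMeasure_apply hS hu hB₂m]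
              exact stepProb_inner_le he1
        _ = ENNReal.ofReal (1 / 8) + ENNReal.ofReal (1 / 4) := by
            rw [ENNReal.ofReal_div_of_pos (by norm_num), ENNReal.ofReal_div_of_pos (by norm_num)]
            norm_num
        _ = ENNReal.ofReal (3 / 8) := by
            rw [← ENNReal.ofReal_add (by norm_num) (by norm_num)]
            norm_num
    exact (ENNReal.toReal_mono ENNReal.ofReal_ne_top h1).trans
      (ENNReal.toReal_ofReal (by norm_num)).le
  have hc1 : 2 * ε / (diam S * Real.exp 6) ≤ 1 := by
    rw [div_le_one (by positivity)]
    nlinarith [Real.one_le_exp (show (0 : ℝ) ≤ 6 by norm_num)]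
  refine (stepTV_le_of_mul_stepDensity_le hS hSb hε hballu hballv hBm (by positivity) hc1
    fun x hx => ?_).trans ?_
  · rw [mem_union, not_or, mem_ball, not_lt, dist_eq_norm] at hx
    obtain ⟨hx1, hx2⟩ := hx
    have hx2 : |inner ℝ (x - u) e| ≤ 2 / √d * ‖x - u‖ := not_lt.1 hx2
    have ha : 0 < ‖x - u‖ := hF0.trans_le hx1
    refine mul_stepDensity_le hSb hε hballu hv (Real.exp_pos 6) hD
      (fun h => ha.ne' (by rw [h, sub_self, norm_zero]))
      (hsee.trans_of_locally_convex hS hloc hvi) ?_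
    rw [← hd]
    set a := ‖x - u‖
    have hδa : δ ≤ 2 / √d * a := by
      rw [div_mul_eq_mul_div, le_div_iff₀ hsd]
      linarith
    have hsq : ‖x - v‖ ^ 2 ≤ (1 + 12 / d) * a ^ 2 := by
      have h1 : ‖x - v‖ ^ 2 = a ^ 2 + 2 * (δ * inner ℝ (x - u) e) + δ ^ 2 := by
        rw [← sub_add_sub_cancel x u v, norm_add_sq_real, hue, inner_smul_right, norm_smul, he1,
          mul_one, Real.norm_of_nonneg hδ0.le]
      have h2 : δ * inner ℝ (x - u) e ≤ (2 / √d * a) * (2 / √d * a) :=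
        (mul_le_mul_of_nonneg_left ((le_abs_self _).trans hx2) hδ0.le).trans
          (mul_le_mul_of_nonneg_right hδa (by positivity))
      have h3 : δ ^ 2 ≤ (2 / √d * a) ^ 2 := pow_le_pow_left₀ hδ0.le hδa 2
      have h4 : (2 / √d * a) ^ 2 = 4 / d * a ^ 2 := by
        rw [mul_pow, div_pow, Real.sq_sqrt hd0.le]
        norm_num
      calc _ ≤ a ^ 2 + 3 * (2 / √d * a) ^ 2 := by rw [h1]; nlinarith
        _ = _ := by rw [h4]; ring
    have hexp : (1 + 12 / (d : ℝ)) ^ (d - 1) ≤ Real.exp 12 := by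
      calc (1 + 12 / (d : ℝ)) ^ (d - 1) ≤ (1 + 12 / (d : ℝ)) ^ d :=
            pow_le_pow_right₀ (by linarith [div_nonneg (by norm_num : (0 : ℝ) ≤ 12) hd0.le])
              (Nat.sub_le _ _)
        _ ≤ Real.exp (12 / d) ^ d := by
            gcongr
            linarith [Real.add_one_le_exp (12 / (d : ℝ))]
        _ = Real.exp 12 := by
            rw [← Real.exp_nat_mul, mul_div_cancel₀ _ hd0.ne']
    refine le_of_sq_le_sq ?_ (by positivity)
    calc (‖x - v‖ ^ (d - 1)) ^ 2 = (‖x - v‖ ^ 2) ^ (d - 1) := by ring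
      _ ≤ ((1 + 12 / d) * a ^ 2) ^ (d - 1) := by gcongr
      _ = (1 + 12 / (d : ℝ)) ^ (d - 1) * (a ^ 2) ^ (d - 1) := mul_pow _ _ _
      _ ≤ Real.exp 12 * (a ^ 2) ^ (d - 1) := by gcongr
      _ = (Real.exp 6 * a ^ (d - 1)) ^ 2 := by
          rw [mul_pow, ← Real.exp_nat_mul, ← pow_mul, ← pow_mul, mul_comm 2]
          norm_num
  · have : 0 ≤ 2 * ε / (diam S * Real.exp 6) := by positivity
    nlinarith

/-- In the plane, the step is lost inside of the small ball about `u`, or at the points that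
cannot be seen from `v`. -/
theorem stepTV_le_of_finrank_eq_two (hdim : Module.finrank ℝ E = 2) {S : Set E}
    (hS : IsClosed S) (hSb : Bornology.IsBounded S) (hC : HasC2Boundary S) {u v : E}
    {ε K R : ℝ} (hε : 0 < ε) (hballu : closedBall u ε ⊆ S) (hballv : closedBall v ε ⊆ S)
    (huv : u ≠ v) (hK : 0 < K) (hcurv : maxCurvature (frontier S) ≤ ENNReal.ofReal K)
    (hR : 0 ≤ R) (hlen : μH[1] (frontier S) ≤ ENNReal.ofReal R) (hδε : 7 * dist u v < ε)
    (hKR : 15 * (dist u v * (K * R)) ≤ ε) (hF : dist u v * √2 < 2 * stepRadius S u) :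
    stepTV S u v ≤ 1 - 2 * ε / (diam S * (5 / 2)) * (51 / 200) := by
  have : Nontrivial E := Module.nontrivial_of_finrank_pos (R := ℝ) (by omega)
  have hu : u ∈ S := hballu (mem_closedBall_self hε.le)
  have hv : v ∈ S := hballv (mem_closedBall_self hε.le)
  have := isProbabilityMeasure_stepMeasure hS hSb hε hballu
  have hDε := two_mul_le_diam hSb hε hballu
  have hD : 0 < diam S := by linarith
  have hδ0 : 0 < dist u v := dist_pos.2 huv
  set δ := dist u v with hδ
  set F := stepRadius S u with hFdef
  have hF0 : 0 < F := by nlinarith [mul_pos hδ0 (Real.sqrt_pos.2 (zero_lt_two (α := ℝ)))]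
  set B₂ : Set E := {x | ¬ Sees S v x} with hB₂
  have hB₂m : MeasurableSet B₂ := (isClosed_setOf_sees hS v).measurableSet.compl
  have hBm : MeasurableSet (ball u F ∪ B₂) := measurableSet_ball.union hB₂m
  have hPB : (stepMeasure S u).real (ball u F ∪ B₂) ≤ 149 / 200 := by
    have h1 : stepMeasure S u (ball u F ∪ B₂) ≤ ENNReal.ofReal (149 / 200) := by
      calc _ ≤ stepMeasure S u (ball u F) + stepMeasure S u B₂ := measure_union_le _ _
        _ ≤ 1 / 8 + ENNReal.ofReal (62 / 100) := by
            gcongr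
            · exact stepMeasure_ball_stepRadius_le hS hu
            · rw [stepMeasure_apply hS hu hB₂m]
              exact stepProb_not_sees_le hdim hS hSb hC hK hcurv hR hlen hε hballu huv hδε hKR
        _ = ENNReal.ofReal (1 / 8) + ENNReal.ofReal (62 / 100) := by
            rw [ENNReal.ofReal_div_of_pos (x := 1) (by norm_num)]
            norm_num
        _ = ENNReal.ofReal (149 / 200) := by
            rw [← ENNReal.ofReal_add (by norm_num) (by norm_num)]
            norm_num
    exact (ENNReal.toReal_mono ENNReal.ofReal_ne_top h1).trans
      (ENNReal.toReal_ofReal (by norm_num)).le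
  have hc1 : 2 * ε / (diam S * (5 / 2)) ≤ 1 := by
    rw [div_le_one (by positivity)]
    linarith
  refine (stepTV_le_of_mul_stepDensity_le hS hSb hε hballu hballv hBm (by positivity) hc1
    fun x hx => ?_).trans ?_
  · rw [mem_union, not_or, mem_ball, not_lt, dist_eq_norm] at hx
    obtain ⟨hx1, hx2⟩ := hx
    have ha : 0 < ‖x - u‖ := hF0.trans_le hx1
    refine mul_stepDensity_le hSb hε hballu hv (by norm_num) hD
      (fun h => ha.ne' (by rw [h, sub_self, norm_zero])) (fun _ => not_not.1 hx2) ?_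
    rw [hdim, Nat.add_one_sub_one, pow_one, pow_one]
    have h1 : ‖x - v‖ ≤ ‖x - u‖ + δ := by
      rw [hδ, dist_eq_norm, ← sub_add_sub_cancel x u v]
      exact norm_add_le _ _
    have h2 : 4 / 3 ≤ √(2 : ℝ) := Real.le_sqrt_of_sq_le (by norm_num)
    nlinarith [mul_le_mul_of_nonneg_left h2 hδ0.le]
  · have : 0 ≤ 2 * ε / (diam S * (5 / 2)) := by positivity
    nlinarith

end

end HitAndRun

end

theorem mainTheorem3 {n : ℕ} (hn : 2 ≤ n) (S : Set (EuclideanSpace ℝ (Fin n)))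
    (hmap : HitAndRun.HasBilipschitzEmbedding S)
    (hsmooth : HitAndRun.HasC2Boundary S)
    (hcurv : HitAndRun.curvatureConst S ≠ ⊤)
    (ε : ℝ) (hε : 0 < ε) (u v : EuclideanSpace ℝ (Fin n))
    (hu : u ∈ HitAndRun.innerPart S ε) (hv : v ∈ HitAndRun.innerPart S ε)
    (hsee : HitAndRun.Sees S u v)
    (hcross : HitAndRun.crossRatioDist S u v < ε / (24 * Metric.diam S))
    (hdist : dist u v < min (2 * HitAndRun.stepRadius S u / √(n : ℝ))
      (ε / 6 * min (Real.pi / 4)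
        (Real.sin (Real.pi / 8) / (HitAndRun.curvatureConst S).toReal))) :
    HitAndRun.stepTV S u v < 1 - ε / (8 * Real.exp 4 * Metric.diam S) := by
  have hdim : Module.finrank ℝ (EuclideanSpace ℝ (Fin n)) = n := finrank_euclideanSpace_fin
  have : Nontrivial (EuclideanSpace ℝ (Fin n)) :=
    Module.nontrivial_of_finrank_pos (R := ℝ) (by omega)
  have hS : IsClosed S := hmap.isCompact.isClosed
  have hSb : Bornology.IsBounded S := hmap.isCompact.isBounded
  have hballu := HitAndRun.closedBall_subset_of_mem_innerPart hS hε hu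
  have hballv := HitAndRun.closedBall_subset_of_mem_innerPart hS hε hv
  have hDε := HitAndRun.two_mul_le_diam hSb hε hballu
  have hD : 0 < Metric.diam S := by linarith
  set D := Metric.diam S with hDdef
  have he4 : 1 ≤ Real.exp 4 := Real.one_le_exp (by norm_num)
  have hq0 : 0 < ε / D := by positivity
  have hsplit : ε / (8 * Real.exp 4 * D) = 1 / (8 * Real.exp 4) * (ε / D) := by
    field_simp
  have h8 : 1 / (8 * Real.exp 4) ≤ 1 / 8 := by
    gcongr
    linarith
  have hF : dist u v * √(n : ℝ) < 2 * HitAndRun.stepRadius S u := by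
    have hn0 : (0 : ℝ) < n := by exact_mod_cast (by omega : 0 < n)
    exact (lt_div_iff₀ (Real.sqrt_pos.2 hn0)).1 (hdist.trans_le (min_le_left _ _))
  rcases eq_or_ne u v with rfl | huv
  · rw [HitAndRun.stepTV_self, hsplit]
    have : ε / D ≤ 1 := by
      rw [div_le_one hD]
      linarith
    nlinarith
  rcases hn.eq_or_lt with rfl | hn3
  · have h2 := hdist.trans_le (min_le_right _ _)
    set κ := HitAndRun.curvatureConst S with hκ
    have hδ0 : 0 < dist u v := dist_pos.2 huv
    have hδ1 : dist u v < ε / 6 * (Real.pi / 4) :=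
      h2.trans_le (mul_le_mul_of_nonneg_left (min_le_left _ _) (by positivity))
    have hδ2 : dist u v < ε / 6 * (Real.sin (Real.pi / 8) / κ.toReal) :=
      h2.trans_le (mul_le_mul_of_nonneg_left (min_le_right _ _) (by positivity))
    -- for `κ = 0` the quotient by `κ` is zero by convention, and `dist u v` would be negative
    have hκ0 : 0 < κ.toReal := by
      refine ENNReal.toReal_nonneg.lt_of_ne' fun h => ?_
      rw [h, div_zero, mul_zero] at hδ2
      linarith
    have hprod := HitAndRun.curvatureConst_eq_of_finrank_eq_two hdim S
    rw [← hκ] at hprod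
    set k := HitAndRun.maxCurvature (frontier S)
    set m := MeasureTheory.Measure.hausdorffMeasure (1 : ℝ) (frontier S)
    have hκ0' : k * m ≠ 0 := by
      rw [← hprod]
      exact (ENNReal.toReal_pos_iff.1 hκ0).1.ne'
    obtain ⟨hk0, hm0⟩ := mul_ne_zero_iff.1 hκ0'
    have hkt : k ≠ ⊤ := fun h => hcurv (by rw [hprod, h, ENNReal.top_mul hm0])
    have hmt : m ≠ ⊤ := fun h => hcurv (by rw [hprod, h, ENNReal.mul_top hk0])
    have hπ := Real.pi_lt_d2
    have hκδ : 15 * (dist u v * (k.toReal * m.toReal)) ≤ ε := by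
      rw [← ENNReal.toReal_mul, ← hprod]
      have h3 : dist u v * κ.toReal < ε / 6 * Real.sin (Real.pi / 8) := by
        rw [← mul_div_assoc] at hδ2
        exact (lt_div_iff₀ hκ0).1 hδ2
      have h4 : Real.sin (Real.pi / 8) ≤ Real.pi / 8 := Real.sin_le (by positivity)
      nlinarith
    refine (HitAndRun.stepTV_le_of_finrank_eq_two hdim hS hSb hsmooth hε hballu hballv huv
      (ENNReal.toReal_pos hk0 hkt) (ENNReal.ofReal_toReal hkt).ge ENNReal.toReal_nonneg
      (ENNReal.ofReal_toReal hmt).ge (by nlinarith) hκδ (by simpa using hF)).trans_lt ?_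
    rw [hsplit, show 2 * ε / (D * (5 / 2)) = 4 / 5 * (ε / D) by field_simp; norm_num]
    nlinarith
  · refine (HitAndRun.stepTV_le_of_locally_convex (by omega) hS hSb
      (fun p hp => HitAndRun.exists_convex_inter_ball (by omega) hS hSb hsmooth hcurv hp) hε
      hballu hballv hsee huv (by rwa [hdim])).trans_lt ?_
    rw [hsplit, show 2 * ε / (D * Real.exp 6) * (5 / 8) = 5 / (4 * Real.exp 6) * (ε / D) by
      field_simp; norm_num]
    have h6 : 1 / (8 * Real.exp 4) < 5 / (4 * Real.exp 6) := by
      have h7 : Real.exp 6 = Real.exp 4 * Real.exp 1 ^ 2 := by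
        rw [← Real.exp_nat_mul, ← Real.exp_add]
        norm_num
      have h9 : Real.exp 1 ^ 2 < 10 := by
        have := Real.exp_one_lt_d9
        nlinarith [Real.exp_pos 1]
      rw [div_lt_div_iff₀ (by positivity) (by positivity), h7]
      nlinarith [Real.exp_pos 4]
    have := mul_lt_mul_of_pos_right h6 hq0
    linarith
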